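/- **Setting.** An environment on the arm space $[0,1]$ consists of a mean-payoff function $f:[0,1]\to[0,1]$ and of reward laws: when arm $x$ is played, the reward is drawn, independently of the past, from a probability law $\rho_x$ on $\mathbb R$ (depending measurably on $x$) that has mean $f(x)$ and is $(1/4)$-subgaussian around it, i.e. $\mathbb E_{Y\sim\rho_x}[e^{u(Y-f(x))}]\le e^{u^2/8}$ for all $u\in\mathbb R$. An algorithm chooses in each round $t$ an arm $X_t$ (possibly at random, with internal memory) from the past observations; its regret is $\overline R_T=T\max f-\mathbb E\big[\sum_{t=1}^T f(X_t)\big]$. For $\alpha,L>0$, $\mathcal H(L,\alpha)$ is the set of functions $f$ that have a maximum point $x^\star\in[0,1]$ with $|f(x^\star)-f(x)|\le L|x^\star-x|^\alpha$ for all $x\in[0,1]$. A rate function is a nonincreasing $\theta:(0,\infty)\to[0,1]$. An algorithm achieves $\theta$ if for all $\varepsilon,\alpha,L>0$, $\limsup_{T\to\infty} T^{-(\theta(\alpha)+\varepsilon)}\sup_{f\in\mathcal H(L,\alpha)}\overline R_T<+\infty$, the supremum being over all environments with mean-payoff function in $\mathcal H(L,\alpha)$. A rate function $\theta$ is admissible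 if some algorithm achieves it and no algorithm achieves a rate function $\theta'$ with $\theta'\le\theta$ everywhere and $\theta'(\alpha_0)<\theta(\alpha_0)$ for some $\alpha_0$. An algorithm is admissible if it achieves an admissible rate function. For $m\in[1/2,1]$ let $\theta_m(\alpha)=\max\big(m,\,1-m\frac{\alpha}{\alpha+1}\big)$. **The algorithm.** MOSS with $K$ arms and horizon $n$ pulls an arm of largest index $\hat\mu_a+\sqrt{\max(\log(n/(KN_a)),0)/N_a}$, where $N_a$ is the number of pulls of $a$ and $\hat\mu_a$ its empirical mean reward so far (the index is $+\infty$ if $N_a=0$), ties being broken by any fixed rule. MeDZO with input $B\ge 1$ sets $p=\lceil\log_2B\rceil$ and works in successive regimes $i=1,2,\dots$; regime $i$ lasts $2^{p+i}$ rounds and plays a fresh instance of MOSS with horizon $2^{p+i}$ on the following $K_i+i-1$ discrete arms, $K_i=2^{p+2-i}$: the uniform laws on the intervals $[(a-1)/K_i,a/K_i]$, $1\le a\le K_i$, and the empirical measures of the arms $X_t$ played in each of the regimes $1,\dots,i-1$; when MOSS selects a discrete arm, $X_t$ is drawn from the corresponding probability measure and the reward is given to MOSS. The doubling-trick MeDZO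 with input $m$ runs, for $k=0,1,2,\dots$, a fresh instance of MeDZO with input $B=2^{km}$ for $2^k$ rounds. **Statement.** For any $m\in[1/2,1]$, the doubling-trick MeDZO with input $m$ achieves the rate function $\theta_m$. For any $m\in[1/2,1)$, the rate function $\theta_m$ is admissible, and therefore so is the doubling-trick MeDZO with input $m$. -/

import Mathlib

open MeasureTheory ProbabilityTheory Filter Topology
open scoped ENNReal unitInterval

namespace XArmed

noncomputable section

/-! ### Environments, algorithms, regret -/

/-- A stochastic bandit environment on the arm space `[0,1]`: when arm `x` is played, the reward is
drawn, independently of the past, from `reward x`, which has mean `f x ∈ [0,1]` and is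
`(1/4)`-subgaussian around its mean (`E exp (u (Y - f x)) ≤ exp (u² / 8)`). -/
structure Environment where
  /-- the mean-payoff function -/
  f : I → ℝ
  f_mem : ∀ x, f x ∈ Set.Icc (0 : ℝ) 1
  /-- the law of the reward, given the arm -/
  reward : Kernel I ℝ
  markov : IsMarkovKernel reward
  mean_eq : ∀ x, ∫ y, y ∂(reward x) = f x
  subgaussian : ∀ x, HasSubgaussianMGF (fun y => y - f x) (1 / 4) (reward x)

/-- What is recorded in a round: an internal label `I_t` of the algorithm (a value which the player
may draw and remember, and which the environment ignores), the arm `X_t`, the reward `Y_t`. -/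
abbrev Obs : Type := ℕ × I × ℝ

/-- An algorithm: for each `t`, a probability kernel which, from the record of the first `t` rounds
(rounds are numbered from `0`), draws the label and the arm of the next round. -/
structure Algorithm where
  kernel : (t : ℕ) → Kernel (Fin t → Obs) (ℕ × I)
  markov : ∀ t, IsMarkovKernel (kernel t)

/-- One round: the algorithm draws `(I_t, X_t)`, then the environment draws `Y_t` given `X_t`. -/
def roundKernel (A : Algorithm) (E : Environment) (t : ℕ) :
    Kernel (Fin t → Obs) ((ℕ × I) × ℝ) :=
  A.kernel t ⊗ₖ E.reward.comap (fun p : (Fin t → Obs) × (ℕ × I) => p.2.2) (by fun_prop)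

/-- The law of the record of the first `t` rounds when `A` plays in `E`. -/
def law (A : Algorithm) (E : Environment) : (t : ℕ) → Measure (Fin t → Obs)
  | 0 => Measure.dirac Fin.elim0
  | t + 1 => (law A E t ⊗ₘ roundKernel A E t).map
      (fun p => Fin.snoc (α := fun _ => Obs) p.1 (p.2.1.1, p.2.1.2, p.2.2))

/-- The expected cumulative regret at time `T`, namely `T M(f) - E [∑_{t ≤ T} f (X_t)]`. -/
def regret (A : Algorithm) (E : Environment) (T : ℕ) : ℝ :=
  T * (⨆ x, E.f x) - ∫ h, ∑ t, E.f (h t).2.1 ∂(law A E T)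

/-- The functions which are `(L, α)`-Hölder around one of their maxima. -/
def HolderClass (L α : ℝ) : Set (I → ℝ) :=
  {f | ∃ x₀ : I, (∀ x, f x ≤ f x₀) ∧ ∀ x : I, |f x₀ - f x| ≤ L * |(x₀ : ℝ) - (x : ℝ)| ^ α}

/-- The worst-case regret at time `T` over the environments with mean-payoff function in the class
(the regret is nonnegative, so that `ENNReal.ofReal` does not truncate). -/
def worstRegret (A : Algorithm) (L α : ℝ) (T : ℕ) : ℝ≥0∞ :=
  ⨆ (E : Environment) (_ : E.f ∈ HolderClass L α), ENNReal.ofReal (regret A E T)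

/-! ### Rate functions and admissibility -/

/-- A rate function: a nonincreasing function from `(0, ∞)` to `[0, 1]`
(the values of `θ` outside `(0, ∞)` are never used). -/
def IsRateFunction (θ : ℝ → ℝ) : Prop :=
  AntitoneOn θ (Set.Ioi 0) ∧ ∀ α, 0 < α → θ α ∈ Set.Icc (0 : ℝ) 1

/-- The algorithm `A` achieves adaptive rates `θ`. -/
def Achieves (A : Algorithm) (θ : ℝ → ℝ) : Prop :=
  IsRateFunction θ ∧
    ∀ ε : ℝ, 0 < ε → ∀ α L : ℝ, 0 < α → 0 < L →
      limsup (fun T : ℕ => worstRegret A L α T / ENNReal.ofReal ((T : ℝ) ^ (θ α + ε))) atTop < ⊤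

/-- `θ'` is strictly smaller than `θ` for the pointwise order on `(0, ∞)`. -/
def StrictlySmaller (θ' θ : ℝ → ℝ) : Prop :=
  (∀ α, 0 < α → θ' α ≤ θ α) ∧ ∃ α, 0 < α ∧ θ' α < θ α

/-- A rate function is admissible if some algorithm achieves it and no algorithm achieves a
strictly smaller one. -/
def AdmissibleRate (θ : ℝ → ℝ) : Prop :=
  (∃ A : Algorithm, Achieves A θ) ∧
    ¬ ∃ (A : Algorithm) (θ' : ℝ → ℝ), Achieves A θ' ∧ StrictlySmaller θ' θ

/-- An algorithm is admissible if it achieves an admissible rate function. -/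
def Admissible (A : Algorithm) : Prop :=
  ∃ θ : ℝ → ℝ, AdmissibleRate θ ∧ Achieves A θ

/-- The rate function `θ_m`. -/
def theta (m α : ℝ) : ℝ := max m (1 - m * (α / (α + 1)))

/-! ### The finite-armed algorithm MOSS

The arms are `0, …, K - 1`, the horizon is `n`, and `g` is the list of the pairs
(arm pulled, reward) of the `r` rounds played so far. -/

/-- The number of pulls of arm `a`. -/
def pulls {r : ℕ} (g : Fin r → ℕ × ℝ) (a : ℕ) : ℕ :=
  (Finset.univ.filter fun s => (g s).1 = a).card

/-- The sum of the rewards obtained from arm `a`. -/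
def totalReward {r : ℕ} (g : Fin r → ℕ × ℝ) (a : ℕ) : ℝ :=
  ∑ s with (g s).1 = a, (g s).2

/-- The MOSS index of arm `a`: empirical mean plus `√(log₊ (n / (K N)) / N)`, where `N` is the
number of pulls; it is `+∞` for an arm not yet pulled. -/
def mossIndex (n K : ℕ) {r : ℕ} (g : Fin r → ℕ × ℝ) (a : ℕ) : EReal :=
  if pulls g a = 0 then ⊤ else
    ((totalReward g a / pulls g a +
      √(max (Real.log (n / (K * pulls g a))) 0 / pulls g a) : ℝ) : EReal)

open Classical in
/-- The arms of maximal index. -/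
def mossArgmax (n K : ℕ) {r : ℕ} (g : Fin r → ℕ × ℝ) : Finset ℕ :=
  (Finset.range K).filter fun a => ∀ b ∈ Finset.range K, mossIndex n K g b ≤ mossIndex n K g a

/-- The arm recommended by MOSS: one of maximal index, ties being broken by the rule `tie`. -/
def mossArm (tie : Finset ℕ → ℕ) (n K : ℕ) {r : ℕ} (g : Fin r → ℕ × ℝ) : ℕ :=
  tie (mossArgmax n K g)

/-! ### MeDZO -/

/-- The last round of regime `i` is followed by round `T_i = ∑_{j = 1}^{i} 2 ^ (p + j)`. -/
def regimeEnd (p i : ℕ) : ℕ := ∑ j ∈ Finset.Icc 1 i, 2 ^ (p + j)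

lemma exists_lt_regimeEnd (p s : ℕ) : ∃ i, s < regimeEnd p i := by
  refine ⟨s + 1, ?_⟩
  have h : ∑ _j ∈ Finset.Icc 1 (s + 1), 1 ≤ regimeEnd p (s + 1) :=
    Finset.sum_le_sum fun j _ => Nat.one_le_two_pow
  simp at h
  omega

/-- The regime `i ≥ 1` of round `s`: the one with `T_{i-1} ≤ s < T_i`. -/
def regime (p s : ℕ) : ℕ := Nat.find (exists_lt_regimeEnd p s)

/-- The first round of the regime of round `s`. -/
def regimeStart (p s : ℕ) : ℕ := regimeEnd p (regime p s - 1)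

/-- The number `K_i = 2 ^ (p + 2 - i)` of cells of the discretization in regime `i`. -/
def numCells (p i : ℕ) : ℕ := 2 ^ (p + 2 - i)

/-- The number of discrete arms in regime `i`: the `K_i` cells and the `i - 1` previous regimes. -/
def numArms (p i : ℕ) : ℕ := numCells p i + (i - 1)

/-- The cell number `a` (from `0`) of the regular partition into `K` cells. -/
def cell (K a : ℕ) : Set I := {x | (a : ℝ) / K ≤ x ∧ (x : ℝ) ≤ (a + 1) / K}

/-- The rounds of regime `j ≥ 1`, among the first `s` ones. -/
def regimeRounds (p s j : ℕ) : Finset (Fin s) :=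
  Finset.univ.filter fun r => regimeEnd p (j - 1) ≤ r ∧ (r : ℕ) < regimeEnd p j

/-- The empirical measure of the arms played in the rounds of `S`. -/
def empirical {s : ℕ} (h : Fin s → Obs) (S : Finset (Fin s)) : Measure I :=
  (S.card : ℝ≥0∞)⁻¹ • ∑ r ∈ S, Measure.dirac (h r).2.1

/-- The probability measure on `[0,1]` which is the discrete arm number `a` in round `s`: for
`a < K_i`, the uniform law on a cell; then the empirical measures of the regimes `1, …, i - 1`.
(The last line concerns numbers which are not discrete arms.) -/
def armLaw (p : ℕ) {s : ℕ} (h : Fin s → Obs) (a : ℕ) : Measure I :=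
  if a < numCells p (regime p s) then volume[|cell (numCells p (regime p s)) a]
  else if a < numArms p (regime p s) then
    empirical h (regimeRounds p s (a - numCells p (regime p s) + 1))
  else Measure.dirac 0

/-- The (discrete arm, reward) pairs of the current regime, before round `s`. -/
def regimeHistory (p : ℕ) {s : ℕ} (h : Fin s → Obs) : Fin (s - regimeStart p s) → ℕ × ℝ :=
  fun r => ((h ⟨regimeStart p s + r, by omega⟩).1, (h ⟨regimeStart p s + r, by omega⟩).2.2)

/-- The discrete arm `I_s` chosen in round `s`: MOSS, started afresh in each regime `i`, with
horizon `2 ^ (p + i)`. -/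
def chosenArm (tie : Finset ℕ → ℕ) (p : ℕ) {s : ℕ} (h : Fin s → Obs) : ℕ :=
  mossArm tie (2 ^ (p + regime p s)) (numArms p (regime p s)) (regimeHistory p h)

lemma measurable_pulls {r : ℕ} (a : ℕ) : Measurable fun g : Fin r → ℕ × ℝ => pulls g a := by
  simp only [pulls, Finset.card_filter]
  refine Finset.measurable_sum _ fun s _ => Measurable.ite ?_ measurable_const measurable_const
  exact (measurable_fst.comp (measurable_pi_apply s)) (measurableSet_singleton a)

lemma measurable_totalReward {r : ℕ} (a : ℕ) :
    Measurable fun g : Fin r → ℕ × ℝ => totalReward g a := by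
  simp only [totalReward, Finset.sum_filter]
  refine Finset.measurable_sum _ fun s _ => Measurable.ite ?_ (by fun_prop) measurable_const
  exact (measurable_fst.comp (measurable_pi_apply s)) (measurableSet_singleton a)

lemma measurable_mossIndex (n K : ℕ) {r : ℕ} (a : ℕ) :
    Measurable fun g : Fin r → ℕ × ℝ => mossIndex n K g a := by
  have h1 := measurable_pulls (r := r) a
  have h2 := measurable_totalReward (r := r) a
  have h3 : Measurable fun g : Fin r → ℕ × ℝ => (pulls g a : ℝ) :=
    (measurable_from_top (f := fun k : ℕ => (k : ℝ))).comp h1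
  unfold mossIndex
  refine Measurable.ite (h1 (measurableSet_singleton 0)) measurable_const ?_
  exact Measurable.coe_real_ereal (by fun_prop)

lemma measurable_mossArm (tie : Finset ℕ → ℕ) (n K : ℕ) {r : ℕ} :
    Measurable fun g : Fin r → ℕ × ℝ => mossArm tie n K g := by
  let : MeasurableSpace (Finset ℕ) := ⊤
  have h : Measurable fun g : Fin r → ℕ × ℝ => mossArgmax n K g := by
    refine measurable_to_countable' fun S => ?_
    have : (fun g : Fin r → ℕ × ℝ => mossArgmax n K g) ⁻¹' {S}
        = {g | ∀ a, a ∈ mossArgmax n K g ↔ a ∈ S} := by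
      ext g
      simp [Finset.ext_iff]
    rw [this]
    simp only [mossArgmax, Finset.mem_filter]
    refine measurableSet_setOfPred.2 (Measurable.forall fun a => ?_)
    refine Measurable.iff (Measurable.and measurable_const ?_) measurable_const
    refine Measurable.forall fun b => Measurable.imp measurable_const ?_
    exact measurableSet_setOfPred.1
      (measurableSet_le (measurable_mossIndex n K b) (measurable_mossIndex n K a))
  exact measurable_from_top.comp h

lemma measurable_chosenArm (tie : Finset ℕ → ℕ) (p s : ℕ) :
    Measurable fun h : Fin s → Obs => chosenArm tie p h := by
  refine (measurable_mossArm tie _ _).comp ?_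
  unfold regimeHistory
  fun_prop

lemma measurable_armLaw (p s : ℕ) :
    Measurable fun q : (Fin s → Obs) × ℕ => armLaw p q.1 q.2 := by
  refine measurable_from_prod_countable_left fun a => ?_
  simp only [armLaw]
  split_ifs
  · exact measurable_const
  · refine Measure.measurable_of_measurable_coe _ fun S hS => ?_
    simp only [empirical, Measure.smul_apply, Measure.finsetSum_apply, smul_eq_mul,
      Measure.dirac_apply' _ hS]
    refine Measurable.const_mul (Finset.measurable_sum _ fun r _ => ?_) _
    exact (measurable_one.indicator hS).comp (by fun_prop)
  · exact measurable_const

lemma regimeEnd_lt (p : ℕ) {i j : ℕ} (h : i < j) : regimeEnd p i < regimeEnd p j := by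
  refine strictMono_nat_of_lt_succ (f := regimeEnd p) (fun n => ?_) h
  simp only [regimeEnd, Finset.sum_Icc_succ_top (Nat.le_add_left 1 n)]
  exact Nat.lt_add_of_pos_right (by positivity)

lemma regimeEnd_le_of_lt_regime {p s i : ℕ} (h : i < regime p s) : regimeEnd p i ≤ s :=
  not_lt.1 (Nat.find_min (exists_lt_regimeEnd p s) h)

lemma volume_cell_ne_zero {K a : ℕ} (h : a < K) : volume (cell K a) ≠ 0 := by
  have hK : (0 : ℝ) < K := by exact_mod_cast (Nat.zero_lt_of_lt h)
  have ha : (a : ℝ) + 1 ≤ K := by exact_mod_cast h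
  have hsub : Set.Icc ((a : ℝ) / K) ((a + 1) / K) ⊆ Set.Icc (0 : ℝ) 1 := by
    intro x hx
    refine ⟨le_trans (by positivity) hx.1, hx.2.trans ?_⟩
    rwa [div_le_one hK]
  have himg : (Subtype.val '' cell K a : Set ℝ) = Set.Icc ((a : ℝ) / K) ((a + 1) / K) := by
    ext x
    constructor
    · rintro ⟨y, hy, rfl⟩
      exact hy
    · intro hx
      exact ⟨⟨x, hsub hx⟩, hx, rfl⟩
  rw [Measure.Subtype.volume_def, comap_subtype_coe_apply measurableSet_Icc, himg,
    Real.volume_Icc]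
  simp only [ne_eq, ENNReal.ofReal_eq_zero, not_le]
  have : ((a : ℝ) + 1) / K - a / K = 1 / K := by ring
  rw [this]
  positivity

lemma isProbabilityMeasure_armLaw (p : ℕ) {s : ℕ} (h : Fin s → Obs) (a : ℕ) :
    IsProbabilityMeasure (armLaw p h a) := by
  unfold armLaw
  split_ifs with h1 h2
  · exact cond_isProbabilityMeasure (volume_cell_ne_zero h1)
  · set j := a - numCells p (regime p s) + 1 with hj
    have hlt : j < regime p s := by
      simp only [numArms] at h2
      omega
    have h3 : regimeEnd p (j - 1) < regimeEnd p j := regimeEnd_lt p (by omega)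
    have h4 : regimeEnd p j ≤ s := regimeEnd_le_of_lt_regime hlt
    have hne : (regimeRounds p s j).card ≠ 0 := by
      refine Finset.card_ne_zero_of_mem (a := ⟨regimeEnd p (j - 1), by omega⟩) ?_
      simp [regimeRounds, h3]
    constructor
    simp only [empirical, Measure.smul_apply, Measure.finsetSum_apply, measure_univ,
      Finset.sum_const, smul_eq_mul, nsmul_eq_mul, mul_one]
    exact ENNReal.inv_mul_cancel (by exact_mod_cast hne) (ENNReal.natCast_ne_top _)
  · infer_instance

/-- MeDZO with input `B`, where `p = ⌈log₂ B⌉`: in round `s`, the label is the discrete arm `I_s`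
chosen by MOSS, and the arm `X_s` is drawn from the corresponding probability measure. No horizon
appears in the definition: whoever runs MeDZO for `T` rounds uses the first `T` kernels only. -/
def MeDZO (tie : Finset ℕ → ℕ) (B : ℝ) : Algorithm where
  kernel s :=
    Kernel.deterministic (fun h : Fin s → Obs => chosenArm tie ⌈Real.logb 2 B⌉₊ h)
        (measurable_chosenArm tie _ s)
      ⊗ₖ ⟨fun q : (Fin s → Obs) × ℕ => armLaw ⌈Real.logb 2 B⌉₊ q.1 q.2, measurable_armLaw _ s⟩
  markov s := by
    have : IsMarkovKernel (⟨fun q : (Fin s → Obs) × ℕ => armLaw ⌈Real.logb 2 B⌉₊ q.1 q.2,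
        measurable_armLaw _ s⟩ : Kernel ((Fin s → Obs) × ℕ) I) :=
      ⟨fun q => isProbabilityMeasure_armLaw _ q.1 q.2⟩
    infer_instance

/-! ### The doubling trick -/

/-- The phase `k` of round `t`: phase `k` consists of the `2 ^ k` rounds `t` such that
`2 ^ k - 1 ≤ t < 2 ^ (k + 1) - 1`. -/
def phase (t : ℕ) : ℕ := Nat.log 2 (t + 1)

/-- The number of rounds of the current phase which were played before round `t`. -/
def phaseTime (t : ℕ) : ℕ := t + 1 - 2 ^ phase t

lemma phaseTime_le (t : ℕ) : phaseTime t ≤ t := by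
  have : 1 ≤ 2 ^ phase t := Nat.one_le_two_pow
  unfold phaseTime
  omega

/-- The record of the current phase: the last `phaseTime t` of the first `t` rounds. -/
def phaseHistory {t : ℕ} (h : Fin t → Obs) : Fin (phaseTime t) → Obs :=
  fun r => h ⟨t - phaseTime t + r, by have := phaseTime_le t; omega⟩

/-- Run `A 0`, `A 1`, … successively, with a fresh start of `A k` for the `2 ^ k` rounds of
phase `k`. -/
def doublingTrick (A : ℕ → Algorithm) : Algorithm where
  kernel t := ((A (phase t)).kernel (phaseTime t)).comap phaseHistory
    (by unfold phaseHistory; fun_prop)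
  markov t := by
    have := (A (phase t)).markov (phaseTime t)
    infer_instance

/-- The doubling trick version of MeDZO, with input `m`: MeDZO is run with `B = 2 ^ (k m)` for the
`2 ^ k` rounds of phase `k`. -/
def doublingMeDZO (tie : Finset ℕ → ℕ) (m : ℝ) : Algorithm :=
  doublingTrick fun k => MeDZO tie ((2 : ℝ) ^ ((k : ℝ) * m))

end

end XArmed

namespace XArmed

noncomputable section

/-! ### Laws of trajectories -/

/-! Lower bound. One algorithm cannot be good at two regularities at once: `Achieves.le_rate` gives
1 - θ(α) α'/(α'+1) ≤ θ(α'). Take the payoff 1/2 on the left half of [0,1] and 1/2 - D on the right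
half, and cut the right half into N cells. The regret is at least D times the time spent on the
right, so some cell receives on average at most regret/(D N) visits. Raising that cell to 1/2 + D
creates a relative entropy of order D² per visit; when the total is small the algorithm cannot
notice the change and loses order D T (`occupation_change`, `exists_hard_environment`). Regularity
α' allows D of order N^(-α'), and N is chosen just large enough to hide the cell. A rate function
below θ_m contradicts this trade-off (`not_strictlySmaller_theta`).

Upper bound. In every regime of MeDZO the number of cells times the length is 4·4^p, so MOSS pays
about 2^p up to logarithms, the few memory arms included (`mossBound_le`). While the cells are fine
enough, up to about regime j₀ = pα/(α+1), the discretization error is also of order 2^p. Afterwards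
the empirical measure of the critical regime is an arm whose regret per round is of order 2^(-j₀),
so the later regimes cost at most about 2^(k-j₀) over 2^k rounds. With p ≈ k m, the sum is 2^(k
θ_m(α)) up to polynomial factors in k (`regret_MeDZO_le`); the algorithm never uses α or L. Summing
over the phases of the doubling trick keeps this exponent.

MOSS itself is analysed up to logarithms, which the T^ε in `Achieves` absorbs. A single positive
supermartingale, a weighted sum of exponentials of centred rewards, dominates all deviations that
matter. Its running maximum has a bounded moment of order 2/3 (`lintegral_runMax_le`), and on each
trajectory the 2/3-th power of this maximum bounds every error of the indices (`underestimation_le`,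
`overestimation_le`). -/

/-- A record of finitely many rounds, continued by a default value. -/
def extend {t : ℕ} (h : Fin t → Obs) : ℕ → Obs :=
  fun n => if hn : n < t then h ⟨n, hn⟩ else (0, 0, 0)

/-- The record of the first `t` rounds of a trajectory. -/
def initial (t : ℕ) (ω : ℕ → Obs) : Fin t → Obs := fun r => ω r

@[simp] lemma initial_apply (t : ℕ) (ω : ℕ → Obs) (r : Fin t) : initial t ω r = ω r := rfl

lemma measurable_extend {t : ℕ} : Measurable (extend (t := t)) := by
  refine measurable_pi_lambda _ fun n => ?_
  unfold extend
  split_ifs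
  · exact measurable_pi_apply _
  · exact measurable_const

@[fun_prop]
lemma measurable_initial (t : ℕ) : Measurable (initial t) :=
  measurable_pi_lambda _ fun _ => measurable_pi_apply _

lemma initial_extend {t : ℕ} (h : Fin t → Obs) : initial t (extend h) = h := by
  ext r : 1
  simp [initial, extend]

lemma extend_snoc {t : ℕ} (h : Fin t → Obs) (o : Obs) :
    extend (Fin.snoc (α := fun _ => Obs) h o) = Function.update (extend h) t o := by
  ext n : 1
  rcases lt_trichotomy n t with hn | rfl | hn
  · rw [Function.update_of_ne hn.ne]
    simp [extend, hn, hn.trans (Nat.lt_succ_self t), Fin.snoc]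
  · simp [extend, Fin.snoc]
  · rw [Function.update_of_ne hn.ne']
    simp [extend, hn.not_gt, show ¬ n < t + 1 by omega]

/-- The law of the record of the first `t` rounds, as a law on trajectories. -/
def trajLaw (A : Algorithm) (E : Environment) (t : ℕ) : Measure (ℕ → Obs) :=
  (law A E t).map extend

instance (E : Environment) : IsMarkovKernel E.reward := E.markov

instance (A : Algorithm) (t : ℕ) : IsMarkovKernel (A.kernel t) := A.markov t

instance (A : Algorithm) (E : Environment) (t : ℕ) : IsMarkovKernel (roundKernel A E t) := by
  unfold roundKernel
  infer_instance

/-- The triple recorded in a round. -/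
def toObs (q : (ℕ × I) × ℝ) : Obs := (q.1.1, q.1.2, q.2)

@[fun_prop]
lemma measurable_toObs : Measurable toObs := by
  unfold toObs
  fun_prop

lemma law_succ (A : Algorithm) (E : Environment) (t : ℕ) :
    law A E (t + 1) = (law A E t ⊗ₘ roundKernel A E t).map
      (fun p => Fin.snoc (α := fun _ => Obs) p.1 (toObs p.2)) := rfl

lemma measurable_snoc {t : ℕ} : Measurable
    (fun p : (Fin t → Obs) × ((ℕ × I) × ℝ) => Fin.snoc (α := fun _ => Obs) p.1 (toObs p.2)) := by
  refine measurable_pi_lambda _ fun n => ?_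
  refine Fin.lastCases ?_ (fun r => ?_) n
  · simp only [Fin.snoc_last]
    fun_prop
  · simp only [Fin.snoc_castSucc]
    fun_prop

instance isProbabilityMeasure_law (A : Algorithm) (E : Environment) :
    (t : ℕ) → IsProbabilityMeasure (law A E t)
  | 0 => by unfold law; infer_instance
  | t + 1 => by
    have := isProbabilityMeasure_law A E t
    rw [law_succ]
    exact Measure.isProbabilityMeasure_map measurable_snoc.aemeasurable

instance (A : Algorithm) (E : Environment) (t : ℕ) : IsProbabilityMeasure (trajLaw A E t) :=
  Measure.isProbabilityMeasure_map measurable_extend.aemeasurable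

/-- One round, as a kernel on trajectories. -/
def stepKernel (A : Algorithm) (E : Environment) (t : ℕ) : Kernel (ℕ → Obs) ((ℕ × I) × ℝ) :=
  (roundKernel A E t).comap (initial t) (measurable_initial t)

instance (A : Algorithm) (E : Environment) (t : ℕ) : IsMarkovKernel (stepKernel A E t) := by
  unfold stepKernel
  infer_instance

/-- The trajectory `p.1`, whose round `t` is replaced by `p.2`. -/
def setRound (t : ℕ) (p : (ℕ → Obs) × ((ℕ × I) × ℝ)) : ℕ → Obs :=
  Function.update p.1 t (toObs p.2)

@[fun_prop]
lemma measurable_setRound (t : ℕ) : Measurable (setRound t) := by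
  refine measurable_pi_lambda _ fun n => ?_
  unfold setRound
  by_cases h : n = t
  · subst h
    simp only [Function.update_self]
    fun_prop
  · simp only [Function.update_of_ne h]
    fun_prop

lemma setRound_of_ne {t n : ℕ} (h : n ≠ t) (p : (ℕ → Obs) × ((ℕ × I) × ℝ)) :
    setRound t p n = p.1 n := by
  simp [setRound, h]

@[simp] lemma setRound_self (t : ℕ) (p : (ℕ → Obs) × ((ℕ × I) × ℝ)) :
    setRound t p t = toObs p.2 := by
  simp [setRound]

lemma trajLaw_zero (A : Algorithm) (E : Environment) :
    trajLaw A E 0 = Measure.dirac (fun _ => (0, 0, 0)) := by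
  rw [trajLaw, law]
  refine (Measure.map_dirac' measurable_extend _).trans ?_
  congr 1

/-- Records of all lengths live on one space thanks to the padding, so that appending a round
becomes the update of one coordinate. -/
lemma trajLaw_succ (A : Algorithm) (E : Environment) (t : ℕ) :
    trajLaw A E (t + 1) = (trajLaw A E t ⊗ₘ stepKernel A E t).map (setRound t) := by
  refine Measure.ext_of_lintegral _ fun F hF => ?_
  have h1 : Measurable fun h : Fin (t + 1) → Obs => F (extend h) := hF.comp measurable_extend
  have h2 : Measurable fun p => F (setRound t p) := hF.comp (measurable_setRound t)
  have h3 : Measurable fun p : (Fin t → Obs) × ((ℕ × I) × ℝ) =>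
      F (extend (Fin.snoc (α := fun _ => Obs) p.1 (toObs p.2))) := h1.comp measurable_snoc
  rw [trajLaw, lintegral_map hF measurable_extend, law_succ, lintegral_map h1 measurable_snoc,
    Measure.lintegral_compProd h3,
    lintegral_map hF (measurable_setRound t), Measure.lintegral_compProd h2, trajLaw,
    lintegral_map (Measurable.lintegral_kernel_prod_right h2) measurable_extend]
  refine lintegral_congr fun h => ?_
  simp only [stepKernel, Kernel.comap_apply, initial_extend, extend_snoc, setRound]

lemma lintegral_stepKernel (A : Algorithm) (E : Environment) (t : ℕ) (ω : ℕ → Obs)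
    {F : (ℕ × I) × ℝ → ℝ≥0∞} (hF : Measurable F) :
    ∫⁻ q, F q ∂(stepKernel A E t ω)
      = ∫⁻ q, ∫⁻ y, F (q, y) ∂(E.reward q.2) ∂(A.kernel t (initial t ω)) := by
  rw [stepKernel, Kernel.comap_apply, roundKernel, Kernel.lintegral_compProd _ _ _ hF]
  rfl

lemma lintegral_trajLaw_succ (A : Algorithm) (E : Environment) (t : ℕ)
    {F : (ℕ → Obs) → ℝ≥0∞} (hF : Measurable F) :
    ∫⁻ ω, F ω ∂(trajLaw A E (t + 1))
      = ∫⁻ ω, ∫⁻ q, F (setRound t (ω, q)) ∂(stepKernel A E t ω) ∂(trajLaw A E t) := by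
  have h : Measurable fun p => F (setRound t p) := hF.comp (measurable_setRound t)
  rw [trajLaw_succ, lintegral_map hF (measurable_setRound t), Measure.lintegral_compProd h]

lemma integral_trajLaw_succ (A : Algorithm) (E : Environment) (t : ℕ)
    {F : (ℕ → Obs) → ℝ} (hm : Measurable F) (hF : Integrable F (trajLaw A E (t + 1))) :
    ∫ ω, F ω ∂(trajLaw A E (t + 1))
      = ∫ ω, ∫ q, F (setRound t (ω, q)) ∂(stepKernel A E t ω) ∂(trajLaw A E t) := by
  rw [trajLaw_succ] at hF ⊢
  rw [integral_map (measurable_setRound t).aemeasurable hm.aestronglyMeasurable]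
  exact Measure.integral_compProd
    ((integrable_map_measure hm.aestronglyMeasurable (measurable_setRound t).aemeasurable).1 hF)

/-- The functional `F` depends on the first `s` rounds only. -/
def Adapted {β : Type*} (s : ℕ) (F : (ℕ → Obs) → β) : Prop :=
  ∀ ω ω' : ℕ → Obs, (∀ r < s, ω r = ω' r) → F ω = F ω'

lemma Adapted.setRound {β : Type*} {s : ℕ} {F : (ℕ → Obs) → β} (hF : Adapted s F) {t : ℕ}
    (hst : s ≤ t) (p : (ℕ → Obs) × ((ℕ × I) × ℝ)) : F (setRound t p) = F p.1 :=
  hF _ _ fun r hr => setRound_of_ne (by omega) p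

lemma Adapted.mono {β : Type*} {s t : ℕ} {F : (ℕ → Obs) → β} (hF : Adapted s F) (hst : s ≤ t) :
    Adapted t F :=
  fun ω ω' h => hF ω ω' fun r hr => h r (hr.trans_le hst)

lemma adapted_initial (s : ℕ) : Adapted s (initial s) := by
  intro ω ω' h
  ext r : 1
  exact h r r.2

/-- Round `t` overwrites only coordinate `t` and its kernel has mass one, so later rounds leave the
law of earlier ones unchanged. Expectations of adapted functionals can therefore be moved between
horizons. -/
lemma map_initial_trajLaw (A : Algorithm) (E : Environment) {s t : ℕ} (hst : s ≤ t) :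
    (trajLaw A E t).map (initial s) = (trajLaw A E s).map (initial s) := by
  induction t, hst using Nat.le_induction with
  | base => rfl
  | succ t hst ih =>
    rw [← ih]
    refine Measure.ext_of_lintegral _ fun F hF => ?_
    have h : Measurable fun ω => F (initial s ω) := hF.comp (measurable_initial s)
    rw [lintegral_map hF (measurable_initial s), lintegral_map hF (measurable_initial s),
      lintegral_trajLaw_succ _ _ _ h]
    refine lintegral_congr fun ω => ?_
    simp only [(adapted_initial s).setRound hst, lintegral_const, measure_univ, mul_one]

lemma Adapted.eq_comp_initial {β : Type*} {s : ℕ} {F : (ℕ → Obs) → β} (hF : Adapted s F)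
    (ω : ℕ → Obs) : F ω = F (extend (initial s ω)) :=
  hF _ _ fun r hr => by simp [extend, hr]

lemma Adapted.lintegral_eq {s : ℕ} {F : (ℕ → Obs) → ℝ≥0∞} (hF : Adapted s F) (hm : Measurable F)
    (A : Algorithm) (E : Environment) {t : ℕ} (hst : s ≤ t) :
    ∫⁻ ω, F ω ∂(trajLaw A E t) = ∫⁻ ω, F ω ∂(trajLaw A E s) := by
  have h := fun r => lintegral_map (μ := trajLaw A E r) (hm.comp (measurable_extend (t := s)))
    (measurable_initial s)
  simp only [Function.comp_def, ← hF.eq_comp_initial] at h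
  rw [← h t, ← h s, map_initial_trajLaw A E hst]

lemma Adapted.integral_eq {s : ℕ} {F : (ℕ → Obs) → ℝ} (hF : Adapted s F) (hm : Measurable F)
    (A : Algorithm) (E : Environment) {t : ℕ} (hst : s ≤ t) :
    ∫ ω, F ω ∂(trajLaw A E t) = ∫ ω, F ω ∂(trajLaw A E s) := by
  have h := fun r => integral_map (μ := trajLaw A E r) (measurable_initial s).aemeasurable
    (hm.comp (measurable_extend (t := s))).aestronglyMeasurable
  simp only [Function.comp_def, ← hF.eq_comp_initial] at h
  rw [← h t, ← h s, map_initial_trajLaw A E hst]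

/-! ### The regret -/

lemma Environment.measurable_f (E : Environment) : Measurable E.f := by
  have : StronglyMeasurable fun x => ∫ y, y ∂(E.reward x) :=
    StronglyMeasurable.integral_kernel (f := fun y : ℝ => y) stronglyMeasurable_id
  simpa only [E.mean_eq] using this.measurable

/-- The expected payoff of round `t`. -/
def meanPayoff (A : Algorithm) (E : Environment) (t : ℕ) : ℝ :=
  ∫ ω, E.f (ω t).2.1 ∂(trajLaw A E (t + 1))

lemma integrable_payoff (A : Algorithm) (E : Environment) (t s : ℕ) :
    Integrable (fun ω : ℕ → Obs => E.f (ω t).2.1) (trajLaw A E s) := by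
  refine Integrable.of_bound (C := 1)
    (E.measurable_f.comp (by fun_prop)).aestronglyMeasurable (ae_of_all _ fun ω => ?_)
  rw [Real.norm_of_nonneg (E.f_mem _).1]
  exact (E.f_mem _).2

lemma integral_payoff (A : Algorithm) (E : Environment) {t s : ℕ} (h : t < s) :
    ∫ ω, E.f (ω t).2.1 ∂(trajLaw A E s) = meanPayoff A E t := by
  refine Adapted.integral_eq (s := t + 1) (F := fun ω => E.f (ω t).2.1) (fun ω ω' h => ?_)
    (E.measurable_f.comp (by fun_prop)) A E h
  simp only [h t (Nat.lt_succ_self t)]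

lemma Environment.bddAbove (E : Environment) : BddAbove (Set.range E.f) :=
  ⟨1, by rintro _ ⟨x, rfl⟩; exact (E.f_mem x).2⟩

lemma Environment.le_iSup (E : Environment) (x : I) : E.f x ≤ ⨆ x, E.f x :=
  le_ciSup E.bddAbove x

lemma meanPayoff_nonneg (A : Algorithm) (E : Environment) (t : ℕ) : 0 ≤ meanPayoff A E t :=
  integral_nonneg fun _ => (E.f_mem _).1

lemma meanPayoff_le (A : Algorithm) (E : Environment) (t : ℕ) :
    meanPayoff A E t ≤ ⨆ x, E.f x := by
  have := integral_mono (integrable_payoff A E t (t + 1))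
    (integrable_const (⨆ x, E.f x)) fun _ => E.le_iSup _
  simpa [meanPayoff] using this

lemma regret_eq_sum (A : Algorithm) (E : Environment) (T : ℕ) :
    regret A E T = ∑ t ∈ Finset.range T, ((⨆ x, E.f x) - meanPayoff A E t) := by
  have h1 : ∫ h, ∑ t, E.f (h t).2.1 ∂(law A E T)
      = ∫ ω, ∑ t ∈ Finset.range T, E.f (ω t).2.1 ∂(trajLaw A E T) := by
    rw [trajLaw, integral_map measurable_extend.aemeasurable]
    · refine integral_congr_ae (ae_of_all _ fun h => ?_)
      simp only [Finset.sum_range]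
      refine Finset.sum_congr rfl fun t _ => ?_
      simp [extend]
    · refine (Finset.measurable_sum _ fun t _ => ?_).aestronglyMeasurable
      exact E.measurable_f.comp (by fun_prop)
  rw [regret, h1, integral_finsetSum _ fun t _ => integrable_payoff A E t T, Finset.sum_sub_distrib]
  simp only [Finset.sum_const, Finset.card_range, nsmul_eq_mul]
  congr 1
  exact Finset.sum_congr rfl fun t ht => integral_payoff A E (Finset.mem_range.1 ht)

lemma regret_mono (A : Algorithm) (E : Environment) : Monotone (regret A E) := by
  intro s t hst
  rw [regret_eq_sum, regret_eq_sum]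
  exact Finset.sum_le_sum_of_subset_of_nonneg (Finset.range_mono hst)
    fun r _ _ => sub_nonneg.2 (meanPayoff_le A E r)

lemma regret_nonneg (A : Algorithm) (E : Environment) (T : ℕ) : 0 ≤ regret A E T := by
  rw [regret_eq_sum]
  exact Finset.sum_nonneg fun r _ => sub_nonneg.2 (meanPayoff_le A E r)

/-! ### Environments with Bernoulli rewards -/

/-- The Bernoulli law on `{0, 1}`, as a measure on `ℝ`. -/
def bernoulliLaw (g : ℝ) : Measure ℝ :=
  ENNReal.ofReal (1 - g) • Measure.dirac 0 + ENNReal.ofReal g • Measure.dirac 1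

lemma lintegral_bernoulliLaw (g : ℝ) (F : ℝ → ℝ≥0∞) :
    ∫⁻ y, F y ∂(bernoulliLaw g) = ENNReal.ofReal (1 - g) * F 0 + ENNReal.ofReal g * F 1 := by
  simp [bernoulliLaw, lintegral_add_measure, lintegral_smul_measure]

lemma integral_bernoulliLaw {g : ℝ} (hg : g ∈ Set.Icc (0 : ℝ) 1) (F : ℝ → ℝ) :
    ∫ y, F y ∂(bernoulliLaw g) = (1 - g) * F 0 + g * F 1 := by
  have h (c a : ℝ) : Integrable F (ENNReal.ofReal c • Measure.dirac a) :=
    Integrable.smul_measure (integrable_dirac (by simp)) ENNReal.ofReal_ne_top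
  rw [bernoulliLaw, integral_add_measure (h _ _) (h _ _), integral_smul_measure,
    integral_smul_measure, integral_dirac, integral_dirac,
    ENNReal.toReal_ofReal (sub_nonneg.2 hg.2), ENNReal.toReal_ofReal hg.1, smul_eq_mul, smul_eq_mul]

lemma isProbabilityMeasure_bernoulliLaw {g : ℝ} (hg : g ∈ Set.Icc (0 : ℝ) 1) :
    IsProbabilityMeasure (bernoulliLaw g) := by
  constructor
  have h := lintegral_bernoulliLaw g fun _ => 1
  simp only [lintegral_const, one_mul, mul_one] at h
  rw [h, ← ENNReal.ofReal_add (sub_nonneg.2 hg.2) hg.1, sub_add_cancel, ENNReal.ofReal_one]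

/-- The Bernoulli law of mean `g x`, as a kernel. -/
def bernoulliKernel (g : I → ℝ) (hm : Measurable g) : Kernel I ℝ :=
  ⟨fun x => bernoulliLaw (g x), by
    refine Measure.measurable_of_measurable_coe _ fun S _ => ?_
    change Measurable fun x => (bernoulliLaw (g x)) S
    simp only [bernoulliLaw, Measure.add_apply, Measure.smul_apply, smul_eq_mul]
    fun_prop⟩

/-- The environment with Bernoulli rewards of mean `g x`. -/
def bernoulliEnv (g : I → ℝ) (hm : Measurable g) (hg : ∀ x, g x ∈ Set.Icc (0 : ℝ) 1) :
    Environment where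
  f := g
  f_mem := hg
  reward := bernoulliKernel g hm
  markov := ⟨fun x => isProbabilityMeasure_bernoulliLaw (hg x)⟩
  mean_eq x := by
    refine (integral_bernoulliLaw (hg x) fun y => y).trans ?_
    ring
  subgaussian x := by
    change HasSubgaussianMGF (fun y => y - g x) (1 / 4) (bernoulliLaw (g x))
    have := isProbabilityMeasure_bernoulliLaw (hg x)
    have h := hasSubgaussianMGF_of_mem_Icc (μ := bernoulliLaw (g x)) (X := fun y : ℝ => y)
      (a := 0) (b := 1) (by fun_prop) (by
        simp only [bernoulliLaw]
        refine ae_add_measure_iff.2 ⟨Measure.ae_smul_measure ?_ _, Measure.ae_smul_measure ?_ _⟩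
        · exact (ae_dirac_iff measurableSet_Icc).2 (by simp)
        · exact (ae_dirac_iff measurableSet_Icc).2 (by simp))
    rw [integral_bernoulliLaw (hg x) fun y => y] at h
    simp only [mul_zero, mul_one, zero_add] at h
    convert h using 1
    rw [← NNReal.coe_inj]
    norm_num

lemma bernoulliEnv_reward (g : I → ℝ) (hm : Measurable g) (hg : ∀ x, g x ∈ Set.Icc (0 : ℝ) 1)
    (x : I) : (bernoulliEnv g hm hg).reward x = bernoulliLaw (g x) := rfl

lemma bernoulliEnv_f (g : I → ℝ) (hm : Measurable g) (hg : ∀ x, g x ∈ Set.Icc (0 : ℝ) 1) :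
    (bernoulliEnv g hm hg).f = g := rfl

/-! ### Change of environment -/

/-- A function of the arm and reward of a round has the same mean as its average over the reward. -/
lemma integral_reward (A : Algorithm) (E : Environment) (t : ℕ) {φ : I × ℝ → ℝ}
    (hm : Measurable φ) {C : ℝ} (hC : ∀ z, |φ z| ≤ C) :
    ∫ ω, φ (ω t).2 ∂(trajLaw A E (t + 1))
      = ∫ ω, ∫ y, φ ((ω t).2.1, y) ∂(E.reward (ω t).2.1) ∂(trajLaw A E (t + 1)) := by
  have hψ : StronglyMeasurable fun x => ∫ y, φ (x, y) ∂(E.reward x) :=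
    StronglyMeasurable.integral_kernel_prod_right hm.stronglyMeasurable
  have hψC (x : I) : ‖∫ y, φ (x, y) ∂(E.reward x)‖ ≤ C := by
    simpa using norm_integral_le_of_norm_le_const (μ := E.reward x) (f := fun y => φ (x, y))
      (C := C) (ae_of_all _ fun y => hC (x, y))
  have hm1 : Measurable fun ω : ℕ → Obs => φ (ω t).2 := hm.comp (by fun_prop)
  have hm2 : Measurable fun ω : ℕ → Obs => ∫ y, φ ((ω t).2.1, y) ∂(E.reward (ω t).2.1) :=
    hψ.measurable.comp (g := fun x => ∫ y, φ (x, y) ∂(E.reward x))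
      (f := fun ω : ℕ → Obs => (ω t).2.1) (by fun_prop)
  rw [integral_trajLaw_succ _ _ _ hm1
      (Integrable.of_bound hm1.aestronglyMeasurable C (ae_of_all _ fun ω => hC _)),
    integral_trajLaw_succ _ _ _ hm2
      (Integrable.of_bound hm2.aestronglyMeasurable C (ae_of_all _ fun ω => hψC _))]
  refine integral_congr_ae (ae_of_all _ fun ω => ?_)
  simp only [setRound_self, toObs, stepKernel, Kernel.comap_apply, roundKernel]
  have hm3 : Measurable fun q : (ℕ × I) × ℝ => φ (q.1.2, q.2) := hm.comp (by fun_prop)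
  have hm4 : Measurable fun q : (ℕ × I) × ℝ => ∫ y, φ (q.1.2, y) ∂(E.reward q.1.2) :=
    hψ.measurable.comp (g := fun x => ∫ y, φ (x, y) ∂(E.reward x))
      (f := fun q : (ℕ × I) × ℝ => q.1.2) (by fun_prop)
  rw [integral_compProd (Integrable.of_bound hm3.aestronglyMeasurable C (ae_of_all _ fun ω => hC _)),
    integral_compProd (Integrable.of_bound hm4.aestronglyMeasurable C (ae_of_all _ fun ω => hψC _))]
  simp [Kernel.comap_apply]

/-- The likelihood ratio of the first `t` rounds. -/
def likelihood (r : I × ℝ → ℝ) (t : ℕ) (ω : ℕ → Obs) : ℝ := ∏ s ∈ Finset.range t, r (ω s).2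

lemma likelihood_setRound (r : I × ℝ → ℝ) (t : ℕ) (p : (ℕ → Obs) × ((ℕ × I) × ℝ)) :
    likelihood r (t + 1) (setRound t p) = likelihood r t p.1 * r (p.2.1.2, p.2.2) := by
  rw [likelihood, Finset.prod_range_succ, setRound_self]
  congr 1
  refine Finset.prod_congr rfl fun s hs => ?_
  rw [setRound_of_ne (Finset.mem_range.1 hs).ne]

lemma measurable_likelihood {r : I × ℝ → ℝ} (hr : Measurable r) (t : ℕ) :
    Measurable (likelihood r t) := by
  unfold likelihood
  fun_prop

/-- The algorithm's kernels are the same in both environments and cancel in the likelihood ratio;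
only the reward densities remain. -/
lemma trajLaw_eq_withDensity (A : Algorithm) (E₀ E₁ : Environment) {r : I × ℝ → ℝ}
    (hr : Measurable r) (hr0 : ∀ z, 0 ≤ r z)
    (h : ∀ x, ∀ F : ℝ → ℝ≥0∞, Measurable F →
      ∫⁻ y, F y ∂(E₁.reward x) = ∫⁻ y, F y * ENNReal.ofReal (r (x, y)) ∂(E₀.reward x)) (t : ℕ) :
    trajLaw A E₁ t = (trajLaw A E₀ t).withDensity fun ω => ENNReal.ofReal (likelihood r t ω) := by
  induction t with
  | zero => simp [trajLaw_zero, likelihood]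
  | succ t ih =>
    have hL := measurable_likelihood hr
    refine Measure.ext_of_lintegral _ fun F hF => ?_
    have hF1 : Measurable fun p => F (setRound t p) := hF.comp (measurable_setRound t)
    rw [lintegral_withDensity_eq_lintegral_mul _ (by fun_prop) hF, lintegral_trajLaw_succ _ _ _ hF,
      lintegral_trajLaw_succ _ _ _ (by fun_prop), ih,
      lintegral_withDensity_eq_lintegral_mul _ (by fun_prop)]
    · refine lintegral_congr fun ω => ?_
      have hω : Measurable fun q => F (setRound t (ω, q)) := hF1.comp (by fun_prop)
      simp only [Pi.mul_apply, likelihood_setRound]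
      rw [lintegral_stepKernel _ _ _ _ hω, lintegral_stepKernel _ _ _ _ (by fun_prop),
        ← lintegral_const_mul']
      · refine lintegral_congr fun q => ?_
        rw [h _ _ (by fun_prop), ← lintegral_const_mul' _ _ ENNReal.ofReal_ne_top]
        refine lintegral_congr fun y => ?_
        rw [ENNReal.ofReal_mul' (hr0 _)]
        ring
      · exact ENNReal.ofReal_ne_top
    · exact Measurable.lintegral_kernel_prod_right hF1

/-! ### Change of measure and time spent in a set -/

/-- The number of rounds, among the first `T`, in which the arm is in `S`. -/
def occupation (S : Set I) (T : ℕ) (ω : ℕ → Obs) : ℝ :=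
  ∑ t ∈ Finset.range T, S.indicator 1 (ω t).2.1

lemma measurable_occupation {S : Set I} (hS : MeasurableSet S) (T : ℕ) :
    Measurable (occupation S T) := by
  have : Measurable (S.indicator (1 : I → ℝ)) := measurable_one.indicator hS
  unfold occupation
  fun_prop

lemma indicator_one_mem (S : Set I) (x : I) : S.indicator (1 : I → ℝ) x ∈ Set.Icc (0 : ℝ) 1 := by
  by_cases h : x ∈ S <;> simp [h]

lemma occupation_mem (S : Set I) (T : ℕ) (ω : ℕ → Obs) : occupation S T ω ∈ Set.Icc (0 : ℝ) T := by
  refine ⟨Finset.sum_nonneg fun t _ => (indicator_one_mem S _).1, ?_⟩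
  refine (Finset.sum_le_card_nsmul _ _ 1 fun t _ => (indicator_one_mem S _).2).trans ?_
  simp

lemma integrable_occupation {S : Set I} (hS : MeasurableSet S) (T : ℕ) (P : Measure (ℕ → Obs))
    [IsProbabilityMeasure P] : Integrable (occupation S T) P := by
  refine Integrable.of_bound (measurable_occupation hS T).aestronglyMeasurable T
    (ae_of_all _ fun ω => ?_)
  rw [Real.norm_of_nonneg (occupation_mem S T ω).1]
  exact (occupation_mem S T ω).2

/-- The left side is the relative entropy between the Bernoulli laws of means 1/2 - D and 1/2 + D.
Since 1/2 - D ≥ 1/4, the ratio exceeds 1 by at most 8 D. -/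
lemma log_ratio_le {D : ℝ} (hD0 : 0 ≤ D) (hD : D ≤ 1 / 4) :
    2 * D * Real.log ((1 / 2 + D) / (1 / 2 - D)) ≤ 16 * D ^ 2 := by
  have h1 : 0 < 1 / 2 - D := by linarith
  have h2 := Real.log_le_sub_one_of_pos (x := (1 / 2 + D) / (1 / 2 - D)) (by positivity)
  have h3 : (1 / 2 + D) / (1 / 2 - D) - 1 ≤ 8 * D := by
    rw [sub_le_iff_le_add, div_le_iff₀ h1]
    nlinarith
  nlinarith

/-- If the payoff `1/2 - D` of `g₀` is replaced by `1/2 + D` on `S`, then the time spent in `S`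
cannot increase much, unless it was already long. -/
lemma occupation_change (A : Algorithm) {S : Set I} (hS : MeasurableSet S) {D : ℝ} (hD0 : 0 ≤ D)
    (hD : D ≤ 1 / 4) {g₀ g₁ : I → ℝ} (hm₀ : Measurable g₀) (hm₁ : Measurable g₁)
    (hg₀ : ∀ x, g₀ x ∈ Set.Icc (0 : ℝ) 1) (hg₁ : ∀ x, g₁ x ∈ Set.Icc (0 : ℝ) 1)
    (hS₀ : ∀ x ∈ S, g₀ x = 1 / 2 - D) (hS₁ : ∀ x ∈ S, g₁ x = 1 / 2 + D)
    (hSc : ∀ x ∉ S, g₁ x = g₀ x) {T : ℕ} (hT : 0 < T) :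
    1 / 2 * (1 - (∫ ω, occupation S T ω ∂(trajLaw A (bernoulliEnv g₀ hm₀ hg₀) T)) / T)
        - 16 * D ^ 2 * ∫ ω, occupation S T ω ∂(trajLaw A (bernoulliEnv g₀ hm₀ hg₀) T)
      ≤ 1 - (∫ ω, occupation S T ω ∂(trajLaw A (bernoulliEnv g₁ hm₁ hg₁) T)) / T := by
  classical
  have hT' : (0 : ℝ) < T := by exact_mod_cast hT
  set E₀ := bernoulliEnv g₀ hm₀ hg₀
  set E₁ := bernoulliEnv g₁ hm₁ hg₁
  have hpos : 0 < 1 / 2 - D := by linarith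
  set ρ := (1 / 2 + D) / (1 / 2 - D) with hρ
  have hρ0 : 0 < ρ := by positivity
  -- On `S` the two Bernoulli laws exchange their weights, so the density is `ρ` at reward 1 and
  -- `ρ⁻¹` at reward 0. Rewards outside {0, 1} have probability zero; the value there only keeps `r`
  -- positive.
  set r : I × ℝ → ℝ := fun z => if z.1 ∈ S then (if z.2 = 1 then ρ else ρ⁻¹) else 1 with hr
  have hrm : Measurable r := by
    refine Measurable.ite (measurable_fst hS) ?_ measurable_const
    exact Measurable.ite (measurable_snd (measurableSet_singleton 1)) measurable_const
      measurable_const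
  have hr0 (z : I × ℝ) : 0 < r z := by
    simp only [hr]
    split_ifs <;> positivity
  have hdens : ∀ x, ∀ F : ℝ → ℝ≥0∞, Measurable F →
      ∫⁻ y, F y ∂(E₁.reward x) = ∫⁻ y, F y * ENNReal.ofReal (r (x, y)) ∂(E₀.reward x) := by
    intro x F _
    simp only [E₀, E₁, bernoulliEnv_reward, lintegral_bernoulliLaw, hr]
    by_cases hx : x ∈ S
    · simp only [hx, if_true, hS₀ x hx, hS₁ x hx, zero_ne_one, if_false]
      rw [mul_left_comm, mul_left_comm (ENNReal.ofReal (1 / 2 - D)),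
        ← ENNReal.ofReal_mul (by linarith), ← ENNReal.ofReal_mul (by linarith), mul_comm (F 0),
        mul_comm (F 1)]
      congr 3
      · have : (1 - (1 / 2 - D)) = 1 / 2 + D := by ring
        rw [hρ, inv_div, this, mul_div_cancel₀ _ (by positivity : 1 / 2 + D ≠ 0)]
        ring
      · rw [hρ, mul_div_cancel₀ _ hpos.ne']
    · simp [hx, hSc x hx]
  have hP := trajLaw_eq_withDensity A E₀ E₁ hrm (fun z => (hr0 z).le) hdens T
  have hZpos (ω : ℕ → Obs) : 0 < likelihood r T ω := Finset.prod_pos fun s _ => hr0 _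
  have hZm := measurable_likelihood hrm T
  have hint (F : (ℕ → Obs) → ℝ) : ∫ ω, F ω ∂(trajLaw A E₁ T)
      = ∫ ω, likelihood r T ω * F ω ∂(trajLaw A E₀ T) := by
    rw [hP, integral_withDensity_eq_integral_toReal_smul (by fun_prop) (by simp)]
    simp [ENNReal.toReal_ofReal (hZpos _).le]
  have hZi : Integrable (likelihood r T) (trajLaw A E₀ T) := by
    refine ⟨hZm.aestronglyMeasurable, ?_⟩
    rw [hasFiniteIntegral_iff_ofReal (ae_of_all _ fun ω => (hZpos ω).le)]
    have h1 : trajLaw A E₁ T Set.univ = 1 := measure_univ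
    rw [hP, withDensity_apply _ MeasurableSet.univ, setLIntegral_univ] at h1
    rw [h1]
    exact ENNReal.one_lt_top
  have hZ1 : ∫ ω, likelihood r T ω ∂(trajLaw A E₀ T) = 1 := by
    simpa using (hint fun _ => 1).symm
  -- the expected log-likelihood
  set φ : I × ℝ → ℝ := fun z => Real.log (r z) with hφ
  have hφm : Measurable φ := hrm.log
  have hφC (z : I × ℝ) : |φ z| ≤ |Real.log ρ| := by
    simp only [hφ, hr]
    split_ifs <;> simp
  have hφi (t : ℕ) : Integrable (fun ω : ℕ → Obs => φ (ω t).2) (trajLaw A E₀ T) := by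
    refine Integrable.of_bound (C := |Real.log ρ|)
      (hφm.comp (by fun_prop)).aestronglyMeasurable (ae_of_all _ fun ω => hφC _)
  have hindm : Measurable (S.indicator (1 : I → ℝ)) := measurable_one.indicator hS
  -- Given an arm in `S`, the log-ratio has mean (1/2 - D) log ρ - (1/2 + D) log ρ = -2 D log ρ
  -- under the first environment; elsewhere it is 0.
  have hone (t : ℕ) (ht : t < T) : ∫ ω, φ (ω t).2 ∂(trajLaw A E₀ T)
      = -(2 * D * Real.log ρ) * ∫ ω, S.indicator 1 (ω t).2.1 ∂(trajLaw A E₀ T) := by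
    rw [Adapted.integral_eq (s := t + 1) (F := fun ω : ℕ → Obs => φ (ω t).2)
        (fun ω ω' h => by simp only [h t (Nat.lt_succ_self t)]) (hφm.comp (by fun_prop)) A E₀ ht,
      Adapted.integral_eq (s := t + 1) (F := fun ω : ℕ → Obs => S.indicator 1 (ω t).2.1)
        (fun ω ω' h => by simp only [h t (Nat.lt_succ_self t)]) (by fun_prop) A E₀ ht,
      integral_reward A E₀ t hφm hφC, ← integral_const_mul]
    refine integral_congr_ae (ae_of_all _ fun ω => ?_)
    simp only [E₀, bernoulliEnv_reward]
    rw [integral_bernoulliLaw (hg₀ _)]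
    by_cases hx : (ω t).2.1 ∈ S
    · simp only [hφ, hr, hx, if_true, zero_ne_one, if_false, hS₀ _ hx, Set.indicator_of_mem,
        Real.log_inv, Pi.one_apply]
      ring
    · simp [hφ, hr, hx]
  have hlogZ (ω : ℕ → Obs) : Real.log (likelihood r T ω) = ∑ t ∈ Finset.range T, φ (ω t).2 :=
    Real.log_prod fun s _ => (hr0 _).ne'
  have hlogi : Integrable (fun ω => Real.log (likelihood r T ω)) (trajLaw A E₀ T) := by
    simp only [hlogZ]
    exact integrable_finsetSum _ fun t _ => hφi t
  have hlog : ∫ ω, Real.log (likelihood r T ω) ∂(trajLaw A E₀ T)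
      = -(2 * D * Real.log ρ) * ∫ ω, occupation S T ω ∂(trajLaw A E₀ T) := by
    simp only [hlogZ, occupation]
    rw [integral_finsetSum _ fun t _ => hφi t, integral_finsetSum, Finset.mul_sum]
    · exact Finset.sum_congr rfl fun t ht => hone t (Finset.mem_range.1 ht)
    · intro t _
      refine Integrable.of_bound (C := 1)
        (hindm.comp (by fun_prop)).aestronglyMeasurable (ae_of_all _ fun ω => ?_)
      have := indicator_one_mem S (ω t).2.1
      rw [Real.norm_of_nonneg this.1]
      exact this.2
  -- the pointwise inequality
  have hoi := integrable_occupation hS T (trajLaw A E₀ T)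
  have hz (ω : ℕ → Obs) : 1 - occupation S T ω / T ∈ Set.Icc (0 : ℝ) 1 := by
    have h := occupation_mem S T ω
    constructor
    · rw [sub_nonneg, div_le_one hT']
      exact h.2
    · have := div_nonneg h.1 hT'.le
      linarith
  have hzi : Integrable (fun ω => 1 - occupation S T ω / T) (trajLaw A E₀ T) :=
    (integrable_const _).sub (hoi.div_const _)
  have hzZ : Integrable (fun ω => likelihood r T ω * (1 - occupation S T ω / T))
      (trajLaw A E₀ T) := by
    refine hZi.mul_bdd (c := 1) hzi.aestronglyMeasurable (ae_of_all _ fun ω => ?_)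
    rw [Real.norm_of_nonneg (hz ω).1]
    exact (hz ω).2
  -- With z the fraction of time outside `S` and Z the likelihood ratio, use log x ≤ x - 1 at x = (1
  -- + z) Z, and log (1 + z) ≥ z/(1 + z) ≥ z/2 as z ≤ 1. On integrating, log Z gives minus the
  -- relative entropy, z Z gives the mean of z in the second environment, and Z - 1 vanishes. This
  -- plays the role of a Pinsker-type inequality.
  have key : ∫ ω, (Real.log (likelihood r T ω) + 1 / 2 * (1 - occupation S T ω / T))
        ∂(trajLaw A E₀ T)
      ≤ ∫ ω, (likelihood r T ω * (1 - occupation S T ω / T) + (likelihood r T ω - 1))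
        ∂(trajLaw A E₀ T) := by
    refine integral_mono (hlogi.add (hzi.const_mul _)) (hzZ.add (hZi.sub (integrable_const _)))
      fun ω => ?_
    obtain ⟨hz0, hz1⟩ := hz ω
    set z := 1 - occupation S T ω / T
    set Z := likelihood r T ω
    have hZ : 0 < Z := hZpos ω
    have h1 := Real.log_le_sub_one_of_pos (x := (1 + z) * Z) (by positivity)
    rw [Real.log_mul (by positivity) hZ.ne'] at h1
    have h2 := Real.one_sub_inv_le_log_of_pos (x := 1 + z) (by positivity)
    have h3 : 1 / 2 * z ≤ 1 - (1 + z)⁻¹ := by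
      have : 1 - (1 + z)⁻¹ = z / (1 + z) := by
        field_simp
        ring
      rw [this, le_div_iff₀ (by positivity)]
      nlinarith
    simp only
    linarith
  have hZi' : Integrable (fun ω => likelihood r T ω - 1) (trajLaw A E₀ T) :=
    hZi.sub (integrable_const _)
  rw [integral_add hlogi (hzi.const_mul _), integral_add hzZ hZi', integral_sub hZi (integrable_const _), hZ1, integral_const_mul, ← hint, hlog,
    integral_sub (integrable_const _) (hoi.div_const _), integral_sub (integrable_const _)
      ((integrable_occupation hS T _).div_const _), integral_div, integral_div] at key
  simp only [integral_const, probReal_univ, smul_eq_mul, mul_one, sub_self, add_zero] at key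
  have hn : 0 ≤ ∫ ω, occupation S T ω ∂(trajLaw A E₀ T) :=
    integral_nonneg fun ω => (occupation_mem S T ω).1
  have := mul_le_mul_of_nonneg_right (log_ratio_le hD0 hD) hn
  linarith

/-! ### The lower bound -/

/-- Serves both environments: with `b = -D` time spent in the right half is costly, with `b = D`
only time spent in the needle is profitable. -/
lemma regret_ge_of_payoff_le (A : Algorithm) (E : Environment) (T : ℕ) {S : Set I}
    (hS : MeasurableSet S) {a b M : ℝ} (hM : M ≤ ⨆ x, E.f x)
    (hf : ∀ x, E.f x ≤ a + b * S.indicator 1 x) :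
    T * (M - a) - b * ∫ ω, occupation S T ω ∂(trajLaw A E T) ≤ regret A E T := by
  have hsum : ∑ t ∈ Finset.range T, meanPayoff A E t
      ≤ T * a + b * ∫ ω, occupation S T ω ∂(trajLaw A E T) := by
    calc ∑ t ∈ Finset.range T, meanPayoff A E t
        = ∫ ω, ∑ t ∈ Finset.range T, E.f (ω t).2.1 ∂(trajLaw A E T) := by
          rw [integral_finsetSum _ fun t _ => integrable_payoff A E t T]
          exact Finset.sum_congr rfl fun t ht =>
            (integral_payoff A E (Finset.mem_range.1 ht)).symm
      _ ≤ ∫ ω, (T * a + b * occupation S T ω) ∂(trajLaw A E T) := by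
          refine integral_mono (integrable_finsetSum _ fun t _ => integrable_payoff A E t T)
            ((integrable_const _).add ((integrable_occupation hS T _).const_mul b)) fun ω => ?_
          refine (Finset.sum_le_sum fun t _ => hf (ω t).2.1).trans ?_
          simp [occupation, Finset.sum_add_distrib, Finset.mul_sum]
      _ = _ := by
          rw [integral_add (integrable_const _) ((integrable_occupation hS T _).const_mul b),
            integral_const_mul b (occupation S T)]
          simp
  rw [regret_eq_sum, Finset.sum_sub_distrib]
  simp only [Finset.sum_const, Finset.card_range, nsmul_eq_mul]
  have : T * M ≤ T * ⨆ x, E.f x := by gcongr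
  linarith

/-- The right half of `[0,1]`. -/
def rightHalf : Set I := {x | 1 / 2 ≤ (x : ℝ)}

lemma measurableSet_rightHalf : MeasurableSet rightHalf :=
  measurableSet_le measurable_const measurable_subtype_coe

/-- The cell number `j` of the right half, divided into `N` cells. -/
def needle (N j : ℕ) : Set I := {x | 1 / 2 ≤ (x : ℝ) ∧ ⌊((x : ℝ) - 1 / 2) * (2 * N)⌋₊ = j}

lemma measurableSet_needle (N j : ℕ) : MeasurableSet (needle N j) := by
  refine MeasurableSet.inter measurableSet_rightHalf ?_
  have : Measurable fun x : I => ⌊((x : ℝ) - 1 / 2) * (2 * N)⌋₊ :=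
    Nat.measurable_floor.comp (by fun_prop)
  exact this (measurableSet_singleton j)

lemma needle_subset (N j : ℕ) : needle N j ⊆ rightHalf := fun _ hx => hx.1

lemma sum_indicator_needle_le (N : ℕ) (x : I) :
    ∑ j ∈ Finset.range N, (needle N j).indicator (1 : I → ℝ) x
      ≤ rightHalf.indicator (1 : I → ℝ) x := by
  classical
  by_cases hx : 1 / 2 ≤ (x : ℝ)
  · have h (j : ℕ) : (needle N j).indicator (1 : I → ℝ) x
        = if ⌊((x : ℝ) - 1 / 2) * (2 * N)⌋₊ = j then 1 else 0 := by
      simp only [needle, Set.indicator_apply, Set.mem_ofPred_eq, hx, true_and, Pi.one_apply]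
    rw [Set.indicator_of_mem (show x ∈ rightHalf from hx)]
    simp only [h, Finset.sum_ite_eq, Pi.one_apply]
    split_ifs <;> norm_num
  · refine (Finset.sum_nonpos fun j _ => ?_).trans (indicator_one_mem _ _).1
    rw [Set.indicator_of_notMem fun h => hx h.1]

/-- The centre of a cell of the right half. -/
def needleCentre {N j : ℕ} (hj : j < N) : I :=
  ⟨1 / 2 + (2 * j + 1) / (4 * N), by
    have hN : (0 : ℝ) < N := by exact_mod_cast Nat.zero_lt_of_lt hj
    have : (j : ℝ) + 1 ≤ N := by exact_mod_cast hj
    refine ⟨by positivity, ?_⟩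
    have : (2 * (j : ℝ) + 1) / (4 * N) ≤ 1 / 2 := by
      rw [div_le_iff₀ (by positivity)]
      linarith
    linarith⟩

lemma mem_needle_of_lt {N j : ℕ} (hj : j < N) {x : I}
    (hx : |(needleCentre hj : ℝ) - x| < 1 / (4 * N)) : x ∈ needle N j := by
  have hN : (0 : ℝ) < N := by exact_mod_cast Nat.zero_lt_of_lt hj
  rw [abs_lt] at hx
  obtain ⟨h1, h2⟩ := hx
  simp only [needleCentre] at h1 h2
  have e1 : (2 * (j : ℝ) + 1) / (4 * N) = j / (2 * N) + 1 / (4 * N) := by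
    field_simp
    ring
  have e2 : ((j : ℝ) + 1) / (2 * N) = j / (2 * N) + 1 / (4 * N) + 1 / (4 * N) := by
    field_simp
    ring
  have h3 : (j : ℝ) / (2 * N) < (x : ℝ) - 1 / 2 := by linarith
  have h4 : (x : ℝ) - 1 / 2 < (j + 1) / (2 * N) := by linarith
  have h5 : (0 : ℝ) ≤ j / (2 * N) := by positivity
  refine ⟨by linarith, ?_⟩
  rw [Nat.floor_eq_iff (mul_nonneg (by linarith) (by positivity))]
  rw [div_lt_iff₀ (by positivity)] at h3
  rw [lt_div_iff₀ (by positivity)] at h4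
  exact ⟨h3.le, h4⟩

open Classical in
/-- The payoff function which is maximal on the left half of `[0,1]`. -/
def basePayoff (D : ℝ) (x : I) : ℝ := if x ∈ rightHalf then 1 / 2 - D else 1 / 2

open Classical in
/-- The payoff function which is maximal on one cell of the right half. -/
def needlePayoff (D : ℝ) (N j : ℕ) (x : I) : ℝ :=
  if x ∈ needle N j then 1 / 2 + D else basePayoff D x

lemma measurable_basePayoff (D : ℝ) : Measurable (basePayoff D) :=
  Measurable.ite measurableSet_rightHalf measurable_const measurable_const

lemma measurable_needlePayoff (D : ℝ) (N j : ℕ) : Measurable (needlePayoff D N j) :=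
  Measurable.ite (measurableSet_needle N j) measurable_const (measurable_basePayoff D)

lemma basePayoff_mem {D : ℝ} (hD0 : 0 ≤ D) (hD : D ≤ 1 / 4) (x : I) :
    basePayoff D x ∈ Set.Icc (0 : ℝ) 1 := by
  unfold basePayoff
  split_ifs <;> constructor <;> linarith

lemma needlePayoff_mem {D : ℝ} (hD0 : 0 ≤ D) (hD : D ≤ 1 / 4) (N j : ℕ) (x : I) :
    needlePayoff D N j x ∈ Set.Icc (0 : ℝ) 1 := by
  unfold needlePayoff
  split_ifs
  · constructor <;> linarith
  · exact basePayoff_mem hD0 hD x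

/-- Around the maximizer 0, the payoff drops by `D` only at distance at least 1/2, so any exponent
is possible for small `D`. -/
lemma basePayoff_mem_holderClass {D α : ℝ} (hα : 0 < α) (hD0 : 0 ≤ D) (hD : D ≤ (1 / 2) ^ α) :
    basePayoff D ∈ HolderClass 1 α := by
  have h0 : (0 : I) ∉ rightHalf := by
    simp only [rightHalf, Set.mem_ofPred_eq, Set.Icc.coe_zero]
    norm_num
  refine ⟨0, fun x => ?_, fun x => ?_⟩
  · simp only [basePayoff, h0, if_false]
    split_ifs <;> linarith
  · simp only [basePayoff, h0, if_false, one_mul, Set.Icc.coe_zero, zero_sub, abs_neg,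
      abs_of_nonneg x.2.1]
    split_ifs with h
    · rw [sub_sub_cancel, abs_of_nonneg hD0]
      exact hD.trans (Real.rpow_le_rpow (by norm_num) h hα.le)
    · rw [sub_self, abs_zero]
      exact Real.rpow_nonneg x.2.1 _

/-- Around the centre of the needle the payoff is constant up to distance 1/(4N), and drops by at
most 2 D beyond. -/
lemma needlePayoff_mem_holderClass {D α : ℝ} (hα : 0 < α) (hD0 : 0 ≤ D) {N j : ℕ} (hj : j < N)
    (hD : 2 * D ≤ (1 / (4 * N)) ^ α) : needlePayoff D N j ∈ HolderClass 1 α := by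
  have hN : (0 : ℝ) < N := by exact_mod_cast Nat.zero_lt_of_lt hj
  have hc : needleCentre hj ∈ needle N j := mem_needle_of_lt hj (by
    rw [sub_self, abs_zero]
    positivity)
  have hb (x : I) : 1 / 2 - D ≤ basePayoff D x ∧ basePayoff D x ≤ 1 / 2 := by
    unfold basePayoff
    split_ifs <;> constructor <;> linarith
  refine ⟨needleCentre hj, fun x => ?_, fun x => ?_⟩
  · simp only [needlePayoff, hc, if_true]
    split_ifs
    · exact le_rfl
    · linarith [(hb x).2]
  · simp only [needlePayoff, hc, if_true, one_mul]
    split_ifs with h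
    · rw [sub_self, abs_zero]
      positivity
    · have h1 : 1 / (4 * (N : ℝ)) ≤ |(needleCentre hj : ℝ) - x| :=
        not_lt.1 fun h' => h (mem_needle_of_lt hj h')
      rw [abs_of_nonneg (by linarith [(hb x).2])]
      have h2 := Real.rpow_le_rpow (by positivity) h1 hα.le
      linarith [(hb x).1]

/-- If the regret is small in an environment with regularity `α`, it is large in an environment
with regularity `α'`. -/
lemma exists_hard_environment (A : Algorithm) {α α' D : ℝ} (hα : 0 < α) (hα' : 0 < α')
    (hD0 : 0 ≤ D) (hD : D ≤ 1 / 4) {N T : ℕ} (hN : 0 < N) (hT : 0 < T)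
    (hDα : D ≤ (1 / 2) ^ α) (hDα' : 2 * D ≤ (1 / (4 * N)) ^ α') :
    ∃ E₀ E₁ : Environment, E₀.f ∈ HolderClass 1 α ∧ E₁.f ∈ HolderClass 1 α' ∧
      D * T * (1 / 2 * (1 - 1 / N) - 16 * D * regret A E₀ T / N) ≤ regret A E₁ T := by
  have hN' : (0 : ℝ) < N := by exact_mod_cast hN
  have hT' : (0 : ℝ) < T := by exact_mod_cast hT
  set E₀ := bernoulliEnv (basePayoff D) (measurable_basePayoff D) (basePayoff_mem hD0 hD) with hE₀
  set n : ℕ → ℝ := fun j => ∫ ω, occupation (needle N j) T ω ∂(trajLaw A E₀ T) with hn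
  have hn0 (j : ℕ) : 0 ≤ n j := integral_nonneg fun ω => (occupation_mem _ T ω).1
  have hsum : ∑ j ∈ Finset.range N, n j
      ≤ ∫ ω, occupation rightHalf T ω ∂(trajLaw A E₀ T) := by
    rw [← integral_finsetSum _ fun j _ =>
      integrable_occupation (measurableSet_needle N j) T (trajLaw A E₀ T)]
    refine integral_mono (integrable_finsetSum _ fun j _ =>
      integrable_occupation (measurableSet_needle N j) T (trajLaw A E₀ T))
      (integrable_occupation measurableSet_rightHalf T _) fun ω => ?_
    simp only [occupation]
    rw [Finset.sum_comm]
    exact Finset.sum_le_sum fun t _ => sum_indicator_needle_le N _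
  have hsumT : ∑ j ∈ Finset.range N, n j ≤ T := by
    refine hsum.trans ?_
    have := integral_mono (integrable_occupation measurableSet_rightHalf T (trajLaw A E₀ T))
      (integrable_const (T : ℝ)) fun ω => (occupation_mem _ T ω).2
    simpa using this
  have hreg₀ : D * ∑ j ∈ Finset.range N, n j ≤ regret A E₀ T := by
    have h1 : (1 / 2 : ℝ) ≤ ⨆ x, E₀.f x := by
      refine le_trans (le_of_eq ?_) (E₀.le_iSup 0)
      rw [hE₀, bernoulliEnv_f, basePayoff, if_neg]
      simp only [rightHalf, Set.mem_ofPred_eq, Set.Icc.coe_zero]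
      norm_num
    have h2 := regret_ge_of_payoff_le A E₀ T (S := rightHalf) (a := 1 / 2) (b := -D)
      measurableSet_rightHalf h1 fun x => by
        rw [hE₀, bernoulliEnv_f, basePayoff]
        by_cases hx : x ∈ rightHalf <;> simp [hx, sub_eq_add_neg]
    have := mul_le_mul_of_nonneg_left hsum hD0
    linarith
  -- The least visited cell is at or below the average, which is bounded both by T/N and, through
  -- the regret in `E₀`, by regret/(D N). The first bound serves the main term of
  -- `occupation_change`, the second its entropy term.
  obtain ⟨j, hj, hnj⟩ : ∃ j ∈ Finset.range N, n j ≤ (∑ j ∈ Finset.range N, n j) / N := by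
    refine Finset.exists_le_of_sum_le (Finset.nonempty_range_iff.2 hN.ne') ?_
    rw [Finset.sum_const, Finset.card_range, nsmul_eq_mul, mul_div_cancel₀ _ hN'.ne']
  rw [Finset.mem_range] at hj
  set E₁ := bernoulliEnv (needlePayoff D N j) (measurable_needlePayoff D N j)
    (needlePayoff_mem hD0 hD N j) with hE₁
  refine ⟨E₀, E₁, basePayoff_mem_holderClass hα hD0 hDα,
    needlePayoff_mem_holderClass hα' hD0 hj hDα', ?_⟩
  have hchange := occupation_change A (measurableSet_needle N j) hD0 hD (measurable_basePayoff D)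
    (measurable_needlePayoff D N j) (basePayoff_mem hD0 hD) (needlePayoff_mem hD0 hD N j)
    (fun x hx => by simp [basePayoff, needle_subset N j hx]) (fun x hx => by simp [needlePayoff, hx])
    (fun x hx => by simp [needlePayoff, hx]) hT
  have hreg₁ := regret_ge_of_payoff_le A E₁ T (S := needle N j) (a := 1 / 2) (b := D)
    (M := 1 / 2 + D) (measurableSet_needle N j) (by
      refine le_trans (le_of_eq ?_) (E₁.le_iSup (needleCentre hj))
      rw [hE₁, bernoulliEnv_f, needlePayoff, if_pos]
      refine mem_needle_of_lt hj ?_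
      rw [sub_self, abs_zero]
      positivity) fun x => by
        rw [hE₁, bernoulliEnv_f, needlePayoff]
        by_cases hx : x ∈ needle N j
        · simp [hx]
        · simp only [hx, if_false, not_false_eq_true, Set.indicator_of_notMem, mul_zero, add_zero,
            basePayoff]
          split_ifs <;> linarith
  refine le_trans ?_ hreg₁
  set b := ∫ ω, occupation (needle N j) T ω ∂(trajLaw A E₁ T)
  have e : (T : ℝ) * (1 / 2 + D - 1 / 2) - D * b = D * T * (1 - b / T) := by
    field_simp
    ring
  rw [e]
  refine mul_le_mul_of_nonneg_left (le_trans ?_ hchange) (by positivity)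
  have h1 : n j / T ≤ 1 / N := by
    rw [div_le_div_iff₀ hT' hN']
    rw [le_div_iff₀ hN'] at hnj
    linarith
  have h2 : 16 * D ^ 2 * n j ≤ 16 * D * regret A E₀ T / N := by
    rw [le_div_iff₀ hN']
    rw [le_div_iff₀ hN'] at hnj
    have := mul_le_mul_of_nonneg_left hnj hD0
    nlinarith
  change _ ≤ 1 / 2 * (1 - n j / T) - 16 * D ^ 2 * n j
  linarith

/-! ### Exponents forced by the pair of environments -/

/-- The meaning of `Achieves`, with real numbers. -/
lemma Achieves.exists_bound {A : Algorithm} {θ : ℝ → ℝ} (h : Achieves A θ) {ε α L : ℝ} (hε : 0 < ε)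
    (hα : 0 < α) (hL : 0 < L) :
    ∃ C : ℝ, 0 ≤ C ∧ ∀ᶠ T : ℕ in atTop, ∀ E : Environment, E.f ∈ HolderClass L α →
      regret A E T ≤ C * (T : ℝ) ^ (θ α + ε) := by
  obtain ⟨C, hC1, hC2⟩ := ENNReal.lt_iff_exists_nnreal_btwn.1 (h.2 ε hε α L hα hL)
  refine ⟨C, C.2, ?_⟩
  filter_upwards [eventually_lt_of_limsup_lt hC1, eventually_gt_atTop 0] with T hT hT0 E hE
  have hpos : 0 < (T : ℝ) ^ (θ α + ε) := Real.rpow_pos_of_pos (by exact_mod_cast hT0) _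
  rw [ENNReal.div_lt_iff (Or.inl (by simpa using hpos)) (Or.inl ENNReal.ofReal_ne_top)] at hT
  have h1 : ENNReal.ofReal (regret A E T) ≤ worstRegret A L α T := le_iSup₂_of_le E hE le_rfl
  have h2 := h1.trans hT.le
  rw [← ENNReal.ofReal_coe_nnreal, ← ENNReal.ofReal_mul (NNReal.coe_nonneg C)] at h2
  exact (ENNReal.ofReal_le_ofReal_iff (by positivity)).1 h2

lemma le_of_eventually_rpow_le {a b c C : ℝ} (hc : 0 < c)
    (h : ∀ᶠ T : ℕ in atTop, c * (T : ℝ) ^ a ≤ C * (T : ℝ) ^ b) : a ≤ b := by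
  by_contra! hab
  have h1 : Tendsto (fun T : ℕ => (T : ℝ) ^ (a - b)) atTop atTop :=
    (tendsto_rpow_atTop (sub_pos.2 hab)).comp tendsto_natCast_atTop_atTop
  obtain ⟨T, hT, hT1, hT0⟩ :=
    (h.and ((h1.eventually_gt_atTop (C / c)).and (eventually_gt_atTop 0))).exists
  have hT' : (0 : ℝ) < T := by exact_mod_cast hT0
  rw [Real.rpow_sub hT', div_lt_div_iff₀ hc (Real.rpow_pos_of_pos hT' _)] at hT1
  linarith

/-- The price of adaptation. -/
lemma Achieves.le_rate {A : Algorithm} {θ : ℝ → ℝ} (h : Achieves A θ) {α α' : ℝ} (hα : 0 < α)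
    (hα' : 0 < α') : 1 - θ α * (α' / (α' + 1)) ≤ θ α' := by
  suffices H : ∀ ε, 0 < ε → 1 - (θ α + 2 * ε) * (α' / (α' + 1)) ≤ θ α' + ε by
    refine le_of_forall_pos_le_add fun ε hε => ?_
    have h1 := H (ε / 3) (by positivity)
    have h2 : α' / (α' + 1) ≤ 1 := by
      rw [div_le_one (by linarith)]
      linarith
    nlinarith
  intro ε hε
  have hθ : 0 ≤ θ α := (h.1.2 α hα).1
  set s := θ α + 2 * ε with hs
  have hs0 : 0 < s := by linarith
  -- Chosen so that N ≈ T^γ satisfies N^(1+α') ≈ T^(θ(α)+2ε), which exceeds the regret in `E₀` by a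
  -- factor T^ε. With D ≈ N^(-α'), the entropy term D · regret / N then tends to 0.
  set γ := s / (1 + α') with hγ
  have hγ0 : 0 < γ := by positivity
  obtain ⟨C, hC0, hC⟩ := h.exists_bound hε hα one_pos
  obtain ⟨C', -, hC'⟩ := h.exists_bound hε hα' one_pos
  refine le_of_eventually_rpow_le (c := (1 / 8) ^ α' / 16) (C := C') (by positivity) ?_
  have hlim (δ : ℝ) (hδ : 0 < δ) : Tendsto (fun T : ℕ => (T : ℝ) ^ (-δ)) atTop (𝓝 0) :=
    (tendsto_rpow_neg_atTop hδ).comp tendsto_natCast_atTop_atTop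
  have hγlim : Tendsto (fun T : ℕ => (T : ℝ) ^ γ) atTop atTop :=
    (tendsto_rpow_atTop hγ0).comp tendsto_natCast_atTop_atTop
  have hsmall (c : ℝ) (hc : 0 < c) (δ : ℝ) (hδ : 0 < δ) (K : ℝ) :
      ∀ᶠ T : ℕ in atTop, K * (T : ℝ) ^ (-δ) ≤ c := by
    have := (hlim δ hδ).const_mul K
    rw [mul_zero] at this
    exact (this.eventually_lt_const hc).mono fun T => le_of_lt
  -- Here T^γ ≥ 2 gives N ≥ 2 and N ≤ 2 T^γ; the next two conditions give D ≤ 1/4 and D ≤ (1/2)^α;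
  -- the last bounds the entropy term by 1/8. The bracket in `exists_hard_environment` is then at
  -- least 1/4 - 1/8.
  filter_upwards [hC, hC', eventually_gt_atTop 0, hγlim.eventually_ge_atTop 2,
    hsmall (1 / 4) (by norm_num) (γ * α') (by positivity) 1,
    hsmall ((1 / 2) ^ α) (by positivity) (γ * α') (by positivity) 1,
    hsmall (1 / 8) (by norm_num) ε hε (8 * C)] with T h1 h2 hT h3 h4 h5 h6
  have hT' : (0 : ℝ) < T := by exact_mod_cast hT
  set N := ⌈(T : ℝ) ^ γ⌉₊ with hN
  have hN1 : (T : ℝ) ^ γ ≤ N := Nat.le_ceil _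
  have hN2 : (N : ℝ) ≤ 2 * (T : ℝ) ^ γ := by
    have := (Nat.ceil_lt_add_one (a := (T : ℝ) ^ γ) (by positivity)).le
    linarith
  have hN0 : (0 : ℝ) < N := by linarith
  set D := 1 / 2 * (1 / (4 * (N : ℝ))) ^ α' with hD
  have hD0 : 0 ≤ D := by positivity
  have hTγ : ((T : ℝ) ^ γ) ^ (-α') = (T : ℝ) ^ (-(γ * α')) := by
    rw [← Real.rpow_mul hT'.le, mul_neg]
  have hDle : D ≤ 1 / 2 * ((N : ℝ)) ^ (-α') := by
    rw [hD, Real.rpow_neg hN0.le, ← Real.inv_rpow hN0.le]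
    gcongr
    rw [one_div]
    gcongr
    linarith
  have hNα : (N : ℝ) ^ (-α') ≤ (T : ℝ) ^ (-(γ * α')) := by
    rw [← hTγ]
    exact Real.rpow_le_rpow_of_nonpos (by linarith) hN1 (by linarith)
  obtain ⟨E₀, E₁, hE₀, hE₁, hE⟩ := exists_hard_environment A (D := D) (N := N) hα hα' hD0
    (by linarith) (by exact_mod_cast hN0) hT (by linarith) (by rw [hD]; linarith)
  have hr0 := h1 E₀ hE₀
  have hr1 := h2 E₁ hE₁
  have hterm : 16 * D * regret A E₀ T / N ≤ 1 / 8 := by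
    refine le_trans ?_ h6
    rw [div_le_iff₀ hN0]
    have e1 : (T : ℝ) ^ (θ α + ε) = (T : ℝ) ^ (-ε) * ((T : ℝ) ^ γ) ^ (1 + α') := by
      rw [← Real.rpow_mul hT'.le, ← Real.rpow_add hT']
      congr 1
      rw [hγ, div_mul_cancel₀ _ (by positivity), hs]
      ring
    have e2 : ((T : ℝ) ^ γ) ^ (1 + α') ≤ (N : ℝ) ^ (1 + α') :=
      Real.rpow_le_rpow (by positivity) hN1 (by positivity)
    have e3 : (N : ℝ) ^ (-α') * (N : ℝ) ^ (1 + α') = N := by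
      rw [← Real.rpow_add hN0]
      simp
    calc 16 * D * regret A E₀ T
        ≤ 16 * (1 / 2 * (N : ℝ) ^ (-α')) * (C * ((T : ℝ) ^ (-ε) * (N : ℝ) ^ (1 + α'))) := by
          refine mul_le_mul (by linarith) ?_ (regret_nonneg _ _ _) (by positivity)
          refine hr0.trans ?_
          rw [e1]
          gcongr
      _ = 8 * C * (T : ℝ) ^ (-ε) * ((N : ℝ) ^ (-α') * (N : ℝ) ^ (1 + α')) := by ring
      _ = _ := by rw [e3]
  have hinv : 1 / (N : ℝ) ≤ 1 / 2 := one_div_le_one_div_of_le (by norm_num) (by linarith)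
  have hlow : D * T * (1 / 8) ≤ regret A E₁ T := by
    refine le_trans ?_ hE
    exact mul_le_mul_of_nonneg_left (by linarith) (by positivity)
  refine le_trans (le_trans ?_ hlow) hr1
  have hDge : 1 / 2 * ((1 / 8) ^ α' * (T : ℝ) ^ (-(γ * α'))) ≤ D := by
    rw [hD, ← hTγ, Real.rpow_neg (by positivity), ← Real.inv_rpow (by positivity),
      ← Real.mul_rpow (by norm_num) (by positivity)]
    gcongr
    rw [← one_div, one_div_mul_one_div]
    exact one_div_le_one_div_of_le (by positivity) (by linarith)
  have e4 : (T : ℝ) ^ (1 - s * (α' / (α' + 1))) = (T : ℝ) ^ (-(γ * α')) * T := by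
    rw [← Real.rpow_add_one hT'.ne']
    congr 1
    rw [hγ]
    field_simp
    ring
  rw [e4]
  calc (1 / 8) ^ α' / 16 * ((T : ℝ) ^ (-(γ * α')) * T)
      = 1 / 2 * ((1 / 8) ^ α' * (T : ℝ) ^ (-(γ * α'))) * T * (1 / 8) := by ring
    _ ≤ _ := by gcongr

/-! ### The rate functions `θ_m` -/

lemma isRateFunction_theta {m : ℝ} (hm : m ∈ Set.Icc (1 / 2 : ℝ) 1) : IsRateFunction (theta m) := by
  obtain ⟨hm1, hm2⟩ := hm
  refine ⟨fun a ha b hb hab => ?_, fun a ha => ⟨?_, ?_⟩⟩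
  · rw [Set.mem_Ioi] at ha hb
    have : a / (a + 1) ≤ b / (b + 1) := by
      rw [div_le_div_iff₀ (by linarith) (by linarith)]
      nlinarith
    unfold theta
    gcongr
  · exact le_max_of_le_left (by linarith)
  · have : 0 ≤ a / (a + 1) := by positivity
    exact max_le hm2 (by nlinarith)

/-- Letting the regularity tend to infinity in `Achieves.le_rate`, where θ_m tends to m, forces the
branch 1 - m α/(α+1) from below everywhere. An improvement can then only be a value below m; the
same inequality turns it into a value above m at the point where the two branches of θ_m meet, which
is excluded as well. -/
lemma not_strictlySmaller_theta {m : ℝ} (hm : m ∈ Set.Ico (1 / 2 : ℝ) 1) {A : Algorithm}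
    {θ : ℝ → ℝ} (hA : Achieves A θ) : ¬ StrictlySmaller θ (theta m) := by
  obtain ⟨hm1, hm2⟩ := hm
  rintro ⟨hle, α₀, hα₀, hlt⟩
  have hfrac (a : ℝ) (ha : 0 < a) : 0 < a / (a + 1) := by positivity
  have hlow (a : ℝ) (ha : 0 < a) : 1 - m * (a / (a + 1)) ≤ θ a := by
    have hlim : Tendsto (fun b : ℝ => 1 - theta m b * (a / (a + 1))) atTop
        (𝓝 (1 - m * (a / (a + 1)))) := by
      refine Tendsto.const_sub _ (Tendsto.mul_const _ ?_)
      have h1 : Tendsto (fun b : ℝ => b / (b + 1)) atTop (𝓝 1) := by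
        have h2 : Tendsto (fun b : ℝ => 1 - (b + 1)⁻¹) atTop (𝓝 (1 - 0)) :=
          Tendsto.const_sub _ (tendsto_inv_atTop_zero.comp (tendsto_atTop_add_const_right _ 1
            tendsto_id))
        rw [sub_zero] at h2
        refine h2.congr' ?_
        filter_upwards [eventually_gt_atTop 0] with b hb
        field_simp
        ring
      have h3 : Tendsto (fun b : ℝ => max m (1 - m * (b / (b + 1)))) atTop
          (𝓝 (max m (1 - m * 1))) :=
        tendsto_const_nhds.max ((h1.const_mul m).const_sub 1)
      rwa [max_eq_left (by linarith)] at h3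
    refine le_of_tendsto hlim ?_
    filter_upwards [eventually_gt_atTop 0] with b hb
    refine le_trans ?_ (hA.le_rate hb ha)
    have := mul_le_mul_of_nonneg_right (hle b hb) (hfrac a ha).le
    linarith
  have hm' : θ α₀ < m ∧ 1 - m * (α₀ / (α₀ + 1)) < m := by
    rcases lt_max_iff.1 hlt with h | h
    · exact ⟨h, (hlow α₀ hα₀).trans_lt h⟩
    · exact absurd (hlow α₀ hα₀) (not_le.2 h)
  have hm3 : 1 / 2 < m := by
    have h1 : α₀ / (α₀ + 1) < 1 := by
      rw [div_lt_one (by linarith)]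
      linarith
    nlinarith
  -- The solution of m = 1 - m a/(a+1), where both branches of θ_m agree. It is positive because 1/2
  -- < m < 1.
  set a := (1 - m) / (2 * m - 1) with ha
  have ha0 : 0 < a := div_pos (by linarith) (by linarith)
  have hae : a / (a + 1) = (1 - m) / m := by
    have h0 : 2 * m - 1 ≠ 0 := by linarith
    have h1 : a + 1 = m / (2 * m - 1) := by
      rw [ha, div_add_one h0]
      congr 1
      ring
    rw [h1, ha, div_div_div_cancel_right₀ h0]
  have hθa : theta m a = m := by
    rw [theta, hae, mul_div_cancel₀ _ (by linarith)]
    simp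
  have h1 := hA.le_rate hα₀ ha0
  have h2 := hle a ha0
  rw [hθa] at h2
  have h3 := mul_lt_mul_of_pos_right hm'.1 (hfrac a ha0)
  have h4 : m * (a / (a + 1)) = 1 - m := by rw [hae, mul_div_cancel₀ _ (by linarith)]
  linarith

/-! ### The regret of the doubling trick -/

lemma phase_eq {k r : ℕ} (hr : r < 2 ^ k) : phase (2 ^ k - 1 + r) = k := by
  have h1 : 1 ≤ 2 ^ k := Nat.one_le_two_pow
  refine Nat.log_eq_of_pow_le_of_lt_pow (by omega) ?_
  rw [pow_succ]
  omega

lemma phaseTime_eq {k r : ℕ} (hr : r < 2 ^ k) : phaseTime (2 ^ k - 1 + r) = r := by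
  have h1 : 1 ≤ 2 ^ k := Nat.one_le_two_pow
  rw [phaseTime, phase_eq hr]
  omega

/-- The trajectory from round `t` on. -/
def shift (t : ℕ) (ω : ℕ → Obs) : ℕ → Obs := fun n => ω (t + n)

@[fun_prop]
lemma measurable_shift (t : ℕ) : Measurable (shift t) :=
  measurable_pi_lambda _ fun _ => measurable_pi_apply _

lemma kernel_doublingTrick (A : ℕ → Algorithm) {k r : ℕ} (hr : r < 2 ^ k) (ω : ℕ → Obs) :
    (doublingTrick A).kernel (2 ^ k - 1 + r) (initial (2 ^ k - 1 + r) ω)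
      = (A k).kernel r (initial r (shift (2 ^ k - 1) ω)) := by
  have h (k' r' : ℕ) (hk : k' = k) (hr' : r' = r) (g : Fin r' → Obs)
      (hg : ∀ j : Fin r', g j = ω (2 ^ k - 1 + j)) :
      (A k').kernel r' g = (A k).kernel r (initial r (shift (2 ^ k - 1) ω)) := by
    subst hk hr'
    congr 1
    ext j : 1
    exact hg j
  refine h _ _ (phase_eq hr) (phaseTime_eq hr) _ fun j => ?_
  simp only [phaseHistory, initial_apply]
  congr 1
  have := phaseTime_eq hr
  omega

lemma shift_setRound (t r : ℕ) (ω : ℕ → Obs) (q : (ℕ × I) × ℝ) :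
    shift t (setRound (t + r) (ω, q)) = setRound r (shift t ω, q) := by
  ext n : 1
  by_cases h : n = r
  · subst h
    simp [shift]
  · rw [setRound_of_ne h, shift, setRound_of_ne (by omega)]
    rfl

/-- Within phase `k` the kernels read only the record of the phase, so the trajectory seen from the
start of the phase evolves as a fresh run of `A k`. Hence the regrets of the phases add up. -/
lemma map_shift_trajLaw (A : ℕ → Algorithm) (E : Environment) {k r : ℕ} (hr : r ≤ 2 ^ k) :
    (trajLaw (doublingTrick A) E (2 ^ k - 1 + r)).map (shift (2 ^ k - 1))
      = trajLaw (A k) E r := by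
  induction r with
  | zero =>
    rw [trajLaw_zero, add_zero, trajLaw, Measure.map_map (measurable_shift _) measurable_extend]
    have : shift (2 ^ k - 1) ∘ extend (t := 2 ^ k - 1) = fun _ _ => (0, 0, 0) := by
      ext h n : 2
      simp [shift, extend]
    rw [this, Measure.map_const, measure_univ, one_smul]
  | succ r ih =>
    specialize ih (by omega)
    refine Measure.ext_of_lintegral _ fun F hF => ?_
    have hF1 : Measurable fun ω => F (shift (2 ^ k - 1) ω) := hF.comp (measurable_shift _)
    have hF2 : Measurable fun p => F (setRound r p) := hF.comp (measurable_setRound r)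
    rw [lintegral_map hF (measurable_shift _), ← add_assoc, lintegral_trajLaw_succ _ _ _ hF1,
      lintegral_trajLaw_succ _ _ _ hF, ← ih,
      lintegral_map (Measurable.lintegral_kernel_prod_right hF2) (measurable_shift _)]
    refine lintegral_congr fun ω => ?_
    simp only [shift_setRound]
    have hF3 : Measurable fun q => F (setRound r (shift (2 ^ k - 1) ω, q)) :=
      hF2.comp (by fun_prop)
    rw [lintegral_stepKernel _ _ _ _ hF3, lintegral_stepKernel _ _ _ _ hF3,
      kernel_doublingTrick A (by omega)]

lemma meanPayoff_doublingTrick (A : ℕ → Algorithm) (E : Environment) {k r : ℕ} (hr : r < 2 ^ k) :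
    meanPayoff (doublingTrick A) E (2 ^ k - 1 + r) = meanPayoff (A k) E r := by
  have hm : Measurable fun ω : ℕ → Obs => E.f (ω r).2.1 := E.measurable_f.comp (by fun_prop)
  rw [meanPayoff, meanPayoff, ← map_shift_trajLaw A E (show r + 1 ≤ 2 ^ k from hr),
    integral_map (measurable_shift _).aemeasurable hm.aestronglyMeasurable]
  rfl

lemma regret_doublingTrick (A : ℕ → Algorithm) (E : Environment) (k : ℕ) :
    regret (doublingTrick A) E (2 ^ k - 1) = ∑ j ∈ Finset.range k, regret (A j) E (2 ^ j) := by
  induction k with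
  | zero => simp [regret_eq_sum]
  | succ k ih =>
    have h1 : 1 ≤ 2 ^ k := Nat.one_le_two_pow
    have h2 : 2 ^ (k + 1) - 1 = 2 ^ k - 1 + 2 ^ k := by
      rw [pow_succ]
      omega
    rw [Finset.sum_range_succ, ← ih, h2, regret_eq_sum, regret_eq_sum, regret_eq_sum,
      Finset.sum_range_add]
    congr 1
    refine Finset.sum_congr rfl fun r hr => ?_
    rw [meanPayoff_doublingTrick A E (Finset.mem_range.1 hr)]

/-! ### A maximal inequality -/

/-- The running maximum of `W τ, …, W (τ + r)`. -/
def runMax (W : ℕ → (ℕ → Obs) → ℝ) (τ : ℕ) : ℕ → (ℕ → Obs) → ℝ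
  | 0, ω => W τ ω
  | r + 1, ω => max (runMax W τ r ω) (W (τ + r + 1) ω)

lemma runMax_mono (W : ℕ → (ℕ → Obs) → ℝ) (τ : ℕ) (ω : ℕ → Obs) :
    Monotone fun r => runMax W τ r ω :=
  monotone_nat_of_le_succ fun _ => le_max_left _ _

lemma le_runMax (W : ℕ → (ℕ → Obs) → ℝ) (τ : ℕ) (ω : ℕ → Obs) {r R : ℕ} (h : r ≤ R) :
    W (τ + r) ω ≤ runMax W τ R ω := by
  refine le_trans ?_ (runMax_mono W τ ω h)
  cases r with
  | zero => exact le_rfl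
  | succ r => exact le_max_right _ _

lemma measurable_runMax {W : ℕ → (ℕ → Obs) → ℝ} (hW : ∀ s, Measurable (W s)) (τ r : ℕ) :
    Measurable (runMax W τ r) := by
  induction r with
  | zero => exact hW τ
  | succ r ih => exact ih.max (hW _)

lemma adapted_runMax {W : ℕ → (ℕ → Obs) → ℝ} {τ : ℕ} (hW : ∀ s, τ ≤ s → Adapted s (W s))
    (r : ℕ) : Adapted (τ + r) (runMax W τ r) := by
  induction r with
  | zero => exact hW τ le_rfl
  | succ r ih =>
    intro ω ω' h
    simp only [runMax]
    rw [ih.mono (Nat.le_succ _) ω ω' h, hW (τ + r + 1) (by omega) ω ω' h]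

lemma runMax_pos {W : ℕ → (ℕ → Obs) → ℝ} (hW : ∀ s ω, 0 < W s ω) (τ r : ℕ) (ω : ℕ → Obs) :
    0 < runMax W τ r ω :=
  (hW τ ω).trans_le (le_runMax W τ ω (Nat.zero_le r))

/-- The function `(w, m) ↦ m ^ (2/3) + 2 w m ^ (-1/3)` does not increase when the maximum `m` is
updated. -/
lemma bellman_le {m w : ℝ} (hm : 0 < m) (hw : 0 < w) :
    (max m w) ^ (2 / 3 : ℝ) + 2 * w * (max m w) ^ (-(1 / 3) : ℝ)
      ≤ m ^ (2 / 3 : ℝ) + 2 * w * m ^ (-(1 / 3) : ℝ) := by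
  rcases le_total w m with h | h
  · rw [max_eq_left h]
  rw [max_eq_right h]
  set a := w ^ (1 / 3 : ℝ) with ha
  set b := m ^ (1 / 3 : ℝ) with hb
  have ha0 : 0 < a := Real.rpow_pos_of_pos hw _
  have hb0 : 0 < b := Real.rpow_pos_of_pos hm _
  have h2 (x : ℝ) (hx : 0 < x) : x ^ (2 / 3 : ℝ) = (x ^ (1 / 3 : ℝ)) ^ 2 := by
    rw [← Real.rpow_natCast, ← Real.rpow_mul hx.le]
    norm_num
  have h3 : w = a ^ 3 := by
    rw [ha, ← Real.rpow_natCast, ← Real.rpow_mul hw.le]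
    norm_num
  rw [Real.rpow_neg hw.le, Real.rpow_neg hm.le, h2 w hw, h2 m hm, ← ha, ← hb, h3]
  have e1 : a ^ 2 + 2 * a ^ 3 * a⁻¹ = 3 * a ^ 2 := by
    field_simp
    ring
  have e2 : b ^ 2 + 2 * a ^ 3 * b⁻¹ = (b ^ 3 + 2 * a ^ 3) / b := by
    field_simp
  rw [e1, e2, le_div_iff₀ hb0]
  -- After taking cube roots the claim is 3 a² b ≤ b³ + 2 a³, and the difference is (a - b)² (2 a +
  -- b).
  nlinarith [mul_nonneg (sq_nonneg (a - b)) (by positivity : 0 ≤ 2 * a + b)]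

/-- A maximal inequality for positive supermartingales. -/
lemma lintegral_runMax_le (A : Algorithm) (E : Environment) {W : ℕ → (ℕ → Obs) → ℝ} {τ R : ℕ}
    {w₀ : ℝ} (hm : ∀ s, Measurable (W s)) (hW : ∀ s, τ ≤ s → Adapted s (W s))
    (hpos : ∀ s ω, 0 < W s ω) (hinit : ∀ ω, W τ ω ≤ w₀)
    (hstep : ∀ r < R, ∀ ω, ∫⁻ q, ENNReal.ofReal (W (τ + r + 1) (setRound (τ + r) (ω, q)))
      ∂(stepKernel A E (τ + r) ω) ≤ ENNReal.ofReal (W (τ + r) ω)) :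
    ∫⁻ ω, ENNReal.ofReal (runMax W τ R ω ^ (2 / 3 : ℝ)) ∂(trajLaw A E (τ + R))
      ≤ ENNReal.ofReal (3 * w₀ ^ (2 / 3 : ℝ)) := by
  have hM := measurable_runMax hm τ
  have hMpos := runMax_pos hpos τ
  -- A Bellman function of the running maximum and the current value. By `bellman_le`, updating the
  -- maximum does not increase it; for a fixed maximum it is affine in the current value with
  -- positive slope, so the supermartingale property makes its mean nonincreasing. It starts at
  -- three times the 2/3-th power of the initial value and dominates the 2/3-th power of the
  -- maximum.
  set B : ℕ → (ℕ → Obs) → ℝ := fun r ω => runMax W τ r ω ^ (2 / 3 : ℝ)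
    + 2 * W (τ + r) ω * runMax W τ r ω ^ (-(1 / 3) : ℝ) with hB
  have hBm (r : ℕ) : Measurable (B r) := by
    have h1 := hM r
    have h2 := hm (τ + r)
    simp only [hB]
    fun_prop
  have main : ∀ r ≤ R, ∫⁻ ω, ENNReal.ofReal (B r ω) ∂(trajLaw A E (τ + r))
      ≤ ENNReal.ofReal (3 * w₀ ^ (2 / 3 : ℝ)) := by
    intro r
    induction r with
    | zero =>
      intro _
      have h1 (ω : ℕ → Obs) :
          ENNReal.ofReal (B 0 ω) ≤ ENNReal.ofReal (3 * w₀ ^ (2 / 3 : ℝ)) := by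
        refine ENNReal.ofReal_le_ofReal ?_
        have hw := hpos τ ω
        have e : B 0 ω = 3 * W τ ω ^ (2 / 3 : ℝ) := by
          have : W τ ω * W τ ω ^ (-(1 / 3) : ℝ) = W τ ω ^ (2 / 3 : ℝ) := by
            conv_lhs => enter [1]; rw [← Real.rpow_one (W τ ω)]
            rw [← Real.rpow_add hw]
            norm_num
          simp only [hB, runMax, add_zero]
          rw [mul_assoc, this]
          ring
        rw [e]
        gcongr
        exact hinit ω
      refine (lintegral_mono h1).trans ?_
      simp
    | succ r ih =>
      intro hr
      refine le_trans ?_ (ih (by omega))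
      rw [← add_assoc, lintegral_trajLaw_succ _ _ _ (hBm (r + 1)).ennreal_ofReal]
      refine lintegral_mono fun ω => ?_
      set M := runMax W τ r ω
      have hMp : 0 < M := hMpos r ω
      have h1 (q : (ℕ × I) × ℝ) : ENNReal.ofReal (B (r + 1) (setRound (τ + r) (ω, q)))
          ≤ ENNReal.ofReal (M ^ (2 / 3 : ℝ)) + ENNReal.ofReal (2 * M ^ (-(1 / 3) : ℝ))
            * ENNReal.ofReal (W (τ + r + 1) (setRound (τ + r) (ω, q))) := by
        rw [← ENNReal.ofReal_mul (by positivity), ← ENNReal.ofReal_add (by positivity)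
          (mul_nonneg (by positivity) (hpos _ _).le)]
        refine ENNReal.ofReal_le_ofReal ?_
        simp only [hB, runMax, ← add_assoc]
        rw [(adapted_runMax hW r).setRound le_rfl]
        refine (bellman_le hMp (hpos _ _)).trans (le_of_eq ?_)
        ring
      have h2 : Measurable fun q => ENNReal.ofReal (W (τ + r + 1) (setRound (τ + r) (ω, q))) :=
        ((hm _).comp ((measurable_setRound _).comp (by fun_prop))).ennreal_ofReal
      refine (lintegral_mono h1).trans ?_
      rw [lintegral_add_left measurable_const, lintegral_const_mul _ h2, lintegral_const,
        measure_univ, mul_one]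
      have e : B r ω = M ^ (2 / 3 : ℝ) + 2 * M ^ (-(1 / 3) : ℝ) * W (τ + r) ω := by
        simp only [hB]
        ring
      rw [e, ENNReal.ofReal_add (by positivity) (mul_nonneg (by positivity) (hpos _ _).le),
        ENNReal.ofReal_mul (p := 2 * M ^ (-(1 / 3) : ℝ)) (by positivity)]
      gcongr
      exact hstep r (by omega) ω
  refine le_trans (lintegral_mono fun ω => ENNReal.ofReal_le_ofReal ?_) (main R le_rfl)
  have h1 := hpos (τ + R) ω
  have h2 := hMpos R ω
  simp only [hB]
  have : 0 ≤ 2 * W (τ + R) ω * runMax W τ R ω ^ (-(1 / 3) : ℝ) := by positivity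
  linarith

/-! ### Regimes -/

lemma regimeEnd_succ (p i : ℕ) : regimeEnd p (i + 1) = regimeEnd p i + 2 ^ (p + (i + 1)) := by
  simp only [regimeEnd, Finset.sum_Icc_succ_top (Nat.le_add_left 1 i)]

lemma regimeEnd_mono (p : ℕ) : Monotone (regimeEnd p) :=
  monotone_nat_of_le_succ fun i => (regimeEnd_lt p (Nat.lt_succ_self i)).le

/-- Regimes are numbered from 1; from here on the index `i` stands for regime `i + 1`, which
occupies the rounds from `regimeEnd p i` to `regimeEnd p (i + 1) - 1`. -/
lemma regime_eq {p i s : ℕ} (h1 : regimeEnd p i ≤ s) (h2 : s < regimeEnd p (i + 1)) :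
    regime p s = i + 1 := by
  rw [regime, Nat.find_eq_iff]
  exact ⟨h2, fun n hn => not_lt.2 ((regimeEnd_mono p (Nat.lt_succ_iff.1 hn)).trans h1)⟩

lemma regimeStart_eq {p i s : ℕ} (h1 : regimeEnd p i ≤ s) (h2 : s < regimeEnd p (i + 1)) :
    regimeStart p s = regimeEnd p i := by
  rw [regimeStart, regime_eq h1 h2, Nat.add_sub_cancel]

/-- The sum over the rounds of a regime, as a sum over natural numbers. -/
lemma sum_regimeRounds {M : Type*} [AddCommMonoid M] (p : ℕ) {s j : ℕ} (hs : regimeEnd p (j + 1) ≤ s)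
    (g : ℕ → M) : ∑ r ∈ regimeRounds p s (j + 1), g r
      = ∑ r ∈ Finset.Ico (regimeEnd p j) (regimeEnd p (j + 1)), g r := by
  refine Finset.sum_bij (fun r _ => (r : ℕ)) (fun r hr => ?_) (fun r _ r' _ h => Fin.ext h)
    (fun r hr => ?_) fun r _ => rfl
  · simpa [regimeRounds] using hr
  · rw [Finset.mem_Ico] at hr
    exact ⟨⟨r, hr.2.trans_le hs⟩, by simpa [regimeRounds] using hr, rfl⟩

lemma card_regimeRounds (p : ℕ) {s j : ℕ} (hs : regimeEnd p (j + 1) ≤ s) :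
    (regimeRounds p s (j + 1)).card = 2 ^ (p + (j + 1)) := by
  rw [Finset.card_eq_sum_ones, sum_regimeRounds p hs fun _ => 1, Finset.sum_const, Nat.card_Ico,
    regimeEnd_succ]
  simp

/-! ### The discrete arms -/

/-- The mean payoff of the discrete arm `a` of regime `i + 1`. -/
def armMean (E : Environment) (p i : ℕ) (ω : ℕ → Obs) (a : ℕ) : ℝ :=
  if a < numCells p (i + 1) then ∫ x, E.f x ∂(volume[|cell (numCells p (i + 1)) a])
  else if a < numArms p (i + 1) then
    (2 ^ (p + (a - numCells p (i + 1) + 1)) : ℝ)⁻¹ *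
      ∑ r ∈ Finset.Ico (regimeEnd p (a - numCells p (i + 1)))
        (regimeEnd p (a - numCells p (i + 1) + 1)), E.f (ω r).2.1
  else E.f 0

lemma integral_armLaw (E : Environment) {p i s : ℕ} (h1 : regimeEnd p i ≤ s)
    (h2 : s < regimeEnd p (i + 1)) (ω : ℕ → Obs) (a : ℕ) :
    ∫ x, E.f x ∂(armLaw p (initial s ω) a) = armMean E p i ω a := by
  rw [armLaw, armMean, regime_eq h1 h2]
  split_ifs with h3 h4
  · rfl
  · have h5 : a - numCells p (i + 1) + 1 ≤ i := by
      simp only [numArms] at h4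
      omega
    have h6 : regimeEnd p (a - numCells p (i + 1) + 1) ≤ s := (regimeEnd_mono p h5).trans h1
    rw [empirical, integral_smul_measure, integral_finsetSum_measure fun r _ =>
      integrable_dirac (by simp), card_regimeRounds p h6, ← sum_regimeRounds p h6]
    simp
  · simp

lemma armMean_mem (E : Environment) (p i : ℕ) (ω : ℕ → Obs) (a : ℕ) :
    armMean E p i ω a ∈ Set.Icc (0 : ℝ) 1 := by
  rw [← integral_armLaw E le_rfl (regimeEnd_lt p (Nat.lt_succ_self i))]
  have := isProbabilityMeasure_armLaw p (initial (regimeEnd p i) ω) a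
  refine ⟨integral_nonneg fun x => (E.f_mem x).1, ?_⟩
  have hi : Integrable E.f (armLaw p (initial (regimeEnd p i) ω) a) := by
    refine Integrable.of_bound (C := 1) E.measurable_f.aestronglyMeasurable (ae_of_all _ fun x => ?_)
    rw [Real.norm_of_nonneg (E.f_mem x).1]
    exact (E.f_mem x).2
  simpa using integral_mono hi (integrable_const 1) fun x => (E.f_mem x).2

lemma measurable_armMean (E : Environment) (p i a : ℕ) :
    Measurable fun ω => armMean E p i ω a := by
  have := E.measurable_f
  unfold armMean
  split_ifs <;> fun_prop

/-- The means of the memory arms are random but frozen when the regime starts. This is what makes a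
MOSS analysis with fixed means possible inside a regime. -/
lemma adapted_armMean (E : Environment) (p i a : ℕ) :
    Adapted (regimeEnd p i) fun ω => armMean E p i ω a := by
  intro ω ω' h
  simp only [armMean]
  split_ifs with h1 h2
  · rfl
  · congr 1
    refine Finset.sum_congr rfl fun r hr => ?_
    rw [Finset.mem_Ico] at hr
    have h5 : a - numCells p (i + 1) + 1 ≤ i := by
      simp only [numArms] at h2
      omega
    rw [h r (hr.2.trans_le (regimeEnd_mono p h5))]
  · rfl

/-- The reward of an arm drawn from a probability measure is subgaussian. -/
lemma lintegral_exp_reward_le (E : Environment) (ν : Measure I) [IsProbabilityMeasure ν] (u : ℝ) :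
    ∫⁻ x, ∫⁻ y, ENNReal.ofReal (Real.exp (u * (y - ∫ x, E.f x ∂ν))) ∂(E.reward x) ∂ν
      ≤ ENNReal.ofReal (Real.exp (u ^ 2 / 4)) := by
  set μ := ∫ x, E.f x ∂ν
  -- The noise has two sources: the reward given `x`, with variance factor 1/4, and the payoff `E.f
  -- x` of the drawn arm, with factor 1/4 by Hoeffding's lemma. Each contributes u²/8 to the
  -- exponent.
  have h1 (x : I) : ∫⁻ y, ENNReal.ofReal (Real.exp (u * (y - μ))) ∂(E.reward x)
      ≤ ENNReal.ofReal (Real.exp (u * (E.f x - μ))) * ENNReal.ofReal (Real.exp (u ^ 2 / 8)) := by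
    have e (y : ℝ) : ENNReal.ofReal (Real.exp (u * (y - μ)))
        = ENNReal.ofReal (Real.exp (u * (E.f x - μ)))
          * ENNReal.ofReal (Real.exp (u * (y - E.f x))) := by
      rw [← ENNReal.ofReal_mul (Real.exp_nonneg _), ← Real.exp_add]
      ring_nf
    rw [lintegral_congr e, lintegral_const_mul _ (by fun_prop),
      ← ofReal_integral_eq_lintegral_ofReal ((E.subgaussian x).integrable_exp_mul u)
        (ae_of_all _ fun _ => Real.exp_nonneg _)]
    gcongr
    refine ((E.subgaussian x).mgf_le u).trans (le_of_eq ?_)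
    have : (((1 / 4 : NNReal)) : ℝ) = 1 / 4 := by norm_num
    rw [this]
    ring_nf
  refine (lintegral_mono h1).trans ?_
  have hf := E.measurable_f
  have hsub := hasSubgaussianMGF_of_mem_Icc (μ := ν) (X := E.f) hf.aemeasurable
    (ae_of_all _ E.f_mem)
  rw [lintegral_mul_const _ (by fun_prop),
    ← ofReal_integral_eq_lintegral_ofReal (hsub.integrable_exp_mul u)
        (ae_of_all _ fun _ => Real.exp_nonneg _), ← ENNReal.ofReal_mul' (Real.exp_nonneg _)]
  refine ENNReal.ofReal_le_ofReal ?_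
  refine (mul_le_mul_of_nonneg_right (hsub.mgf_le u) (Real.exp_nonneg _)).trans (le_of_eq ?_)
  have : (((‖(1 : ℝ) - 0‖₊ / 2) ^ 2 : NNReal) : ℝ) = 1 / 4 := by norm_num
  rw [← Real.exp_add, this]
  ring_nf

/-! ### One round of MeDZO -/

/-- The discrete arm chosen in round `s`. -/
def chosen (tie : Finset ℕ → ℕ) (p s : ℕ) (ω : ℕ → Obs) : ℕ := chosenArm tie p (initial s ω)

lemma measurable_chosen (tie : Finset ℕ → ℕ) (p s : ℕ) : Measurable (chosen tie p s) :=
  (measurable_chosenArm tie p s).comp (measurable_initial s)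

lemma adapted_chosen (tie : Finset ℕ → ℕ) (p s : ℕ) : Adapted s (chosen tie p s) := by
  intro ω ω' h
  rw [chosen, chosen, adapted_initial s ω ω' h]

lemma lintegral_stepKernel_MeDZO (tie : Finset ℕ → ℕ) (B : ℝ) (E : Environment) (s : ℕ)
    (ω : ℕ → Obs) {F : (ℕ × I) × ℝ → ℝ≥0∞} (hF : Measurable F) :
    ∫⁻ q, F q ∂(stepKernel (MeDZO tie B) E s ω)
      = ∫⁻ x, ∫⁻ y, F ((chosen tie ⌈Real.logb 2 B⌉₊ s ω, x), y) ∂(E.reward x)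
        ∂(armLaw ⌈Real.logb 2 B⌉₊ (initial s ω) (chosen tie ⌈Real.logb 2 B⌉₊ s ω)) := by
  rw [lintegral_stepKernel _ _ _ _ hF]
  set p := ⌈Real.logb 2 B⌉₊ with hp
  set κ : Kernel ((Fin s → Obs) × ℕ) I :=
    ⟨fun q : (Fin s → Obs) × ℕ => armLaw p q.1 q.2, measurable_armLaw p s⟩ with hκ
  have : IsMarkovKernel κ := ⟨fun q => isProbabilityMeasure_armLaw p q.1 q.2⟩
  have hG : Measurable fun q : ℕ × I => ∫⁻ y, F (q, y) ∂(E.reward q.2) :=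
    Measurable.lintegral_kernel_prod_right
      (κ := E.reward.comap (fun q : ℕ × I => q.2) (by fun_prop)) hF
  have e : (MeDZO tie B).kernel s
      = Kernel.deterministic (fun h : Fin s → Obs => chosenArm tie p h)
        (measurable_chosenArm tie _ s) ⊗ₖ κ := rfl
  have hκa (z : (Fin s → Obs) × ℕ) : κ z = armLaw p z.1 z.2 := rfl
  rw [e, Kernel.lintegral_compProd _ _ _ hG, Kernel.lintegral_deterministic']
  · rfl
  · exact Measurable.lintegral_kernel_prod_right
      (κ := κ.comap (fun a : ℕ => (initial s ω, a)) (by fun_prop))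
      (f := fun a x => ∫⁻ y, F ((a, x), y) ∂(E.reward x)) hG

lemma meanPayoff_MeDZO (tie : Finset ℕ → ℕ) {B : ℝ} {p : ℕ} (hp : ⌈Real.logb 2 B⌉₊ = p)
    (E : Environment) {i s : ℕ} (h1 : regimeEnd p i ≤ s) (h2 : s < regimeEnd p (i + 1)) :
    meanPayoff (MeDZO tie B) E s
      = ∫ ω, armMean E p i ω (chosen tie p s ω) ∂(trajLaw (MeDZO tie B) E s) := by
  subst hp
  set p := ⌈Real.logb 2 B⌉₊
  have hf := E.measurable_f
  have hm : Measurable fun ω : ℕ → Obs => E.f (ω s).2.1 := hf.comp (by fun_prop)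
  rw [meanPayoff, integral_trajLaw_succ _ _ _ hm (integrable_payoff _ _ _ _)]
  refine integral_congr_ae (ae_of_all _ fun ω => ?_)
  simp only [setRound_self, toObs]
  rw [integral_eq_lintegral_of_nonneg_ae (ae_of_all _ fun q => (E.f_mem _).1)
      (hf.comp (by fun_prop)).aestronglyMeasurable,
    lintegral_stepKernel_MeDZO tie B E s ω (by fun_prop), ← integral_armLaw E h1 h2,
    integral_eq_lintegral_of_nonneg_ae (ae_of_all _ fun q => (E.f_mem _).1)
      hf.aestronglyMeasurable]
  simp [p]

/-- The statistics of MOSS are read from the recorded labels, whereas payoffs are expressed through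
`chosen`; the two agree almost surely. -/
lemma ae_label_eq_chosen (tie : Finset ℕ → ℕ) {B : ℝ} {p : ℕ} (hp : ⌈Real.logb 2 B⌉₊ = p)
    (E : Environment) (T : ℕ) :
    ∀ᵐ ω ∂(trajLaw (MeDZO tie B) E T), ∀ s < T, (ω s).1 = chosen tie p s ω := by
  subst hp
  set p := ⌈Real.logb 2 B⌉₊ with hp
  refine ae_all_iff.2 fun s => ?_
  by_cases hs : s < T
  swap
  · exact ae_of_all _ fun ω h => absurd h hs
  have hm : MeasurableSet {ω : ℕ → Obs | (ω s).1 ≠ chosen tie p s ω} :=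
    (measurableSet_eq_fun (by fun_prop) (measurable_chosen tie p s)).compl
  set G : (ℕ → Obs) → ℝ≥0∞ := Set.indicator {ω | (ω s).1 ≠ chosen tie p s ω} 1 with hG
  have hGm : Measurable G := measurable_one.indicator hm
  have h0 : ∫⁻ ω, G ω ∂(trajLaw (MeDZO tie B) E T) = 0 := by
    have had : Adapted (s + 1) G := by
      intro ω ω' h
      simp only [hG, Set.indicator_apply, Set.mem_ofPred_eq, h s (Nat.lt_succ_self s),
        adapted_chosen tie p s ω ω' fun r hr => h r (hr.trans (Nat.lt_succ_self s)), Pi.one_apply]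
    rw [had.lintegral_eq hGm _ _ (Nat.succ_le_of_lt hs), lintegral_trajLaw_succ _ _ _ hGm]
    refine (lintegral_congr fun ω => ?_).trans lintegral_zero
    have hGω : Measurable fun q => G (setRound s (ω, q)) :=
      hGm.comp ((measurable_setRound s).comp (by fun_prop))
    rw [lintegral_stepKernel_MeDZO tie B E s ω hGω]
    refine (lintegral_congr fun x => ?_).trans lintegral_zero
    refine (lintegral_congr fun y => ?_).trans lintegral_zero
    rw [hG, Set.indicator_of_notMem]
    simp only [Set.mem_ofPred_eq, setRound_self, toObs, (adapted_chosen tie p s).setRound le_rfl,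
      not_not]
    rfl
  rw [hG, lintegral_indicator_one hm] at h0
  rw [ae_iff]
  simpa [hs] using h0

/-! ### Statistics of the rounds of a block -/

/-- The number of rounds in `[τ, s)` with label `a`. -/
def count (τ s a : ℕ) (ω : ℕ → Obs) : ℕ := ∑ r ∈ Finset.Ico τ s, if (ω r).1 = a then 1 else 0

/-- The sum of the centred rewards over the rounds in `[τ, s)` with label `a`. -/
def deviation (μ : (ℕ → Obs) → ℕ → ℝ) (τ s a : ℕ) (ω : ℕ → Obs) : ℝ :=
  ∑ r ∈ Finset.Ico τ s, if (ω r).1 = a then (ω r).2.2 - μ ω a else 0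

lemma measurable_label_indicator {β : Type*} [MeasurableSpace β] (r a : ℕ) {g h : (ℕ → Obs) → β}
    (hg : Measurable g) (hh : Measurable h) :
    Measurable fun ω : ℕ → Obs => if (ω r).1 = a then g ω else h ω := by
  refine Measurable.ite ?_ hg hh
  exact (measurable_fst.comp (measurable_pi_apply r)) (measurableSet_singleton a)

lemma measurable_count (τ s a : ℕ) : Measurable (count τ s a) :=
  Finset.measurable_sum _ fun r _ => measurable_label_indicator r a measurable_const measurable_const

lemma measurable_deviation {μ : (ℕ → Obs) → ℕ → ℝ} (hμ : ∀ a, Measurable fun ω => μ ω a)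
    (τ s a : ℕ) : Measurable (deviation μ τ s a) :=
  Finset.measurable_sum _ fun r _ => measurable_label_indicator r a
    (by have := hμ a; fun_prop) measurable_const

lemma adapted_count (τ s a : ℕ) : Adapted s (count τ s a) := by
  intro ω ω' h
  refine Finset.sum_congr rfl fun r hr => ?_
  rw [h r (Finset.mem_Ico.1 hr).2]

lemma adapted_deviation {μ : (ℕ → Obs) → ℕ → ℝ} {τ : ℕ} (hμ : ∀ a, Adapted τ fun ω => μ ω a)
    {s : ℕ} (hs : τ ≤ s) (a : ℕ) : Adapted s (deviation μ τ s a) := by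
  intro ω ω' h
  refine Finset.sum_congr rfl fun r hr => ?_
  have h1 : μ ω a = μ ω' a := hμ a ω ω' fun r hr => h r (hr.trans_le hs)
  rw [h r (Finset.mem_Ico.1 hr).2, h1]

lemma count_succ {τ s : ℕ} (hs : τ ≤ s) (a : ℕ) (ω : ℕ → Obs) :
    count τ (s + 1) a ω = count τ s a ω + if (ω s).1 = a then 1 else 0 :=
  Finset.sum_Ico_succ_top hs _

lemma deviation_succ (μ : (ℕ → Obs) → ℕ → ℝ) {τ s : ℕ} (hs : τ ≤ s) (a : ℕ) (ω : ℕ → Obs) :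
    deviation μ τ (s + 1) a ω
      = deviation μ τ s a ω + if (ω s).1 = a then (ω s).2.2 - μ ω a else 0 :=
  Finset.sum_Ico_succ_top hs _

lemma pulls_regimeHistory {p i s : ℕ} (h1 : regimeEnd p i ≤ s) (h2 : s < regimeEnd p (i + 1))
    (ω : ℕ → Obs) (a : ℕ) :
    pulls (regimeHistory p (initial s ω)) a = count (regimeEnd p i) s a ω := by
  rw [pulls, Finset.card_filter, count, Finset.sum_Ico_eq_sum_range, Finset.sum_range,
    ← regimeStart_eq h1 h2]
  rfl

lemma totalReward_regimeHistory {p i s : ℕ} (h1 : regimeEnd p i ≤ s)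
    (h2 : s < regimeEnd p (i + 1)) (μ : (ℕ → Obs) → ℕ → ℝ) (ω : ℕ → Obs) (a : ℕ) :
    totalReward (regimeHistory p (initial s ω)) a
      = deviation μ (regimeEnd p i) s a ω + count (regimeEnd p i) s a ω * μ ω a := by
  have e : deviation μ (regimeEnd p i) s a ω + count (regimeEnd p i) s a ω * μ ω a
      = ∑ r ∈ Finset.Ico (regimeEnd p i) s, if (ω r).1 = a then (ω r).2.2 else 0 := by
    rw [deviation, count, Nat.cast_sum, Finset.sum_mul, ← Finset.sum_add_distrib]
    refine Finset.sum_congr rfl fun r _ => ?_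
    split_ifs <;> simp
  rw [e, totalReward, Finset.sum_filter, Finset.sum_Ico_eq_sum_range, Finset.sum_range,
    ← regimeStart_eq h1 h2]
  rfl

/-! ### Exponential supermartingales -/

/-- A nonnegative combination of exponentials of the centred rewards; the index `(a, v)` stands for
the arm `a` and the parameter `v`. -/
def expWeight (μ : (ℕ → Obs) → ℕ → ℝ) (τ : ℕ) (F : Finset (ℕ × ℝ)) (c : ℕ × ℝ → ℝ) (s : ℕ)
    (ω : ℕ → Obs) : ℝ :=
  ∑ k ∈ F, c k * Real.exp (k.2 * deviation μ τ s k.1 ω - count τ s k.1 ω * (k.2 ^ 2 / 4))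

lemma measurable_expWeight {μ : (ℕ → Obs) → ℕ → ℝ} (hμ : ∀ a, Measurable fun ω => μ ω a) (τ : ℕ)
    (F : Finset (ℕ × ℝ)) (c : ℕ × ℝ → ℝ) (s : ℕ) : Measurable (expWeight μ τ F c s) := by
  refine Finset.measurable_sum _ fun k _ => ?_
  have h1 := measurable_deviation hμ τ s k.1
  have h2 : Measurable fun ω => (count τ s k.1 ω : ℝ) :=
    (measurable_from_top (f := fun n : ℕ => (n : ℝ))).comp (measurable_count τ s k.1)
  fun_prop

lemma adapted_expWeight {μ : (ℕ → Obs) → ℕ → ℝ} {τ : ℕ} (hμ : ∀ a, Adapted τ fun ω => μ ω a)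
    (F : Finset (ℕ × ℝ)) (c : ℕ × ℝ → ℝ) {s : ℕ} (hs : τ ≤ s) :
    Adapted s (expWeight μ τ F c s) := by
  intro ω ω' h
  refine Finset.sum_congr rfl fun k _ => ?_
  rw [adapted_deviation hμ hs k.1 ω ω' h, adapted_count τ s k.1 ω ω' h]

lemma expWeight_init (μ : (ℕ → Obs) → ℕ → ℝ) (τ : ℕ) (F : Finset (ℕ × ℝ)) (c : ℕ × ℝ → ℝ)
    (ω : ℕ → Obs) : expWeight μ τ F c τ ω = ∑ k ∈ F, c k := by
  simp [expWeight, deviation, count]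

/-- In one round, each exponential is unchanged if its arm is not chosen. Otherwise it is multiplied
by exp (v (Y - μ) - v²/4), whose conditional mean is at most 1 by `lintegral_exp_reward_le`, since μ
is exactly the mean of the law from which the arm is drawn. Nonnegative weights preserve this. -/
lemma expWeight_step (tie : Finset ℕ → ℕ) {B : ℝ} {p : ℕ} (hp : ⌈Real.logb 2 B⌉₊ = p)
    (E : Environment) {i s : ℕ} (h1 : regimeEnd p i ≤ s) (h2 : s < regimeEnd p (i + 1))
    (F : Finset (ℕ × ℝ)) {c : ℕ × ℝ → ℝ} (hc : ∀ k, 0 ≤ c k) (ω : ℕ → Obs) :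
    ∫⁻ q, ENNReal.ofReal (expWeight (armMean E p i) (regimeEnd p i) F c (s + 1)
        (setRound s (ω, q))) ∂(stepKernel (MeDZO tie B) E s ω)
      ≤ ENNReal.ofReal (expWeight (armMean E p i) (regimeEnd p i) F c s ω) := by
  subst hp
  set p := ⌈Real.logb 2 B⌉₊ with hp
  set τ := regimeEnd p i
  set μ := armMean E p i with hμ
  set I₀ := chosen tie p s ω with hI₀
  have hadμ (a : ℕ) : Adapted τ fun ω => μ ω a := adapted_armMean E p i a
  set old : ℕ × ℝ → ℝ := fun k =>
    c k * Real.exp (k.2 * deviation μ τ s k.1 ω - count τ s k.1 ω * (k.2 ^ 2 / 4)) with hold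
  have hold0 (k : ℕ × ℝ) : 0 ≤ old k := mul_nonneg (hc k) (Real.exp_nonneg _)
  set fac : ℕ × ℝ → (ℕ × I) × ℝ → ℝ := fun k q =>
    if q.1.1 = k.1 then Real.exp (k.2 * (q.2 - μ ω k.1) - k.2 ^ 2 / 4) else 1 with hfac
  have hfac0 (k : ℕ × ℝ) (q : (ℕ × I) × ℝ) : 0 ≤ fac k q := by
    simp only [hfac]
    split_ifs <;> positivity
  have hfacm (k : ℕ × ℝ) : Measurable (fac k) := by
    refine Measurable.ite ?_ (by fun_prop) measurable_const
    exact (measurable_fst.comp measurable_fst) (measurableSet_singleton k.1)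
  have e (q : (ℕ × I) × ℝ) : ENNReal.ofReal (expWeight μ τ F c (s + 1) (setRound s (ω, q)))
      = ∑ k ∈ F, ENNReal.ofReal (old k) * ENNReal.ofReal (fac k q) := by
    rw [expWeight, ENNReal.ofReal_sum_of_nonneg fun k _ => mul_nonneg (hc k) (Real.exp_nonneg _)]
    refine Finset.sum_congr rfl fun k _ => ?_
    rw [← ENNReal.ofReal_mul (hold0 k), deviation_succ μ h1, count_succ h1,
      (adapted_deviation hadμ h1 k.1).setRound le_rfl, (adapted_count τ s k.1).setRound le_rfl,
      (hadμ k.1).setRound h1, setRound_self]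
    congr 1
    simp only [hold, hfac, toObs, mul_assoc]
    congr 1
    by_cases hq : q.1.1 = k.1
    · simp only [hq, if_true]
      rw [← Real.exp_add]
      congr 1
      push_cast
      ring
    · simp [hq]
  simp only [e]
  rw [lintegral_finsetSum _ fun k _ => ((hfacm k).ennreal_ofReal.const_mul _), expWeight,
    ENNReal.ofReal_sum_of_nonneg fun k _ => hold0 k]
  refine Finset.sum_le_sum fun k _ => ?_
  rw [lintegral_const_mul _ (hfacm k).ennreal_ofReal]
  refine mul_le_of_le_one_right' ?_
  rw [lintegral_stepKernel_MeDZO tie B E s ω (hfacm k).ennreal_ofReal]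
  change ∫⁻ x, ∫⁻ y, ENNReal.ofReal (fac k ((I₀, x), y)) ∂(E.reward x)
    ∂(armLaw p (initial s ω) I₀) ≤ 1
  have := isProbabilityMeasure_armLaw p (initial s ω) I₀
  by_cases hk : I₀ = k.1
  · have hmean : μ ω k.1 = ∫ x, E.f x ∂(armLaw p (initial s ω) I₀) := by
      rw [integral_armLaw E h1 h2, hk]
    have e2 (x : I) (y : ℝ) : ENNReal.ofReal (fac k ((I₀, x), y))
        = ENNReal.ofReal (Real.exp (-(k.2 ^ 2 / 4))) * ENNReal.ofReal
          (Real.exp (k.2 * (y - ∫ x, E.f x ∂(armLaw p (initial s ω) I₀)))) := by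
      simp only [hfac, hk, if_true]
      rw [← ENNReal.ofReal_mul (Real.exp_nonneg _), ← Real.exp_add, hmean, hk]
      congr 2
      ring
    simp only [e2]
    have h3 := lintegral_exp_reward_le E (armLaw p (initial s ω) I₀) k.2
    calc _ = ENNReal.ofReal (Real.exp (-(k.2 ^ 2 / 4))) * ∫⁻ x, ∫⁻ y, ENNReal.ofReal
          (Real.exp (k.2 * (y - ∫ x, E.f x ∂(armLaw p (initial s ω) I₀)))) ∂(E.reward x)
            ∂(armLaw p (initial s ω) I₀) := by
          rw [← lintegral_const_mul' _ _ ENNReal.ofReal_ne_top]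
          refine lintegral_congr fun x => ?_
          rw [lintegral_const_mul' _ _ ENNReal.ofReal_ne_top]
      _ ≤ ENNReal.ofReal (Real.exp (-(k.2 ^ 2 / 4))) * ENNReal.ofReal (Real.exp (k.2 ^ 2 / 4)) := by
          gcongr
      _ = 1 := by
          rw [← ENNReal.ofReal_mul (Real.exp_nonneg _), ← Real.exp_add, neg_add_cancel,
            Real.exp_zero, ENNReal.ofReal_one]
  · simp [hfac, hk]

/-! ### Analysis of MOSS -/

lemma mossArm_mem {tie : Finset ℕ → ℕ} (htie : ∀ S : Finset ℕ, S.Nonempty → tie S ∈ S) (n : ℕ)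
    {K : ℕ} (hK : 0 < K) {r : ℕ} (g : Fin r → ℕ × ℝ) :
    mossArm tie n K g < K ∧ ∀ b < K, mossIndex n K g b ≤ mossIndex n K g (mossArm tie n K g) := by
  have hne : (mossArgmax n K g).Nonempty := by
    obtain ⟨a, ha, hmax⟩ := Finset.exists_max_image (Finset.range K) (mossIndex n K g)
      (Finset.nonempty_range_iff.2 hK.ne')
    exact ⟨a, Finset.mem_filter.2 ⟨ha, hmax⟩⟩
  have h := Finset.mem_filter.1 (htie _ hne)
  exact ⟨Finset.mem_range.1 h.1, fun b hb => h.2 b (Finset.mem_range.2 hb)⟩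

/-- The size `√(log₊ (n / (K N)) / N)` of the confidence interval of MOSS. -/
def mossBonus (n K N : ℕ) : ℝ := √(max (Real.log (n / (K * N))) 0 / N)

lemma mossBonus_sq (n K : ℕ) (N : ℕ) :
    mossBonus n K N ^ 2 = max (Real.log (n / (K * N))) 0 / N :=
  Real.sq_sqrt (by positivity)

lemma mossBonus_nonneg (n K N : ℕ) : 0 ≤ mossBonus n K N := Real.sqrt_nonneg _

lemma max_log_le {n K N : ℕ} (hn : 0 < n) (hK : 0 < K) (hN : 0 < N) :
    max (Real.log (n / (K * N))) 0 ≤ Real.log n := by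
  have hn' : (1 : ℝ) ≤ n := by exact_mod_cast hn
  have hK' : (1 : ℝ) ≤ K := by exact_mod_cast hK
  have hN' : (1 : ℝ) ≤ N := by exact_mod_cast hN
  refine max_le (Real.log_le_log (by positivity) (div_le_self (by linarith) ?_))
    (Real.log_nonneg hn')
  nlinarith

lemma mossBonus_le {n K N : ℕ} (hn : 0 < n) (hK : 0 < K) (hN : 0 < N) :
    mossBonus n K N ≤ √n := by
  have hn' : (1 : ℝ) ≤ n := by exact_mod_cast hn
  have hN' : (1 : ℝ) ≤ N := by exact_mod_cast hN
  refine Real.sqrt_le_sqrt ((div_le_self (le_max_right _ _) hN').trans ?_)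
  exact (max_log_le hn hK hN).trans ((Real.log_le_sub_one_of_pos (by linarith)).trans (by linarith))

/-- The parameters of the exponential supermartingales which control the index of the best arm. -/
def gridParam (n j : ℕ) : ℝ := 2 * (2 ^ j / √n)

/-- If the exponential supermartingales are small, the index of an arm is not much below its
mean. -/
lemma underestimation_le {e K N : ℕ} (hK : 0 < K) (hN : 0 < N) {x S w : ℝ} (hx0 : 0 < x)
    (hx1 : x ≤ 1) (hw : 1 ≤ w) (hS : S ≤ -(N * (x + mossBonus (2 ^ e) K N)))
    (hexp : ∀ j < e + 2, Real.exp (-gridParam (2 ^ e) j * S - N * ((-gridParam (2 ^ e) j) ^ 2 / 4))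
      ≤ (e + 2 : ℕ) * w) :
    x ≤ √(K / (2 ^ e : ℕ)) * ((e + 2 : ℕ) * w ^ (2 / 3 : ℝ)) := by
  set n : ℕ := 2 ^ e with hn
  have hn0 : 0 < n := by positivity
  have hn1 : (1 : ℝ) ≤ n := by exact_mod_cast hn0
  have hK1 : (1 : ℝ) ≤ K := by exact_mod_cast hK
  have hN1 : (1 : ℝ) ≤ N := by exact_mod_cast hN
  set β := mossBonus n K N with hβ
  have hβ0 : 0 ≤ β := mossBonus_nonneg _ _ _
  set D := x + β with hD
  have hD0 : 0 < D := by linarith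
  have hs0 : 0 < √(n : ℝ) := Real.sqrt_pos.2 (by linarith)
  have hs1 : 1 ≤ √(n : ℝ) := Real.one_le_sqrt.2 hn1
  have hss : √(n : ℝ) * √(n : ℝ) = n := Real.mul_self_sqrt (by linarith)
  set J : ℝ := ((e + 2 : ℕ) : ℝ) with hJ
  have hJ1 : 1 ≤ J := by
    rw [hJ]
    push_cast
    have : (0 : ℝ) ≤ e := Nat.cast_nonneg e
    linarith
  have hwp : 1 ≤ w ^ (2 / 3 : ℝ) := Real.one_le_rpow hw (by norm_num)
  -- Below 1/√n the deviation is already smaller than the bound √(K/n), so no exponential is needed.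
  rcases lt_or_ge (D * √n) 1 with hsmall | hlarge
  · have h1 : x ≤ 1 / √n := by
      rw [le_div_iff₀ hs0]
      nlinarith
    have h2 : 1 / √(n : ℝ) ≤ √(K / n) := by
      rw [Real.sqrt_div (by linarith)]
      gcongr
      exact Real.one_le_sqrt.2 hK1
    calc x ≤ √(K / n) * 1 := by linarith
      _ ≤ _ := by
        gcongr
        nlinarith
  -- The dyadic grid supplies v = 2^j/√n with D/2 ≤ v ≤ D, in place of the optimal parameter D,
  -- which depends on the number of pulls. As D ≤ 2√n, the index is at most e + 1.
  set j := Nat.log 2 ⌊D * √n⌋₊ with hj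
  have hfl : ⌊D * √n⌋₊ ≠ 0 := (Nat.floor_pos.2 hlarge).ne'
  have hj1 : (2 : ℝ) ^ j ≤ D * √n := by
    refine le_trans ?_ (Nat.floor_le (by positivity))
    exact_mod_cast Nat.pow_log_le_self 2 hfl
  have hj2 : D * √n < 2 ^ (j + 1) := by
    have h1 : ⌊D * √n⌋₊ + 1 ≤ 2 ^ (j + 1) := Nat.lt_pow_succ_log_self (by norm_num) _
    refine (Nat.lt_floor_add_one _).trans_le ?_
    exact_mod_cast h1
  have hjJ : j < e + 2 := by
    have h1 : (2 : ℝ) ^ j ≤ 2 ^ (e + 1) := by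
      refine hj1.trans ?_
      have h2 : β ≤ √n := mossBonus_le hn0 hK hN
      have h3 : D * √n ≤ 2 * n := by
        have h4 : D ≤ 2 * √n := by linarith
        calc D * √n ≤ 2 * √n * √n := by gcongr
          _ = 2 * n := by rw [mul_assoc, hss]
      refine h3.trans (le_of_eq ?_)
      rw [hn, pow_succ]
      push_cast
      ring
    have h2 : j ≤ e + 1 := (pow_le_pow_iff_right₀ (by norm_num : (1 : ℝ) < 2)).1 h1
    omega
  set v := 2 ^ j / √(n : ℝ) with hv
  have hv1 : v ≤ D := by rwa [hv, div_le_iff₀ hs0]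
  have hv2 : D / 2 ≤ v := by
    rw [hv, le_div_iff₀ hs0]
    rw [pow_succ] at hj2
    linarith
  have hv0 : 0 < v := by positivity
  have hgrid : gridParam n j = 2 * v := rfl
  set ℓ := max (Real.log (n / (K * N))) 0 with hℓ
  have hβsq : N * β ^ 2 = ℓ := by
    rw [hβ, mossBonus_sq, mul_div_cancel₀ _ (by linarith)]
  -- On [D/2, D], 2 v D - v² ≥ (3/4) D²; this factor 3/4 is the price of the grid. The cross term of
  -- D² = (x + β)² is dropped, and N β² = ℓ by definition of the bonus.
  have hexpo : 3 / 4 * (N * x ^ 2 + ℓ) ≤ -gridParam n j * S - N * ((-gridParam n j) ^ 2 / 4) := by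
    rw [hgrid]
    have h1 : N * (2 * v * D) ≤ -(2 * v) * S := by
      have := mul_le_mul_of_nonneg_left hS (by positivity : 0 ≤ 2 * v)
      linarith
    have h2 : 3 / 4 * D ^ 2 ≤ 2 * v * D - v ^ 2 := by
      have := mul_nonneg (sub_nonneg.2 hv2) (by linarith : 0 ≤ 3 / 2 * D - v)
      linarith
    have h3 : x ^ 2 + β ^ 2 ≤ D ^ 2 := by
      have := mul_nonneg hx0.le hβ0
      rw [hD]
      linarith
    calc 3 / 4 * (N * x ^ 2 + ℓ) = N * (3 / 4 * (x ^ 2 + β ^ 2)) := by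
          rw [← hβsq]
          ring
      _ ≤ N * (2 * v * D - v ^ 2) := by
          refine mul_le_mul_of_nonneg_left ?_ (by linarith)
          linarith
      _ = N * (2 * v * D) - N * ((-(2 * v)) ^ 2 / 4) := by ring
      _ ≤ _ := by linarith
  -- The bonus cancels the factor 1/N: exp ℓ ≥ n/(K N) while exp (N x²) ≥ N x², so the product no
  -- longer involves N.
  have hX : x ^ 2 * n / K ≤ Real.exp (N * x ^ 2 + ℓ) := by
    have h1 : N * x ^ 2 ≤ Real.exp (N * x ^ 2) := by
      linarith [Real.add_one_le_exp (N * x ^ 2)]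
    have h2 : (n : ℝ) / (K * N) ≤ Real.exp ℓ :=
      (Real.log_le_iff_le_exp (by positivity)).1 (le_max_left _ _)
    calc x ^ 2 * n / K = N * x ^ 2 * (n / (K * N)) := by
          field_simp
      _ ≤ Real.exp (N * x ^ 2) * Real.exp ℓ := by gcongr
      _ = _ := (Real.exp_add _ _).symm
  have hX2 : (x ^ 2 * n / K) ^ (3 / 4 : ℝ) ≤ J * w := by
    refine (Real.rpow_le_rpow (by positivity) hX (by norm_num)).trans ?_
    rw [← Real.exp_mul]
    refine le_trans (Real.exp_le_exp.2 ?_) (hexp j hjJ)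
    linarith
  -- Passing from the power 3/4 to the power 1/2 raises `w` to the power 2/3, hence the moment
  -- required in the maximal inequality.
  have hX3 : √(x ^ 2 * n / K) ≤ J * w ^ (2 / 3 : ℝ) := by
    have h1 := Real.rpow_le_rpow (by positivity) hX2 (by norm_num : (0 : ℝ) ≤ 2 / 3)
    rw [← Real.rpow_mul (by positivity), Real.mul_rpow (by positivity) (by positivity)] at h1
    rw [Real.sqrt_eq_rpow]
    have h2 : J ^ (2 / 3 : ℝ) ≤ J := by
      conv_rhs => rw [← Real.rpow_one J]
      exact Real.rpow_le_rpow_of_exponent_le hJ1 (by norm_num)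
    have h3 : (3 / 4 : ℝ) * (2 / 3) = 1 / 2 := by norm_num
    rw [h3] at h1
    exact h1.trans (by gcongr)
  have hxe : x = √(K / n) * √(x ^ 2 * n / K) := by
    rw [← Real.sqrt_mul (by positivity)]
    have : (K : ℝ) / n * (x ^ 2 * n / K) = x ^ 2 := by
      field_simp
    rw [this, Real.sqrt_sq hx0.le]
  calc x = √(K / n) * √(x ^ 2 * n / K) := hxe
    _ ≤ _ := by gcongr

/-- If the exponential supermartingales are small, the index of an arm is not much above its
mean. -/
lemma overestimation_le {n K N : ℕ} (hn : 0 < n) (hK : 0 < K) (hN : 0 < N) {S w : ℝ} (hw : 1 ≤ w)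
    (hexp : Real.exp (2 / √N * S - N * ((2 / √N) ^ 2 / 4)) ≤ K * n * w) :
    S / N + mossBonus n K N ≤ (2 + 2 * Real.log (K * n) + w ^ (2 / 3 : ℝ)) / √N := by
  have hn1 : (1 : ℝ) ≤ n := by exact_mod_cast hn
  have hK1 : (1 : ℝ) ≤ K := by exact_mod_cast hK
  have hN1 : (1 : ℝ) ≤ N := by exact_mod_cast hN
  have hs0 : 0 < √(N : ℝ) := Real.sqrt_pos.2 (by linarith)
  have hss : √(N : ℝ) * √(N : ℝ) = N := Real.mul_self_sqrt (by linarith)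
  have hKn : (1 : ℝ) ≤ K * n := by nlinarith
  have hL0 : 0 ≤ Real.log (K * n) := Real.log_nonneg hKn
  have hnL : Real.log n ≤ Real.log (K * n) := Real.log_le_log (by linarith) (by nlinarith)
  -- Taking logarithms, with log w ≤ (3/2) w^(2/3), expresses this error too through the moment of
  -- order 2/3. A logarithmic loss is harmless, so the parameter 2/√N is sufficient.
  have h1 : 2 / √N * S - 1 ≤ Real.log (K * n) + 3 / 2 * w ^ (2 / 3 : ℝ) := by
    have e : (N : ℝ) * ((2 / √N) ^ 2 / 4) = 1 := by
      rw [div_pow, pow_two √(N : ℝ), hss]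
      field_simp
      norm_num
    rw [e, ← Real.le_log_iff_exp_le (by positivity), Real.log_mul (by positivity) (by linarith)]
      at hexp
    have h2 := Real.log_le_rpow_div (x := w) (by linarith) (by norm_num : (0 : ℝ) < 2 / 3)
    linarith
  have h3 : mossBonus n K N ≤ (1 + Real.log (K * n)) / √N := by
    rw [mossBonus, Real.sqrt_div (le_max_right _ _)]
    gcongr
    refine (Real.sqrt_le_sqrt ((max_log_le hn hK hN).trans hnL)).trans ?_
    rw [Real.sqrt_le_left (by linarith)]
    nlinarith
  have h4 : S / N = 2 / √N * S / 2 / √N := by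
    have h5 : 2 / √(N : ℝ) * S / 2 / √(N : ℝ) = S / (√(N : ℝ) * √(N : ℝ)) := by field_simp
    rw [h5, hss]
  rw [h4]
  have hwp : 0 ≤ w ^ (2 / 3 : ℝ) := by positivity
  calc 2 / √N * S / 2 / √N + mossBonus n K N
      ≤ 2 / √N * S / 2 / √N + (1 + Real.log (K * n)) / √N := by gcongr
    _ = (2 / √N * S / 2 + (1 + Real.log (K * n))) / √N := by ring
    _ ≤ _ := div_le_div_of_nonneg_right (by linarith) hs0.le

/-! ### Total cost of the pulls in a block -/

/-- The width of the confidence interval after `N` pulls, up to constants. -/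
def pullCost (N : ℕ) : ℝ := if N = 0 then 1 else 1 / √N

/-- The increment √(N+1) - √N is at least 1/(3√N) for N ≥ 1, because √(N+1) ≤ 2√N. The costs of one
arm thus telescope, the first pull, charged 1, included. -/
lemma pullCost_le (N : ℕ) : pullCost N ≤ 4 * √(N + 1 : ℕ) - 4 * √N := by
  unfold pullCost
  split_ifs with h
  · subst h
    norm_num
  · have h1 : (1 : ℝ) ≤ N := by exact_mod_cast Nat.one_le_iff_ne_zero.2 h
    have hs0 : 1 ≤ √(N : ℝ) := Real.one_le_sqrt.2 h1
    have hss : √(N : ℝ) * √(N : ℝ) = N := Real.mul_self_sqrt (by linarith)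
    have hss' : √((N + 1 : ℕ) : ℝ) * √((N + 1 : ℕ) : ℝ) = N + 1 := by
      rw [Real.mul_self_sqrt (by positivity)]
      push_cast
      ring
    have hs1 : √((N + 1 : ℕ) : ℝ) ≤ 2 * √N := by
      rw [Real.sqrt_le_left (by positivity)]
      push_cast
      nlinarith
    have hs2 : √(N : ℝ) ≤ √((N + 1 : ℕ) : ℝ) := Real.sqrt_le_sqrt (by push_cast; linarith)
    rw [div_le_iff₀ (by linarith)]
    nlinarith

lemma sum_sqrt_le (K : ℕ) (x : ℕ → ℝ) (hx : ∀ a, 0 ≤ x a) :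
    ∑ a ∈ Finset.range K, √(x a) ≤ √(K * ∑ a ∈ Finset.range K, x a) := by
  refine Real.le_sqrt_of_sq_le ?_
  refine sq_sum_le_card_mul_sum_sq.trans (le_of_eq ?_)
  rw [Finset.card_range]
  congr 1
  exact Finset.sum_congr rfl fun a _ => Real.sq_sqrt (hx a)

lemma sum_count_le (τ t K : ℕ) (ω : ℕ → Obs) :
    ∑ a ∈ Finset.range K, count τ t a ω ≤ t - τ := by
  simp only [count]
  rw [Finset.sum_comm]
  refine (Finset.sum_le_card_nsmul _ _ 1 fun r _ => ?_).trans (by simp)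
  rw [Finset.sum_ite_eq]
  split_ifs <;> norm_num

/-- Telescoping gives 4√N for each arm pulled N times; Cauchy–Schwarz then uses that the pulls of
all arms number at most `t - τ`. -/
lemma sum_pullCost_le {τ t K : ℕ} (ht : τ ≤ t) {ω : ℕ → Obs}
    (hω : ∀ s ∈ Finset.Ico τ t, (ω s).1 < K) :
    ∑ s ∈ Finset.Ico τ t, pullCost (count τ s (ω s).1 ω) ≤ 4 * √(K * (t - τ : ℕ)) := by
  have h1 : ∑ s ∈ Finset.Ico τ t, pullCost (count τ s (ω s).1 ω)
      ≤ ∑ a ∈ Finset.range K, 4 * √(count τ t a ω) := by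
    induction t, ht using Nat.le_induction with
    | base => simp [count]
    | succ t ht ih =>
      rw [Finset.sum_Ico_succ_top ht]
      have hlt : (ω t).1 < K := hω t (by simp [ht])
      have h2 := ih fun s hs => hω s (by
        rw [Finset.mem_Ico] at hs ⊢
        omega)
      have h3 : ∑ a ∈ Finset.range K, 4 * √(count τ (t + 1) a ω)
          = ∑ a ∈ Finset.range K, 4 * √(count τ t a ω)
            + (4 * √(count τ t (ω t).1 ω + 1 : ℕ) - 4 * √(count τ t (ω t).1 ω)) := by
        rw [← Finset.add_sum_erase _ _ (Finset.mem_range.2 hlt),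
          ← Finset.add_sum_erase (Finset.range K) (fun a => 4 * √(count τ t a ω))
            (Finset.mem_range.2 hlt), count_succ ht, if_pos rfl]
        have h4 : ∑ a ∈ (Finset.range K).erase (ω t).1, 4 * √(count τ (t + 1) a ω)
            = ∑ a ∈ (Finset.range K).erase (ω t).1, 4 * √(count τ t a ω) := by
          refine Finset.sum_congr rfl fun a ha => ?_
          rw [count_succ ht, if_neg (Finset.ne_of_mem_erase ha).symm, add_zero]
        rw [h4]
        ring
      rw [h3]
      exact add_le_add h2 (pullCost_le _)
  refine h1.trans ?_
  rw [← Finset.mul_sum]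
  gcongr
  refine (sum_sqrt_le K (fun a => (count τ t a ω : ℝ)) fun a => Nat.cast_nonneg _).trans ?_
  refine Real.sqrt_le_sqrt ?_
  gcongr
  exact_mod_cast sum_count_le τ t K ω

/-! ### The supermartingale of a regime -/

/-- Indices of the supermartingales which control the index of arm `b` from below. -/
def lowerFamily (e b : ℕ) : Finset (ℕ × ℝ) :=
  (Finset.range (e + 2)).image fun j => (b, -gridParam (2 ^ e) j)

/-- Indices of the supermartingales which control the indices of all arms from above. -/
def upperFamily (n K : ℕ) : Finset (ℕ × ℝ) :=
  (Finset.range K ×ˢ Finset.Icc 1 n).image fun k => (k.1, 2 / √(k.2 : ℝ))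

/-- All these indices, and one for the constant supermartingale. -/
def fullFamily (e K b : ℕ) : Finset (ℕ × ℝ) :=
  {(0, 0)} ∪ (lowerFamily e b ∪ upperFamily (2 ^ e) K)

open Classical in
/-- The weights of the supermartingales. -/
def familyWeight (e K b : ℕ) (k : ℕ × ℝ) : ℝ :=
  (if k ∈ ({(0, 0)} : Finset (ℕ × ℝ)) then 1 else 0)
    + ((if k ∈ lowerFamily e b then ((e + 2 : ℕ) : ℝ)⁻¹ else 0)
      + if k ∈ upperFamily (2 ^ e) K then ((K : ℝ) * (2 ^ e : ℕ))⁻¹ else 0)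

lemma familyWeight_nonneg (e K b : ℕ) (k : ℕ × ℝ) : 0 ≤ familyWeight e K b k := by
  unfold familyWeight
  have h (P : Prop) [Decidable P] (x : ℝ) (hx : 0 ≤ x) : 0 ≤ if P then x else 0 := by
    split_ifs
    · exact hx
    · exact le_rfl
  exact add_nonneg (h _ _ zero_le_one) (add_nonneg (h _ _ (by positivity)) (h _ _ (by positivity)))

/-- Each of the three families has total weight at most 1. Weights are added rather than chosen by
cases, so overlaps between families are harmless. -/
lemma sum_familyWeight_le (e b : ℕ) {K : ℕ} (hK : 0 < K) :
    ∑ k ∈ fullFamily e K b, familyWeight e K b k ≤ 3 := by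
  classical
  have h (F G : Finset (ℕ × ℝ)) (c : ℝ) (hc : 0 < c) (hG : (G.card : ℝ) ≤ c) :
      (∑ k ∈ F, if k ∈ G then c⁻¹ else 0) ≤ 1 := by
    rw [Finset.sum_ite_mem, Finset.sum_const, nsmul_eq_mul, ← div_eq_mul_inv, div_le_one hc]
    refine le_trans ?_ hG
    exact_mod_cast Finset.card_le_card Finset.inter_subset_right
  have h1 := h (fullFamily e K b) {(0, 0)} 1 one_pos (by simp)
  have h2 := h (fullFamily e K b) (lowerFamily e b) (e + 2 : ℕ) (by positivity) (by
    exact_mod_cast Finset.card_image_le.trans (by simp))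
  have h3 := h (fullFamily e K b) (upperFamily (2 ^ e) K) (K * (2 ^ e : ℕ)) (by positivity) (by
    exact_mod_cast Finset.card_image_le.trans (by simp))
  simp only [familyWeight, Finset.sum_add_distrib]
  rw [inv_one] at h1
  exact (add_le_add h1 (add_le_add h2 h3)).trans (by norm_num)

/-- A union bound in supermartingale form: all terms being nonnegative, the sum controls every
exponential at the cost of the inverse of its weight. -/
lemma le_expWeight {μ : (ℕ → Obs) → ℕ → ℝ} {τ : ℕ} {F : Finset (ℕ × ℝ)} {c : ℕ × ℝ → ℝ}
    (hc : ∀ k, 0 ≤ c k) {k : ℕ × ℝ} (hk : k ∈ F) (s : ℕ) (ω : ℕ → Obs) :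
    c k * Real.exp (k.2 * deviation μ τ s k.1 ω - count τ s k.1 ω * (k.2 ^ 2 / 4))
      ≤ expWeight μ τ F c s ω :=
  Finset.single_le_sum (f := fun k : ℕ × ℝ =>
    c k * Real.exp (k.2 * deviation μ τ s k.1 ω - count τ s k.1 ω * (k.2 ^ 2 / 4)))
    (fun k _ => mul_nonneg (hc k) (Real.exp_nonneg _)) hk

/-- The supermartingale which controls the indices in a block starting in round `τ`. -/
def blockWeight (μ : (ℕ → Obs) → ℕ → ℝ) (τ e K b : ℕ) : ℕ → (ℕ → Obs) → ℝ :=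
  expWeight μ τ (fullFamily e K b) (familyWeight e K b)

lemma one_le_blockWeight (μ : (ℕ → Obs) → ℕ → ℝ) (τ e K b s : ℕ) (ω : ℕ → Obs) :
    1 ≤ blockWeight μ τ e K b s ω := by
  refine le_trans ?_ (le_expWeight (familyWeight_nonneg e K b) (k := (0, 0))
    (by simp [fullFamily]) s ω)
  have h : 1 ≤ familyWeight e K b (0, 0) := by
    have hnn (P : Prop) [Decidable P] (x : ℝ) (hx : 0 ≤ x) : 0 ≤ if P then x else 0 := by
      split_ifs
      · exact hx
      · exact le_rfl
    rw [familyWeight, if_pos (Finset.mem_singleton_self _)]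
    exact le_add_of_nonneg_right
      (add_nonneg (hnn _ _ (by positivity)) (hnn _ _ (by positivity)))
  simpa using h

lemma exp_lower_le (μ : (ℕ → Obs) → ℕ → ℝ) (τ e K b s : ℕ) (ω : ℕ → Obs) {j : ℕ}
    (hj : j < e + 2) :
    Real.exp (-gridParam (2 ^ e) j * deviation μ τ s b ω
        - count τ s b ω * ((-gridParam (2 ^ e) j) ^ 2 / 4))
      ≤ (e + 2 : ℕ) * blockWeight μ τ e K b s ω := by
  have hk : ((b, -gridParam (2 ^ e) j) : ℕ × ℝ) ∈ lowerFamily e b :=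
    Finset.mem_image.2 ⟨j, Finset.mem_range.2 hj, rfl⟩
  have h1 := le_expWeight (μ := μ) (τ := τ) (familyWeight_nonneg e K b)
    (F := fullFamily e K b) (k := (b, -gridParam (2 ^ e) j)) (by simp [fullFamily, hk]) s ω
  have h2 : ((e + 2 : ℕ) : ℝ)⁻¹ ≤ familyWeight e K b (b, -gridParam (2 ^ e) j) := by
    rw [familyWeight, if_pos hk]
    have h3 (P : Prop) [Decidable P] (x : ℝ) (hx : 0 ≤ x) : 0 ≤ if P then x else 0 := by
      split_ifs
      · exact hx
      · exact le_rfl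
    have h4 := h3 (((b, -gridParam (2 ^ e) j) : ℕ × ℝ) ∈ ({(0, 0)} : Finset (ℕ × ℝ))) 1 zero_le_one
    have h5 := h3 (((b, -gridParam (2 ^ e) j) : ℕ × ℝ) ∈ upperFamily (2 ^ e) K)
      ((K : ℝ) * (2 ^ e : ℕ))⁻¹ (by positivity)
    convert le_add_of_nonneg_of_le h4 (le_add_of_nonneg_right h5) using 1
  have h6 := (mul_le_mul_of_nonneg_right h2 (Real.exp_nonneg _)).trans h1
  rwa [inv_mul_le_iff₀ (by positivity)] at h6

lemma exp_upper_le (μ : (ℕ → Obs) → ℕ → ℝ) (τ e b s : ℕ) {K : ℕ} (ω : ℕ → Obs) {a N : ℕ}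
    (ha : a < K) (hN : N ∈ Finset.Icc 1 (2 ^ e)) :
    Real.exp (2 / √(N : ℝ) * deviation μ τ s a ω - count τ s a ω * ((2 / √(N : ℝ)) ^ 2 / 4))
      ≤ K * (2 ^ e : ℕ) * blockWeight μ τ e K b s ω := by
  have hk : ((a, 2 / √(N : ℝ)) : ℕ × ℝ) ∈ upperFamily (2 ^ e) K :=
    Finset.mem_image.2 ⟨(a, N), Finset.mem_product.2 ⟨Finset.mem_range.2 ha, hN⟩, rfl⟩
  have h1 := le_expWeight (μ := μ) (τ := τ) (familyWeight_nonneg e K b)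
    (F := fullFamily e K b) (k := (a, 2 / √(N : ℝ))) (by simp [fullFamily, hk]) s ω
  have h2 : ((K : ℝ) * (2 ^ e : ℕ))⁻¹ ≤ familyWeight e K b (a, 2 / √(N : ℝ)) := by
    rw [familyWeight, if_pos hk]
    have h3 (P : Prop) [Decidable P] (x : ℝ) (hx : 0 ≤ x) : 0 ≤ if P then x else 0 := by
      split_ifs
      · exact hx
      · exact le_rfl
    have h4 := h3 (((a, 2 / √(N : ℝ)) : ℕ × ℝ) ∈ ({(0, 0)} : Finset (ℕ × ℝ))) 1 zero_le_one
    have h5 := h3 (((a, 2 / √(N : ℝ)) : ℕ × ℝ) ∈ lowerFamily e b)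
      (((e + 2 : ℕ) : ℝ)⁻¹) (by positivity)
    convert le_add_of_nonneg_of_le h4 (le_add_of_nonneg_of_le h5 le_rfl) using 1
  have h6 := (mul_le_mul_of_nonneg_right h2 (Real.exp_nonneg _)).trans h1
  have hK : (0 : ℝ) < K := by exact_mod_cast Nat.zero_lt_of_lt ha
  rwa [inv_mul_le_iff₀ (by positivity)] at h6

/-! ### The regret in a regime -/

lemma numArms_pos (p i : ℕ) : 0 < numArms p i :=
  Nat.add_pos_left (by unfold numCells; positivity) _

lemma mossIndex_regimeHistory (E : Environment) {p i s : ℕ} (h1 : regimeEnd p i ≤ s)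
    (h2 : s < regimeEnd p (i + 1)) (n K : ℕ) (ω : ℕ → Obs) (a : ℕ) :
    mossIndex n K (regimeHistory p (initial s ω)) a
      = if count (regimeEnd p i) s a ω = 0 then ⊤ else
        ((armMean E p i ω a + (deviation (armMean E p i) (regimeEnd p i) s a ω
          / count (regimeEnd p i) s a ω + mossBonus n K (count (regimeEnd p i) s a ω)) : ℝ) :
            EReal) := by
  rw [mossIndex, pulls_regimeHistory h1 h2, totalReward_regimeHistory h1 h2 (armMean E p i)]
  split_ifs with h
  · rfl
  · have h' : (count (regimeEnd p i) s a ω : ℝ) ≠ 0 := by exact_mod_cast h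
    congr 1
    rw [add_div, mul_div_cancel_left₀ _ h', mossBonus]
    ring

lemma count_lt {p i s : ℕ} (h1 : regimeEnd p i ≤ s) (h2 : s < regimeEnd p (i + 1)) (a : ℕ)
    (ω : ℕ → Obs) : count (regimeEnd p i) s a ω < 2 ^ (p + (i + 1)) := by
  have h3 : count (regimeEnd p i) s a ω ≤ s - regimeEnd p i := by
    refine (Finset.sum_le_card_nsmul _ _ 1 fun r _ => ?_).trans (by simp)
    split_ifs <;> norm_num
  have := regimeEnd_succ p i
  omega

lemma chosen_spec {tie : Finset ℕ → ℕ} (htie : ∀ S : Finset ℕ, S.Nonempty → tie S ∈ S)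
    {p i s : ℕ} (h1 : regimeEnd p i ≤ s) (h2 : s < regimeEnd p (i + 1)) (ω : ℕ → Obs) :
    chosen tie p s ω < numArms p (i + 1) ∧ ∀ b < numArms p (i + 1),
      mossIndex (2 ^ (p + (i + 1))) (numArms p (i + 1)) (regimeHistory p (initial s ω)) b
        ≤ mossIndex (2 ^ (p + (i + 1))) (numArms p (i + 1)) (regimeHistory p (initial s ω))
          (chosen tie p s ω) := by
  have := mossArm_mem htie (2 ^ (p + (i + 1))) (numArms_pos p (i + 1))
    (regimeHistory p (initial s ω))
  rwa [chosen, chosenArm, regime_eq h1 h2]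

/-- The regret of a round with respect to the discrete arm `b`. -/
lemma armMean_sub_le {tie : Finset ℕ → ℕ} (htie : ∀ S : Finset ℕ, S.Nonempty → tie S ∈ S)
    (E : Environment) {p i s b : ℕ} (h1 : regimeEnd p i ≤ s) (h2 : s < regimeEnd p (i + 1))
    (hb : b < numArms p (i + 1)) (ω : ℕ → Obs) {w : ℝ}
    (hw : blockWeight (armMean E p i) (regimeEnd p i) (p + (i + 1)) (numArms p (i + 1)) b s ω ≤ w) :
    armMean E p i ω b - armMean E p i ω (chosen tie p s ω)
      ≤ √(numArms p (i + 1) / (2 ^ (p + (i + 1)) : ℕ))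
          * ((p + (i + 1) + 2 : ℕ) * w ^ (2 / 3 : ℝ))
        + (2 + 2 * Real.log (numArms p (i + 1) * (2 ^ (p + (i + 1)) : ℕ)) + w ^ (2 / 3 : ℝ))
          * pullCost (count (regimeEnd p i) s (chosen tie p s ω) ω) := by
  set e := p + (i + 1)
  set K := numArms p (i + 1) with hK
  set τ := regimeEnd p i
  set μ := armMean E p i with hμ
  set I₀ := chosen tie p s ω with hI₀
  have hK0 : 0 < K := numArms_pos p (i + 1)
  have hn0 : 0 < 2 ^ e := by positivity
  have hKr : (1 : ℝ) ≤ K := by exact_mod_cast hK0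
  have hnr : (1 : ℝ) ≤ (2 ^ e : ℕ) := by exact_mod_cast hn0
  have hw1 : 1 ≤ w := (one_le_blockWeight _ _ _ _ _ _ _).trans hw
  have hwp : 0 ≤ w ^ (2 / 3 : ℝ) := by positivity
  have hlog : 0 ≤ Real.log (K * (2 ^ e : ℕ)) := Real.log_nonneg (by nlinarith)
  have hA : 0 ≤ √(K / (2 ^ e : ℕ)) * ((e + 2 : ℕ) * w ^ (2 / 3 : ℝ)) := by positivity
  have hgap : μ ω b - μ ω I₀ ≤ 1 := by
    linarith [(armMean_mem E p i ω b).2, (armMean_mem E p i ω I₀).1]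
  obtain ⟨hI, hmax⟩ := chosen_spec htie h1 h2 ω
  -- A first pull is charged the trivial gap 1, which is the value of `pullCost` at 0.
  by_cases hN : count τ s I₀ ω = 0
  · rw [hN, pullCost, if_pos rfl]
    linarith
  have hNb := hmax b hb
  rw [mossIndex_regimeHistory E h1 h2, mossIndex_regimeHistory E h1 h2, if_neg hN] at hNb
  -- An arm not yet pulled has infinite index and would beat the chosen arm, whose index is finite.
  have hb0 : count τ s b ω ≠ 0 := by
    intro h
    rw [if_pos h, top_le_iff] at hNb
    exact EReal.coe_ne_top _ hNb
  rw [if_neg hb0, EReal.coe_le_coe_iff] at hNb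
  have hover := overestimation_le (S := deviation μ τ s I₀ ω) hn0 hK0 (Nat.pos_of_ne_zero hN) hw1
    ((exp_upper_le μ τ e b s ω hI (Finset.mem_Icc.2 ⟨Nat.pos_of_ne_zero hN,
      (count_lt h1 h2 I₀ ω).le⟩)).trans (by gcongr))
  rw [pullCost, if_neg hN, mul_one_div]
  set y := (2 + 2 * Real.log (K * (2 ^ e : ℕ)) + w ^ (2 / 3 : ℝ)) / √(count τ s I₀ ω) with hy
  have hy0 : 0 ≤ y := by positivity
  by_contra! hlt
  -- The chosen index is at most its mean plus `y`, and the index of `b` does not exceed it. So the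
  -- index of `b` lies below its own mean by at least the gap minus `y`, the value taken for `x`.
  have hunder := underestimation_le (e := e) (x := μ ω b - μ ω I₀ - y) (S := deviation μ τ s b ω)
    (w := w) hK0 (Nat.pos_of_ne_zero hb0) (by linarith) (by linarith) hw1 (by
      have hbr : (0 : ℝ) < count τ s b ω := by exact_mod_cast Nat.pos_of_ne_zero hb0
      have h3 : μ ω b - μ ω I₀ - y + mossBonus (2 ^ e) K (count τ s b ω)
          ≤ -(deviation μ τ s b ω / count τ s b ω) := by linarith
      have h4 := mul_le_mul_of_nonneg_left h3 hbr.le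
      rw [mul_neg, mul_div_cancel₀ _ hbr.ne'] at h4
      linarith)
    fun j hj => (exp_lower_le μ τ e K b s ω hj).trans (by gcongr)
  linarith

/-- The regret of MOSS in a regime, with respect to any of its discrete arms. -/
lemma regime_regret_le {tie : Finset ℕ → ℕ} (htie : ∀ S : Finset ℕ, S.Nonempty → tie S ∈ S)
    {B : ℝ} {p : ℕ} (hp : ⌈Real.logb 2 B⌉₊ = p) (E : Environment) (i : ℕ) {b : ℕ}
    (hb : b < numArms p (i + 1)) :
    2 ^ (p + (i + 1)) * (∫ ω, armMean E p i ω b ∂(trajLaw (MeDZO tie B) E (regimeEnd p i)))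
        - ∑ s ∈ Finset.Ico (regimeEnd p i) (regimeEnd p (i + 1)), meanPayoff (MeDZO tie B) E s
      ≤ √(numArms p (i + 1) * 2 ^ (p + (i + 1)))
        * (4 * (2 + 2 * Real.log (numArms p (i + 1) * 2 ^ (p + (i + 1))))
          + 9 * (p + (i + 1) + 6)) := by
  set A := MeDZO tie B
  set τ := regimeEnd p i with hτ
  set T := regimeEnd p (i + 1) with hT
  set e := p + (i + 1) with he
  set K := numArms p (i + 1) with hK
  set μ := armMean E p i with hμ
  set W := blockWeight μ τ e K b with hW
  set Λ := 2 + 2 * Real.log (K * (2 ^ e : ℕ)) with hΛ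
  have hTτ : T = τ + 2 ^ e := regimeEnd_succ p i
  have hτT : τ ≤ T := hTτ ▸ Nat.le_add_right _ _
  have hn0 : (0 : ℝ) < (2 ^ e : ℕ) := by positivity
  have hK1 : (1 : ℝ) ≤ K := by exact_mod_cast numArms_pos p (i + 1)
  have hn1 : (1 : ℝ) ≤ (2 ^ e : ℕ) := by exact_mod_cast Nat.one_le_two_pow
  have hlog : 0 ≤ Real.log (K * (2 ^ e : ℕ)) := Real.log_nonneg (by nlinarith)
  have hadμ : ∀ a, Adapted τ fun ω => μ ω a := adapted_armMean E p i
  have hmμ : ∀ a, Measurable fun ω => μ ω a := measurable_armMean E p i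
  have hmW (s : ℕ) : Measurable (W s) := measurable_expWeight hmμ τ _ _ s
  have hWpos (s : ℕ) (ω : ℕ → Obs) : 0 < W s ω :=
    zero_lt_one.trans_le (one_le_blockWeight μ τ e K b s ω)
  set M : (ℕ → Obs) → ℝ := fun ω => runMax W τ (2 ^ e) ω ^ (2 / 3 : ℝ) with hM
  have hMm : Measurable M := (measurable_runMax hmW τ _).pow_const _
  have hM0 (ω : ℕ → Obs) : 0 ≤ M ω := Real.rpow_nonneg (runMax_pos hWpos τ _ ω).le _
  -- the moment of the running maximum
  have hmax : ∫⁻ ω, ENNReal.ofReal (M ω) ∂(trajLaw A E T) ≤ ENNReal.ofReal 9 := by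
    rw [hTτ]
    -- The three families give initial weight at most 3, and 3 · 3^(2/3) ≤ 9.
    refine (lintegral_runMax_le A E (w₀ := 3) hmW (fun s hs => adapted_expWeight hadμ _ _ hs) hWpos
      (fun ω => ?_) fun r hr ω => ?_).trans (ENNReal.ofReal_le_ofReal ?_)
    · exact (expWeight_init μ τ _ _ ω).trans_le (sum_familyWeight_le e b (numArms_pos p (i + 1)))
    · exact expWeight_step tie hp E (Nat.le_add_right _ _) (by
        change _ < T
        omega) _ (familyWeight_nonneg e K b) ω
    · have : (3 : ℝ) ^ (2 / 3 : ℝ) ≤ 3 ^ (1 : ℝ) :=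
        Real.rpow_le_rpow_of_exponent_le (by norm_num) (by norm_num)
      rw [Real.rpow_one] at this
      linarith
  have hMi : Integrable M (trajLaw A E T) := by
    refine ⟨hMm.aestronglyMeasurable, ?_⟩
    rw [hasFiniteIntegral_iff_ofReal (ae_of_all _ hM0)]
    exact hmax.trans_lt ENNReal.ofReal_lt_top
  have hMint : ∫ ω, M ω ∂(trajLaw A E T) ≤ 9 := by
    rw [integral_eq_lintegral_of_nonneg_ae (ae_of_all _ hM0) hMm.aestronglyMeasurable]
    exact ENNReal.toReal_le_of_le_ofReal (by norm_num) hmax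
  -- the gaps
  have hmc (s : ℕ) : Measurable fun ω => μ ω (chosen tie p s ω) := by
    have h : Measurable fun q : (ℕ → Obs) × ℕ => μ q.1 q.2 :=
      measurable_from_prod_countable_left fun a => hmμ a
    exact h.comp (measurable_id.prodMk (measurable_chosen tie p s))
  have hbdd (g : (ℕ → Obs) → ℝ) (hg : Measurable g) (h : ∀ ω, g ω ∈ Set.Icc (0 : ℝ) 1) (t : ℕ) :
      Integrable g (trajLaw A E t) := by
    refine Integrable.of_bound (C := 1) hg.aestronglyMeasurable (ae_of_all _ fun ω => ?_)
    rw [Real.norm_of_nonneg (h ω).1]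
    exact (h ω).2
  have hib := hbdd _ (hmμ b) (fun ω => armMean_mem E p i ω b) T
  have hic (s : ℕ) := hbdd _ (hmc s) (fun ω => armMean_mem E p i ω _) T
  have hid (s : ℕ) : Integrable (fun ω => μ ω b - μ ω (chosen tie p s ω)) (trajLaw A E T) :=
    hib.sub (hic s)
  -- The mean of arm `b` is fixed at round τ, so its expectation is the same at the end of the
  -- regime, where all gaps are compared on one law.
  have hlhs : 2 ^ e * (∫ ω, μ ω b ∂(trajLaw A E τ))
      - ∑ s ∈ Finset.Ico τ T, meanPayoff A E s
      = ∫ ω, ∑ s ∈ Finset.Ico τ T, (μ ω b - μ ω (chosen tie p s ω)) ∂(trajLaw A E T) := by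
    rw [integral_finsetSum _ fun s _ => hid s]
    have h1 : ∀ s ∈ Finset.Ico τ T, ∫ ω, (μ ω b - μ ω (chosen tie p s ω)) ∂(trajLaw A E T)
        = ∫ ω, μ ω b ∂(trajLaw A E τ) - meanPayoff A E s := by
      intro s hs
      rw [Finset.mem_Ico] at hs
      rw [integral_sub hib (hic s), (hadμ b).integral_eq (hmμ b) A E hτT,
        Adapted.integral_eq (s := s) (F := fun ω => μ ω (chosen tie p s ω)) (fun ω ω' h => ?_)
          (hmc s) A E hs.2.le, meanPayoff_MeDZO tie hp E hs.1 hs.2]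
      simp only [adapted_chosen tie p s ω ω' h]
      exact (hadμ _).mono hs.1 ω ω' h
    rw [Finset.sum_congr rfl h1, Finset.sum_sub_distrib, Finset.sum_const, Nat.card_Ico, hTτ,
      Nat.add_sub_cancel_left, nsmul_eq_mul]
    push_cast
    rfl
  rw [hlhs]
  set R := √(K * (2 ^ e : ℕ)) with hR
  -- One running maximum serves all rounds. Over n = 2^e rounds the first term of `armMean_sub_le`
  -- adds up through n √(K/n) = R, and the pull costs total at most 4 R.
  have hpoint : ∀ᵐ ω ∂(trajLaw A E T),
      ∑ s ∈ Finset.Ico τ T, (μ ω b - μ ω (chosen tie p s ω))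
        ≤ R * (4 * Λ) + R * ((e + 2 : ℕ) + 4) * M ω := by
    filter_upwards [ae_label_eq_chosen tie hp E T] with ω hω
    have h1 : ∀ s ∈ Finset.Ico τ T, μ ω b - μ ω (chosen tie p s ω)
        ≤ √(K / (2 ^ e : ℕ)) * ((e + 2 : ℕ) * M ω)
          + (Λ + M ω) * pullCost (count τ s (ω s).1 ω) := by
      intro s hs
      rw [Finset.mem_Ico] at hs
      rw [hω s hs.2]
      refine armMean_sub_le htie E hs.1 hs.2 hb ω ?_
      have := le_runMax W τ ω (r := s - τ) (R := 2 ^ e) (by omega)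
      rwa [Nat.add_sub_cancel' hs.1] at this
    have h2 : ∑ s ∈ Finset.Ico τ T, pullCost (count τ s (ω s).1 ω) ≤ 4 * R := by
      have := sum_pullCost_le (τ := τ) (t := T) (K := K) hτT (ω := ω) fun s hs => by
        rw [Finset.mem_Ico] at hs
        rw [hω s hs.2]
        exact (chosen_spec htie hs.1 hs.2 ω).1
      rwa [hTτ, Nat.add_sub_cancel_left, ← hTτ] at this
    have h3 : √(K / (2 ^ e : ℕ)) * (2 ^ e : ℕ) = R := by
      have h4 : (K : ℝ) * (2 ^ e : ℕ) = (2 ^ e : ℕ) ^ 2 * (K / (2 ^ e : ℕ)) := by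
        field_simp
      rw [hR, h4, Real.sqrt_mul (by positivity), Real.sqrt_sq hn0.le, mul_comm]
    refine (Finset.sum_le_sum h1).trans ?_
    have hcard : T - τ = 2 ^ e := by rw [hTτ, Nat.add_sub_cancel_left]
    have h6 : (2 ^ e : ℕ) * (√(K / (2 ^ e : ℕ)) * ((e + 2 : ℕ) * M ω)) = R * ((e + 2 : ℕ) * M ω) := by
      rw [← h3]
      ring
    rw [Finset.sum_add_distrib, Finset.sum_const, Nat.card_Ico, hcard, nsmul_eq_mul,
      ← Finset.mul_sum, h6]
    have h5 : (Λ + M ω) * ∑ s ∈ Finset.Ico τ T, pullCost (count τ s (ω s).1 ω)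
        ≤ (Λ + M ω) * (4 * R) :=
      mul_le_mul_of_nonneg_left h2 (add_nonneg (by linarith) (hM0 ω))
    linarith
  have hri : Integrable (fun ω => R * (4 * Λ) + R * ((e + 2 : ℕ) + 4) * M ω) (trajLaw A E T) :=
    (integrable_const _).add (hMi.const_mul _)
  refine (integral_mono_ae (integrable_finsetSum _ fun s _ => hid s) hri hpoint).trans ?_
  rw [integral_add (integrable_const _) (hMi.const_mul _),
    integral_const_mul (R * ((e + 2 : ℕ) + 4)) M]
  simp only [integral_const, probReal_univ, smul_eq_mul, one_mul]
  have hfin : R * ((e + 2 : ℕ) + 4) * ∫ ω, M ω ∂(trajLaw A E T) ≤ R * ((e + 2 : ℕ) + 4) * 9 :=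
    mul_le_mul_of_nonneg_left hMint (by positivity)
  refine (add_le_add_right hfin _).trans (le_of_eq ?_)
  have e2 : ((2 ^ e : ℕ) : ℝ) = 2 ^ e := by push_cast; rfl
  have e3 : (((e + 2 : ℕ) : ℝ)) = p + (i + 1) + 2 := by
    rw [he]
    push_cast
    ring
  rw [hR, hΛ, e2, e3]
  ring

/-! ### The regret of MeDZO -/

lemma measurableSet_cell (K a : ℕ) : MeasurableSet (cell K a) :=
  (measurableSet_le measurable_const measurable_subtype_coe).inter
    (measurableSet_le measurable_subtype_coe measurable_const)

lemma exists_mem_cell {K : ℕ} (hK : 0 < K) (x : I) : ∃ a < K, x ∈ cell K a := by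
  have hK' : (0 : ℝ) < K := by exact_mod_cast hK
  obtain ⟨hx0, hx1⟩ := x.2
  rcases hx1.lt_or_eq with h | h
  · refine ⟨⌊(x : ℝ) * K⌋₊, ?_, ?_, ?_⟩
    · rw [Nat.floor_lt (by positivity)]
      nlinarith
    · rw [div_le_iff₀ hK']
      exact Nat.floor_le (by positivity)
    · rw [le_div_iff₀ hK']
      exact (Nat.lt_floor_add_one _).le
  · have e : ((K - 1 : ℕ) : ℝ) + 1 = K := by exact_mod_cast Nat.sub_add_cancel hK
    refine ⟨K - 1, by omega, ?_, ?_⟩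
    · rw [div_le_iff₀ hK', h]
      linarith
    · rw [e, div_self hK'.ne', h]

/-- One of the cells has a mean payoff which is close to the maximum. -/
lemma exists_cell_mean_ge (E : Environment) {L α : ℝ} (hα : 0 < α) (hL : 0 < L)
    (hE : E.f ∈ HolderClass L α) {K : ℕ} (hK : 0 < K) :
    ∃ a < K, (⨆ x, E.f x) - L * (1 / K) ^ α ≤ ∫ x, E.f x ∂(volume[|cell K a]) := by
  obtain ⟨x₀, hmax, hx₀⟩ := hE
  obtain ⟨a, ha, hxa⟩ := exists_mem_cell hK x₀
  have hK' : (0 : ℝ) < K := by exact_mod_cast hK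
  have := cond_isProbabilityMeasure (volume_cell_ne_zero ha)
  have hsup : (⨆ x, E.f x) ≤ E.f x₀ := ciSup_le hmax
  refine ⟨a, ha, ?_⟩
  have hi : Integrable E.f (volume[|cell K a]) := by
    refine Integrable.of_bound (C := 1) E.measurable_f.aestronglyMeasurable (ae_of_all _ fun x => ?_)
    rw [Real.norm_of_nonneg (E.f_mem x).1]
    exact (E.f_mem x).2
  have h := integral_mono_ae (integrable_const ((⨆ x, E.f x) - L * (1 / K) ^ α)) hi (by
    filter_upwards [ae_cond_mem (μ := volume) (measurableSet_cell K a)] with x hx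
    have e : ((a : ℝ) + 1) / K = a / K + 1 / K := by ring
    have h1 : |(x₀ : ℝ) - x| ≤ 1 / K := by
      obtain ⟨h2, h3⟩ := hxa
      obtain ⟨h4, h5⟩ := hx
      rw [e] at h3 h5
      rw [abs_le]
      constructor <;> linarith
    have h2 := (le_abs_self _).trans (hx₀ x)
    have h3 := mul_le_mul_of_nonneg_left (Real.rpow_le_rpow (abs_nonneg _) h1 hα.le) hL.le
    linarith)
  simpa using h

/-- The expected regret in regime `i + 1`. -/
def regimeRegret (A : Algorithm) (E : Environment) (p i : ℕ) : ℝ :=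
  ∑ s ∈ Finset.Ico (regimeEnd p i) (regimeEnd p (i + 1)), ((⨆ x, E.f x) - meanPayoff A E s)

lemma card_regime (p i : ℕ) :
    (Finset.Ico (regimeEnd p i) (regimeEnd p (i + 1))).card = 2 ^ (p + (i + 1)) := by
  rw [Nat.card_Ico, regimeEnd_succ, Nat.add_sub_cancel_left]

lemma regimeRegret_eq (A : Algorithm) (E : Environment) (p i : ℕ) :
    regimeRegret A E p i = 2 ^ (p + (i + 1)) * (⨆ x, E.f x)
      - ∑ s ∈ Finset.Ico (regimeEnd p i) (regimeEnd p (i + 1)), meanPayoff A E s := by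
  rw [regimeRegret, Finset.sum_sub_distrib, Finset.sum_const, card_regime, nsmul_eq_mul]
  push_cast
  rfl

lemma regimeRegret_le (A : Algorithm) (E : Environment) (p i : ℕ) :
    regimeRegret A E p i ≤ 2 ^ (p + (i + 1)) := by
  rw [regimeRegret_eq]
  have h1 : (⨆ x, E.f x) ≤ 1 := ciSup_le fun x => (E.f_mem x).2
  have h2 : 0 ≤ ∑ s ∈ Finset.Ico (regimeEnd p i) (regimeEnd p (i + 1)), meanPayoff A E s :=
    Finset.sum_nonneg fun s _ => meanPayoff_nonneg A E s
  have h3 : (2 : ℝ) ^ (p + (i + 1)) * (⨆ x, E.f x) ≤ 2 ^ (p + (i + 1)) :=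
    mul_le_of_le_one_right (by positivity) h1
  linarith

lemma regret_regimeEnd (A : Algorithm) (E : Environment) (p r : ℕ) :
    regret A E (regimeEnd p r) = ∑ i ∈ Finset.range r, regimeRegret A E p i := by
  induction r with
  | zero => simp [regret_eq_sum, regimeEnd]
  | succ r ih =>
    rw [Finset.sum_range_succ, ← ih, regret_eq_sum, regret_eq_sum, regimeRegret,
      Finset.sum_range_add_sum_Ico _ (regimeEnd_mono p (Nat.le_succ r))]

/-! ### Cell arms, memory arms and their combination -/

/-- The bound on the regret of MOSS in regime `i + 1`. -/
def mossBound (p i : ℕ) : ℝ :=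
  √(numArms p (i + 1) * 2 ^ (p + (i + 1)))
    * (4 * (2 + 2 * Real.log (numArms p (i + 1) * 2 ^ (p + (i + 1)))) + 9 * (p + (i + 1) + 6))

/-- MOSS is compared with the cell of a maximizer; the first term is the discretization error over
the whole regime. -/
lemma regimeRegret_le_cell {tie : Finset ℕ → ℕ} (htie : ∀ S : Finset ℕ, S.Nonempty → tie S ∈ S)
    {B : ℝ} {p : ℕ} (hp : ⌈Real.logb 2 B⌉₊ = p) (E : Environment) {L α : ℝ} (hα : 0 < α)
    (hL : 0 < L) (hE : E.f ∈ HolderClass L α) (i : ℕ) :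
    regimeRegret (MeDZO tie B) E p i
      ≤ 2 ^ (p + (i + 1)) * (L * (1 / (numCells p (i + 1) : ℝ)) ^ α) + mossBound p i := by
  have hK : 0 < numCells p (i + 1) := by unfold numCells; positivity
  obtain ⟨a, ha, hmean⟩ := exists_cell_mean_ge E hα hL hE hK
  have h := regime_regret_le htie hp E i (b := a) (ha.trans_le (Nat.le_add_right _ _))
  have e (ω : ℕ → Obs) : armMean E p i ω a = ∫ x, E.f x ∂(volume[|cell (numCells p (i + 1)) a]) :=
    if_pos ha
  simp only [e, integral_const, probReal_univ, one_smul] at h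
  rw [regimeRegret_eq]
  have h2 := mul_le_mul_of_nonneg_left hmean (by positivity : (0 : ℝ) ≤ 2 ^ (p + (i + 1)))
  rw [mossBound]
  linarith

/-- Playing the empirical measure of an earlier regime reproduces its average regret per round, and
the current regime is `2 ^ (i - j)` times longer. -/
lemma regimeRegret_le_memory {tie : Finset ℕ → ℕ} (htie : ∀ S : Finset ℕ, S.Nonempty → tie S ∈ S)
    {B : ℝ} {p : ℕ} (hp : ⌈Real.logb 2 B⌉₊ = p) (E : Environment) {i j : ℕ} (hj : j < i) :
    regimeRegret (MeDZO tie B) E p i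
      ≤ 2 ^ (i - j) * regimeRegret (MeDZO tie B) E p j + mossBound p i := by
  have hb : numCells p (i + 1) + j < numArms p (i + 1) := by
    simp only [numArms]
    omega
  have h := regime_regret_le htie hp E i hb
  have e (ω : ℕ → Obs) : armMean E p i ω (numCells p (i + 1) + j)
      = (2 ^ (p + (j + 1)) : ℝ)⁻¹ *
        ∑ r ∈ Finset.Ico (regimeEnd p j) (regimeEnd p (j + 1)), E.f (ω r).2.1 := by
    rw [armMean, if_neg (by omega), if_pos hb, Nat.add_sub_cancel_left]
  have e2 : ∫ ω, armMean E p i ω (numCells p (i + 1) + j)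
      ∂(trajLaw (MeDZO tie B) E (regimeEnd p i))
      = (2 ^ (p + (j + 1)) : ℝ)⁻¹ *
        ∑ r ∈ Finset.Ico (regimeEnd p j) (regimeEnd p (j + 1)), meanPayoff (MeDZO tie B) E r := by
    simp only [e]
    rw [integral_const_mul, integral_finsetSum _ fun r _ => integrable_payoff _ E r _]
    congr 1
    refine Finset.sum_congr rfl fun r hr => integral_payoff _ E ?_
    exact (Finset.mem_Ico.1 hr).2.trans_le (regimeEnd_mono p hj)
  rw [e2] at h
  rw [regimeRegret_eq, regimeRegret_eq, mossBound]
  have e3 : (2 : ℝ) ^ (p + (i + 1)) = 2 ^ (i - j) * 2 ^ (p + (j + 1)) := by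
    rw [← pow_add]
    congr 1
    omega
  have e4 : (2 : ℝ) ^ (p + (i + 1)) * ((2 ^ (p + (j + 1)) : ℝ)⁻¹ *
        ∑ r ∈ Finset.Ico (regimeEnd p j) (regimeEnd p (j + 1)), meanPayoff (MeDZO tie B) E r)
      = 2 ^ (i - j) *
        ∑ r ∈ Finset.Ico (regimeEnd p j) (regimeEnd p (j + 1)), meanPayoff (MeDZO tie B) E r := by
    rw [e3]
    field_simp
  rw [e4] at h
  have e5 : (2 : ℝ) ^ (p + (i + 1)) * (⨆ x, E.f x)
      = 2 ^ (i - j) * (2 ^ (p + (j + 1)) * ⨆ x, E.f x) := by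
    rw [e3]
    ring
  linarith

/-- Cells times length is always 4·4^p. The memory arms add at most i · 2^(p+i+1) ≤ 2 k · 4^p,
because p + i ≤ k ≤ 2p; hence the square root is 2^p up to a factor k + 2. -/
lemma mossBound_le {p k i : ℕ} (hpk : p ≤ k) (hkp : k ≤ 2 * p) (hi : i ≤ k - p) :
    mossBound p i ≤ 52 * (k + 2) ^ 2 * 2 ^ p := by
  have hcells : numCells p (i + 1) * 2 ^ (p + (i + 1)) = 4 * 4 ^ p := by
    rw [numCells, ← pow_add, show p + 2 - (i + 1) + (p + (i + 1)) = 2 + 2 * p by omega, pow_add,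
      pow_mul]
    norm_num
  have hnat : numArms p (i + 1) * 2 ^ (p + (i + 1)) ≤ 4 ^ p * (4 + 2 * k) := by
    rw [numArms, add_mul, hcells, Nat.add_sub_cancel]
    have h1 : 2 ^ (p + (i + 1)) ≤ 2 * 4 ^ p := by
      have h2 : 2 * 4 ^ p = 2 ^ (2 * p + 1) := by
        rw [pow_succ, pow_mul]
        ring
      rw [h2]
      exact Nat.pow_le_pow_right (by norm_num) (by omega)
    have h3 : i * 2 ^ (p + (i + 1)) ≤ k * (2 * 4 ^ p) := Nat.mul_le_mul (by omega) h1
    linarith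
  have hreal : (numArms p (i + 1) : ℝ) * 2 ^ (p + (i + 1)) ≤ 4 ^ p * (4 + 2 * k) := by
    exact_mod_cast hnat
  have hK1 : (1 : ℝ) ≤ numArms p (i + 1) := by exact_mod_cast numArms_pos p (i + 1)
  have hn1 : (1 : ℝ) ≤ 2 ^ (p + (i + 1)) := one_le_pow₀ (by norm_num)
  have hX1 : (1 : ℝ) ≤ numArms p (i + 1) * 2 ^ (p + (i + 1)) := by nlinarith
  have hk0 : (0 : ℝ) ≤ k := Nat.cast_nonneg k
  have hpk' : (p : ℝ) ≤ k := by exact_mod_cast hpk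
  have hik : (i : ℝ) + p ≤ k := by
    have : i + p ≤ k := by omega
    exact_mod_cast this
  have hsqrt : √(numArms p (i + 1) * 2 ^ (p + (i + 1))) ≤ 2 ^ p * (k + 2) := by
    rw [Real.sqrt_le_left (by positivity), mul_pow]
    have h4 : ((2 : ℝ) ^ p) ^ 2 = 4 ^ p := by
      rw [← pow_mul, mul_comm, pow_mul]
      norm_num
    rw [h4]
    refine hreal.trans ?_
    gcongr
    nlinarith
  have hlog : Real.log (numArms p (i + 1) * 2 ^ (p + (i + 1))) ≤ 4 * k + 4 := by
    refine (Real.log_le_log (by linarith) hreal).trans ?_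
    rw [Real.log_mul (by positivity) (by positivity), Real.log_pow]
    have h5 : Real.log (4 + 2 * k) ≤ 4 + 2 * k - 1 := Real.log_le_sub_one_of_pos (by positivity)
    have h6 : Real.log 4 ≤ 2 := by
      have : (4 : ℝ) = 2 ^ 2 := by norm_num
      rw [this, Real.log_pow]
      have := Real.log_two_lt_d9
      push_cast
      linarith
    have h7 : (p : ℝ) * Real.log 4 ≤ k * 2 := by
      refine mul_le_mul hpk' h6 (Real.log_nonneg (by norm_num)) hk0
    linarith
  have hlog0 := Real.log_nonneg hX1
  have hp0 : (0 : ℝ) ≤ p := Nat.cast_nonneg p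
  have hi0 : (0 : ℝ) ≤ i := Nat.cast_nonneg i
  rw [mossBound]
  calc _ ≤ (2 ^ p * ((k : ℝ) + 2)) * (52 * (k + 2)) := by
        refine mul_le_mul hsqrt (by linarith) (by positivity) (by positivity)
    _ = _ := by ring

/-- The regret of MeDZO in a phase of the doubling trick. -/
lemma regret_MeDZO_le {tie : Finset ℕ → ℕ} (htie : ∀ S : Finset ℕ, S.Nonempty → tie S ∈ S) {m : ℝ}
    (hm : m ∈ Set.Icc (1 / 2 : ℝ) 1) (E : Environment) {L α : ℝ} (hα : 0 < α) (hL : 0 < L)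
    (hE : E.f ∈ HolderClass L α) (k : ℕ) :
    regret (MeDZO tie ((2 : ℝ) ^ ((k : ℝ) * m))) E (2 ^ k)
      ≤ 12 * (k + 1) * (L + 52 * (k + 2) ^ 2) * 2 ^ ((k : ℝ) * theta m α) := by
  obtain ⟨hm1, hm2⟩ := hm
  have hk0 : (0 : ℝ) ≤ k := Nat.cast_nonneg k
  set A := MeDZO tie ((2 : ℝ) ^ ((k : ℝ) * m)) with hA
  set p := ⌈(k : ℝ) * m⌉₊ with hp
  have hp' : ⌈Real.logb 2 ((2 : ℝ) ^ ((k : ℝ) * m))⌉₊ = p := by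
    rw [Real.logb_rpow (by norm_num) (by norm_num)]
  have hp1 : (k : ℝ) * m ≤ p := Nat.le_ceil _
  have hp2 : (p : ℝ) ≤ k * m + 1 := (Nat.ceil_lt_add_one (by positivity)).le
  have hpk : p ≤ k := by
    rw [hp, Nat.ceil_le]
    nlinarith
  -- This is where m ≥ 1/2 matters: it keeps the exponent of the number of cells from being
  -- truncated at 0 and the memory arms affordable.
  have hkp : k ≤ 2 * p := by
    have : (k : ℝ) ≤ 2 * p := by nlinarith
    exact_mod_cast this
  set c := α / (α + 1) with hc
  have hc0 : 0 < c := by positivity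
  -- Up to this regime the discretization error 2^(p+i+1) · 2^(-(p+1-i)α) is at most 2^p: for i + 1
  -- ≤ pα/(α+1) one has i + 1 ≤ (p - i - 1) α.
  set j₀ := ⌊(p : ℝ) * c⌋₊ with hj₀
  have hj1 : (j₀ : ℝ) ≤ p * c := Nat.floor_le (by positivity)
  have hj2 : (p : ℝ) * c < j₀ + 1 := Nat.lt_floor_add_one _
  set q : ℝ := 52 * (k + 2) ^ 2 with hq
  have hq1 : 1 ≤ q := by
    rw [hq]
    nlinarith
  have h2p : (0 : ℝ) < 2 ^ p := by positivity
  -- the regimes before the critical one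
  have hearly : ∀ i, i < j₀ → i ≤ k - p → regimeRegret A E p i ≤ (L + q) * 2 ^ p := by
    intro i hi hik
    refine (regimeRegret_le_cell htie hp' E hα hL hE i).trans ?_
    have h1 := mossBound_le hpk hkp hik
    have h2 : (2 : ℝ) ^ (p + (i + 1)) * (L * (1 / (numCells p (i + 1) : ℝ)) ^ α) ≤ L * 2 ^ p := by
      have e1 : (1 / (numCells p (i + 1) : ℝ)) ^ α = 2 ^ (-(((p : ℝ) + 1 - i) * α)) := by
        have e2 : ((p + 2 - (i + 1) : ℕ) : ℝ) = p + 1 - i := by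
          have : p + 2 - (i + 1) + i = p + 1 := by omega
          have : ((p + 2 - (i + 1) : ℕ) : ℝ) + i = p + 1 := by exact_mod_cast this
          linarith
        rw [numCells, one_div, Nat.cast_pow, Nat.cast_ofNat, ← Real.rpow_natCast, e2,
          Real.inv_rpow (by positivity), ← Real.rpow_mul (by norm_num), ← Real.rpow_neg (by norm_num)]
      have hle : (2 : ℝ) ^ (i + 1) * 2 ^ (-(((p : ℝ) + 1 - i) * α)) ≤ 1 := by
        rw [← Real.rpow_natCast, ← Real.rpow_add (by norm_num)]
        refine Real.rpow_le_one_of_one_le_of_nonpos (by norm_num) ?_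
        have h3 : (i : ℝ) + 1 ≤ j₀ := by exact_mod_cast hi
        have h4 : ((i : ℝ) + 1) * (α + 1) ≤ p * α := by
          have h5 : (i : ℝ) + 1 ≤ p * α / (α + 1) := by
            rw [mul_div_assoc]
            exact h3.trans hj1
          rwa [le_div_iff₀ (by linarith)] at h5
        push_cast
        nlinarith
      rw [e1, pow_add]
      calc (2 : ℝ) ^ p * 2 ^ (i + 1) * (L * 2 ^ (-(((p : ℝ) + 1 - i) * α)))
          = L * 2 ^ p * (2 ^ (i + 1) * 2 ^ (-(((p : ℝ) + 1 - i) * α))) := by ring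
        _ ≤ L * 2 ^ p * 1 := by gcongr
        _ = _ := by ring
    linarith
  -- all regimes
  have hall : ∀ i, i ≤ k - p →
      regimeRegret A E p i ≤ 2 * (L + q) * (2 ^ p + 2 ^ (k + 1) * (2 ^ j₀)⁻¹) := by
    intro i hik
    have hpos : (0 : ℝ) ≤ 2 ^ (k + 1) * (2 ^ j₀)⁻¹ := by positivity
    rcases lt_or_ge i j₀ with hi | hi
    · refine (hearly i hi hik).trans ?_
      have : 0 ≤ (L + q) * 2 ^ p := by positivity
      have : 0 ≤ (L + q) * (2 ^ (k + 1) * (2 ^ j₀)⁻¹) := by positivity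
      linarith
    · have hpow : (2 : ℝ) ^ (i + 1 - j₀) * 2 ^ p ≤ 2 ^ (k + 1) * (2 ^ j₀)⁻¹ := by
        rw [le_mul_inv_iff₀ (by positivity), ← pow_add, ← pow_add]
        exact pow_le_pow_right₀ (by norm_num) (by omega)
      have hone : (1 : ℝ) ≤ 2 ^ (i + 1 - j₀) := one_le_pow₀ (by norm_num)
      suffices h : regimeRegret A E p i ≤ 2 * (L + q) * (2 ^ (i + 1 - j₀) * 2 ^ p) by
        refine h.trans ?_
        gcongr
        linarith
      -- If no regime is early there is no useful memory arm, but the trivial bound by the length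
      -- suffices. Otherwise the memory arm of index j₀ - 1, that is of regime j₀, is used.
      rcases Nat.eq_zero_or_pos j₀ with h0 | h0
      · refine (regimeRegret_le A E p i).trans ?_
        rw [h0, Nat.sub_zero, ← pow_add, add_comm (i + 1) p]
        exact le_mul_of_one_le_left (by positivity) (by linarith)
      · have h1 := regimeRegret_le_memory htie hp' E (i := i) (j := j₀ - 1) (by omega)
        have h2 := hearly (j₀ - 1) (by omega) (by omega)
        have h3 := mossBound_le hpk hkp hik
        rw [show i - (j₀ - 1) = i + 1 - j₀ by omega] at h1
        have h4 : q * 2 ^ p ≤ (L + q) * (2 ^ (i + 1 - j₀) * 2 ^ p) := by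
          refine mul_le_mul (by linarith) ?_ h2p.le (by positivity)
          exact le_mul_of_one_le_left h2p.le hone
        have h5 := mul_le_mul_of_nonneg_left h2 (by positivity : (0 : ℝ) ≤ 2 ^ (i + 1 - j₀))
        linarith
  have hend : 2 ^ k ≤ regimeEnd p (k - p + 1) := by
    rw [regimeEnd_succ]
    refine le_trans (Nat.pow_le_pow_right (by norm_num) ?_) (Nat.le_add_left _ _)
    omega
  refine (regret_mono A E hend).trans ?_
  rw [regret_regimeEnd]
  have hsum := Finset.sum_le_card_nsmul (Finset.range (k - p + 1)) (regimeRegret A E p) _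
    fun i hi => hall i (Nat.lt_succ_iff.1 (Finset.mem_range.1 hi))
  rw [Finset.card_range, nsmul_eq_mul] at hsum
  refine hsum.trans ?_
  set θ := theta m α with hθ
  have hpθ : (2 : ℝ) ^ p ≤ 2 * 2 ^ ((k : ℝ) * θ) := by
    have h1 : (k : ℝ) * m ≤ k * θ := mul_le_mul_of_nonneg_left (le_max_left _ _) hk0
    calc (2 : ℝ) ^ p = 2 ^ (p : ℝ) := (Real.rpow_natCast _ _).symm
      _ ≤ 2 ^ (1 + (k : ℝ) * θ) := Real.rpow_le_rpow_of_exponent_le (by norm_num) (by linarith)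
      _ = _ := by rw [Real.rpow_add (by norm_num), Real.rpow_one]
  -- Rounding loses one unit: j₀ > p c - 1 ≥ k m c - 1, so the exponent is at most 2 + k (1 - m c).
  have hjθ : (2 : ℝ) ^ (k + 1) * (2 ^ j₀)⁻¹ ≤ 4 * 2 ^ ((k : ℝ) * θ) := by
    have h1 : (k : ℝ) * (1 - m * c) ≤ k * θ := mul_le_mul_of_nonneg_left (le_max_right _ _) hk0
    have h2 : (k : ℝ) * m * c ≤ p * c := mul_le_mul_of_nonneg_right hp1 hc0.le
    calc (2 : ℝ) ^ (k + 1) * (2 ^ j₀)⁻¹ = 2 ^ ((k : ℝ) + 1 - j₀) := by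
          rw [Real.rpow_sub (by norm_num), Real.rpow_natCast, div_eq_mul_inv,
            Real.rpow_add_one (by norm_num), Real.rpow_natCast, pow_succ]
      _ ≤ 2 ^ (2 + (k : ℝ) * θ) := Real.rpow_le_rpow_of_exponent_le (by norm_num) (by linarith)
      _ = _ := by
          rw [Real.rpow_add (by norm_num)]
          norm_num
  have hkp1 : ((k - p + 1 : ℕ) : ℝ) ≤ k + 1 := by
    have : k - p + 1 ≤ k + 1 := by omega
    exact_mod_cast this
  calc ((k - p + 1 : ℕ) : ℝ) * (2 * (L + q) * (2 ^ p + 2 ^ (k + 1) * (2 ^ j₀)⁻¹))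
      ≤ (k + 1) * (2 * (L + q) * (2 * 2 ^ ((k : ℝ) * θ) + 4 * 2 ^ ((k : ℝ) * θ))) := by
        gcongr
    _ = _ := by ring

/-! ### The rate of the doubling trick -/

lemma theta_nonneg {m : ℝ} (hm : m ∈ Set.Icc (1 / 2 : ℝ) 1) (α : ℝ) : 0 ≤ theta m α :=
  le_max_of_le_left (by linarith [hm.1])

/-- All phases are bounded by the bound for the last one. The number of phases provides one of the
four factors k + 1. -/
lemma regret_doublingMeDZO_le {tie : Finset ℕ → ℕ}
    (htie : ∀ S : Finset ℕ, S.Nonempty → tie S ∈ S) {m : ℝ} (hm : m ∈ Set.Icc (1 / 2 : ℝ) 1)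
    (E : Environment) {L α : ℝ} (hα : 0 < α) (hL : 0 < L) (hE : E.f ∈ HolderClass L α) (k : ℕ) :
    regret (doublingMeDZO tie m) E (2 ^ k - 1)
      ≤ 12 * (L + 52) * (k + 1 : ℕ) ^ 4 * 2 ^ ((k : ℝ) * theta m α) := by
  have hθ := theta_nonneg hm α
  rw [doublingMeDZO, regret_doublingTrick]
  have h : ∀ j ∈ Finset.range k, regret (MeDZO tie ((2 : ℝ) ^ ((j : ℝ) * m))) E (2 ^ j)
      ≤ 12 * (k + 1) * (L + 52 * (k + 1) ^ 2) * 2 ^ ((k : ℝ) * theta m α) := by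
    intro j hj
    have hjk : (j : ℝ) + 1 ≤ k := by exact_mod_cast Finset.mem_range.1 hj
    have hj0 : (0 : ℝ) ≤ j := Nat.cast_nonneg j
    refine (regret_MeDZO_le htie hm E hα hL hE j).trans ?_
    have h1 : (52 : ℝ) * (j + 2) ^ 2 ≤ 52 * (k + 1) ^ 2 :=
      mul_le_mul_of_nonneg_left (pow_le_pow_left₀ (by linarith) (by linarith) 2) (by norm_num)
    have h2 : (j : ℝ) * theta m α ≤ k * theta m α :=
      mul_le_mul_of_nonneg_right (by linarith) hθ
    exact mul_le_mul (mul_le_mul (by linarith) (by linarith) (by positivity) (by positivity))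
      (Real.rpow_le_rpow_of_exponent_le one_le_two h2) (by positivity) (by positivity)
  refine (Finset.sum_le_card_nsmul _ _ _ h).trans ?_
  rw [Finset.card_range, nsmul_eq_mul, ← mul_assoc]
  have hk : (0 : ℝ) ≤ k := Nat.cast_nonneg k
  have hk1 : (1 : ℝ) ≤ (k + 1) ^ 2 := one_le_pow₀ (by linarith)
  refine mul_le_mul_of_nonneg_right ?_ (by positivity)
  push_cast
  calc (k : ℝ) * (12 * (k + 1) * (L + 52 * (k + 1) ^ 2))
      ≤ (k + 1) * (12 * (k + 1) * (L * (k + 1) ^ 2 + 52 * (k + 1) ^ 2)) :=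
        mul_le_mul (by linarith) (mul_le_mul_of_nonneg_left
          (by linarith [le_mul_of_one_le_right hL.le hk1]) (by positivity))
          (by positivity) (by positivity)
    _ = _ := by ring

lemma achieves_doublingMeDZO {tie : Finset ℕ → ℕ} (htie : ∀ S : Finset ℕ, S.Nonempty → tie S ∈ S)
    {m : ℝ} (hm : m ∈ Set.Icc (1 / 2 : ℝ) 1) : Achieves (doublingMeDZO tie m) (theta m) := by
  refine ⟨isRateFunction_theta hm, fun ε hε α L hα hL => ?_⟩
  have hθ0 := theta_nonneg hm α
  set θ := theta m α with hθ
  have hr : (1 : ℝ) < 2 ^ ε := Real.one_lt_rpow (by norm_num) hε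
  -- The factor (k + 1)^4 is polynomial in log T and is absorbed by 2^(εk), of order T^ε.
  obtain ⟨C, hC⟩ := (tendsto_pow_const_div_const_pow_of_one_lt 4 hr).bddAbove_range
  have hC' (n : ℕ) : (n : ℝ) ^ 4 ≤ C * ((2 : ℝ) ^ ε) ^ n := by
    have h := hC ⟨n, rfl⟩
    simp only at h
    rwa [div_le_iff₀ (by positivity)] at h
  have hC0 : 0 ≤ C := by
    have := hC' 0
    simpa using this
  set C₁ := 12 * (L + 52) * (C * 4 ^ ε * 2 ^ θ) with hC₁
  have hbound : ∀ T : ℕ, 0 < T → ∀ E : Environment, E.f ∈ HolderClass L α →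
      regret (doublingMeDZO tie m) E T ≤ C₁ * (T : ℝ) ^ (θ + ε) := by
    intro T hT E hE
    have hT' : (0 : ℝ) < T := by exact_mod_cast hT
    -- The horizon is rounded up to the end of the phases 0, …, k - 1, at the cost of constants
    -- since 2^k ≤ 2T and the regret is monotone in the horizon.
    set k := Nat.log 2 T + 1 with hk
    have h1 : T ≤ 2 ^ k - 1 := Nat.le_sub_one_of_lt (Nat.lt_pow_succ_log_self (by norm_num) T)
    have h2 : (2 : ℝ) ^ k ≤ 2 * T := by
      have h3 : 2 ^ k ≤ 2 * T := by
        rw [hk, pow_succ, mul_comm]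
        exact Nat.mul_le_mul_left 2 (Nat.pow_log_le_self 2 hT.ne')
      exact_mod_cast h3
    refine (regret_mono _ E h1).trans ((regret_doublingMeDZO_le htie hm E hα hL hE k).trans ?_)
    have h4 : (2 : ℝ) ^ ((k : ℝ) * θ) ≤ 2 ^ θ * (T : ℝ) ^ θ := by
      rw [Real.rpow_mul (by norm_num), Real.rpow_natCast, ← Real.mul_rpow (by norm_num) hT'.le]
      exact Real.rpow_le_rpow (by positivity) h2 hθ0
    have h5 : ((k + 1 : ℕ) : ℝ) ^ 4 ≤ C * (4 ^ ε * (T : ℝ) ^ ε) := by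
      refine (hC' (k + 1)).trans ?_
      gcongr
      rw [← Real.mul_rpow (by norm_num) hT'.le, ← Real.rpow_natCast, ← Real.rpow_mul (by norm_num),
        mul_comm ε, Real.rpow_mul (by norm_num), Real.rpow_natCast]
      refine Real.rpow_le_rpow (by positivity) ?_ hε.le
      rw [pow_succ]
      linarith
    calc 12 * (L + 52) * ((k + 1 : ℕ) : ℝ) ^ 4 * 2 ^ ((k : ℝ) * θ)
        ≤ 12 * (L + 52) * (C * (4 ^ ε * (T : ℝ) ^ ε)) * (2 ^ θ * (T : ℝ) ^ θ) := by gcongr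
      _ = C₁ * (T : ℝ) ^ (θ + ε) := by
        rw [Real.rpow_add hT', hC₁]
        ring
  refine lt_of_le_of_lt (limsup_le_of_le (a := ENNReal.ofReal C₁) (by isBoundedDefault) ?_)
    ENNReal.ofReal_lt_top
  filter_upwards [eventually_gt_atTop 0] with T hT
  refine ENNReal.div_le_of_le_mul ?_
  rw [← ENNReal.ofReal_mul (by positivity)]
  exact iSup₂_le fun E hE => ENNReal.ofReal_le_ofReal (hbound T hT E hE)

end

end XArmed

theorem corollary2 (tie : Finset ℕ → ℕ) (htie : ∀ S : Finset ℕ, S.Nonempty → tie S ∈ S)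
    (m : ℝ) (hm : m ∈ Set.Icc (1 / 2 : ℝ) 1) :
    XArmed.Achieves (XArmed.doublingMeDZO tie m) (XArmed.theta m) ∧
      (m < 1 →
        XArmed.AdmissibleRate (XArmed.theta m) ∧
          XArmed.Admissible (XArmed.doublingMeDZO tie m)) := by
  have hach := XArmed.achieves_doublingMeDZO htie hm
  refine ⟨hach, fun hm1 => ?_⟩
  have hadm : XArmed.AdmissibleRate (XArmed.theta m) :=
    ⟨⟨_, hach⟩, fun ⟨_, _, hA, hlt⟩ => XArmed.not_strictlySmaller_theta ⟨hm.1, hm1⟩ hA hlt⟩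
  exact ⟨hadm, _, hadm, hach⟩
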